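/- Let $k$ be a field of characteristic zero. All graded vector spaces are $\mathbb Z$-graded over $k$, $V[n]^p=V^{n+p}$, differentials have degree $1$, the Koszul sign rule is used throughout, $S(U)=\bigoplus_m S^m(U)$ is the free graded commutative algebra on a graded vector space $U$, and $\hbar$ is a formal variable of degree $2$. A dg BV algebra is a graded commutative algebra $V$ with linear operators $\Delta_1,\Delta_2$ of degrees $1$ and $-1$ that are differential operators of order $\le 1$ and $\le 2$ respectively, such that $\Delta=\Delta_1+\hbar\Delta_2$ satisfies $\Delta^2=0$ and $\Delta(1)=0$. It is pure if $V=S(U)$ for a graded vector space $U$, $\Delta_1$ maps $U$ to $U$, and $\Delta_2$ maps $U$ to $0$ and $S^2(U)$ to $U$. For a linear map $\varphi:S(U)\to S(U')[[\hbar]]$ with $\varphi(1)=0$ let $\exp(\varphi):S(U)[[\hbar]]\to S(U')[[\hbar]]$ be the continuous $k[[\hbar]]$-linear map with $\exp(\varphi)(1)=1$ and $$\exp(\varphi)(x_1\cdots x_m)=\sum_{j=1}^m\frac1{j!}\sum_{i_1+\dots+i_j=m,\ i_r\ge 1}\frac1{i_1!\cdots i_j!}\sum_{\sigma\in S_m}\pm\,\varphi(x_{\sigma(1)}\cdots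 x_{\sigma(i_1)})\cdots\varphi(x_{\sigma(m-i_j+1)}\cdots x_{\sigma(m)})$$ for $x_1,\dots,x_m\in U$, where $\pm$ is the Koszul sign; its inverse operation $\log$ is given by the same formula with $\frac{1}{j!}$ replaced by $\frac{(-1)^{j-1}}{j}$ and $\log(\Phi)(1)=0$. A pure $BV_\infty$-morphism $(S(U),\Delta)\to(S(U'),\Delta')$ is a linear map $\varphi=\frac1\hbar\sum_{n\ge1}\hbar^n\varphi_n:S(U)\to S(U')[[\hbar]]$ of degree $0$ with $\varphi(1)=0$ and $\exp(\varphi)\Delta=\Delta'\exp(\varphi)$, such that each $\varphi_n$ maps $S^n(U)$ to $U'$ and all other symmetric powers to $0$. Composition is $\psi\diamond\varphi=\log(\exp(\psi)\circ\exp(\varphi))$, and the identity of $S(U)$ is $\varphi=\varphi_1=\mathrm{id}_U$. For a dg Lie algebra $(\mathfrak g,d,[-,-])$ let $D_1,D_2$ be the coderivations of the shuffle coalgebra $S(\mathfrak g[1])$ that extend $l_1=d$ and $l_2(x,y)=(-1)^{|x|}[x,y]$, with $|x|$ the degree of $x$ in $\mathfrak g[1]$. An $L_\infty$-morphism $\mathfrak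 g\to\mathfrak g'$ is a morphism $\Phi:S(\mathfrak g[1])\to S(\mathfrak g'[1])$ of graded counital coalgebras with $\Phi(1)=1$ that commutes with the codifferentials $D_1+D_2$. Statement. Pure dg BV algebras with pure $BV_\infty$-morphisms, the composition $\diamond$ and the above identities form a category. For every dg Lie algebra $\mathfrak g$, the operators $\Delta_1=D_1$ and $\Delta_2=D_2$, transported along the double suspension $S(\mathfrak g[1])\cong S(\mathfrak g[-1])$, make $S(\mathfrak g[-1])$ a pure dg BV algebra. Assign to an $L_\infty$-morphism $\Phi:\mathfrak g\to\mathfrak g'$ the map $\varphi=\frac1\hbar\sum_{n\ge1}\hbar^n\varphi_n$ in which $\varphi_n$ is zero outside $S^n(\mathfrak g[-1])$ and is, on $S^n(\mathfrak g[-1])$, the projection of $\Phi$ to $\mathfrak g'$ (with degrees shifted accordingly). This assignment makes $\mathfrak g\mapsto S(\mathfrak g[-1])$ a functor, and that functor is an equivalence from the category of dg Lie algebras with $L_\infty$-morphisms to the category of pure dg BV algebras with pure $BV_\infty$-morphisms. -/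

import Mathlib

universe u v

noncomputable section

open DirectSum TensorProduct

section Grading
variable {k : Type u} [Field k] {M : Type v} [AddCommGroup M] [Module k M]

/-- The translate `V[n]` of a graded vector space: `V[n]^p = V^(n+p)`. -/
def gradedShift (n : ℤ) (𝒰 : ℤ → Submodule k M) : ℤ → Submodule k M := fun p => 𝒰 (n + p)

instance gradedShift.decomposition (n : ℤ) (𝒰 : ℤ → Submodule k M) [Decomposition 𝒰] :
    Decomposition (gradedShift n 𝒰) :=
  Decomposition.ofLinearMap (gradedShift n 𝒰)
    (DirectSum.toModule k ℤ (⨁ p, gradedShift n 𝒰 p)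
        (fun i => DirectSum.lof k ℤ (fun p => gradedShift n 𝒰 p) (i - n) ∘ₗ
          Submodule.inclusion (le_of_eq (congrArg 𝒰 (add_sub_cancel n i).symm))) ∘ₗ
      (decomposeLinearEquiv 𝒰).toLinearMap)
    (by
      apply decompose_lhom_ext 𝒰
      intro i
      ext x
      simp only [LinearMap.comp_apply, LinearEquiv.coe_coe, decomposeLinearEquiv_apply,
        Submodule.subtype_apply, decompose_coe, LinearMap.id_apply]
      rw [← DirectSum.lof_eq_of k, DirectSum.toModule_lof, LinearMap.comp_apply,
        DirectSum.coeLinearMap_lof]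
      rfl)
    (by
      ext i x : 2
      obtain ⟨x, hx⟩ := x
      simp only [LinearMap.comp_apply, LinearEquiv.coe_coe, decomposeLinearEquiv_apply,
        DirectSum.coeLinearMap_lof, LinearMap.id_apply]
      rw [decompose_of_mem 𝒰 (show x ∈ 𝒰 (n + i) from hx), ← DirectSum.lof_eq_of k,
        DirectSum.toModule_lof, LinearMap.comp_apply, DirectSum.lof_eq_of, DirectSum.lof_eq_of]
      apply DirectSum.of_eq_of_gradedMonoid_eq
      exact Sigma.subtype_ext (add_sub_cancel_left n i) rfl)

/-- The sign operator `x ↦ (-1)^(p * |x|) x` on a graded vector space. -/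
def gradeSign (𝒰 : ℤ → Submodule k M) [Decomposition 𝒰] (p : ℤ) : M →ₗ[k] M :=
  DirectSum.toModule k ℤ M (fun i => ((-1 : k) ^ (p * i)) • (𝒰 i).subtype) ∘ₗ
    (decomposeLinearEquiv 𝒰).toLinearMap

theorem gradeSign_of_mem (𝒰 : ℤ → Submodule k M) [Decomposition 𝒰] (p : ℤ) {i : ℤ} {x : M}
    (hx : x ∈ 𝒰 i) : gradeSign 𝒰 p x = ((-1 : k) ^ (p * i)) • x := by
  rw [gradeSign, LinearMap.comp_apply, LinearEquiv.coe_coe, decomposeLinearEquiv_apply,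
    decompose_of_mem 𝒰 hx, ← DirectSum.lof_eq_of k, DirectSum.toModule_lof]
  rfl

end Grading

section GrSym

variable {k : Type u} [Field k] {U : Type v} [AddCommGroup U] [Module k U]

/-- The relations `x y = (-1)^(|x||y|) y x` of graded commutativity. -/
inductive GrSym.Rel (𝒰 : ℤ → Submodule k U) : TensorAlgebra k U → TensorAlgebra k U → Prop
  | comm {i j : ℤ} {x y : U} (hx : x ∈ 𝒰 i) (hy : y ∈ 𝒰 j) :
      GrSym.Rel 𝒰 (TensorAlgebra.ι k x * TensorAlgebra.ι k y)
        (((-1 : k) ^ (i * j)) • (TensorAlgebra.ι k y * TensorAlgebra.ι k x))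

/-- The graded symmetric algebra `S(U)`, i.e. the free graded commutative algebra on the graded
vector space `(U, 𝒰)`. -/
def GrSym (𝒰 : ℤ → Submodule k U) : Type (max u v) := RingQuot (GrSym.Rel 𝒰)

namespace GrSym

instance instRing (𝒰 : ℤ → Submodule k U) : Ring (GrSym 𝒰) :=
  inferInstanceAs (Ring (RingQuot (GrSym.Rel 𝒰)))

instance instAlgebra (𝒰 : ℤ → Submodule k U) : Algebra k (GrSym 𝒰) :=
  inferInstanceAs (Algebra k (RingQuot (GrSym.Rel 𝒰)))

/-- The inclusion `U = S¹(U) ⊆ S(U)`. -/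
def ι (𝒰 : ℤ → Submodule k U) : U →ₗ[k] GrSym 𝒰 :=
  (RingQuot.mkAlgHom k (GrSym.Rel 𝒰)).toLinearMap ∘ₗ TensorAlgebra.ι k

theorem ι_mul_ι (𝒰 : ℤ → Submodule k U) {i j : ℤ} {x y : U} (hx : x ∈ 𝒰 i) (hy : y ∈ 𝒰 j) :
    ι 𝒰 x * ι 𝒰 y = ((-1 : k) ^ (i * j)) • (ι 𝒰 y * ι 𝒰 x) := by
  have h := RingQuot.mkAlgHom_rel k (GrSym.Rel.comm hx hy)
  rw [map_mul, map_smul, map_mul] at h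
  exact h

/-- The universal property of the free graded commutative algebra. -/
def lift (𝒰 : ℤ → Submodule k U) {A : Type*} [Semiring A] [Algebra k A] (f : U →ₗ[k] A)
    (hf : ∀ (i j : ℤ), ∀ x ∈ 𝒰 i, ∀ y ∈ 𝒰 j, f x * f y = ((-1 : k) ^ (i * j)) • (f y * f x)) :
    GrSym 𝒰 →ₐ[k] A :=
  RingQuot.liftAlgHom k ⟨TensorAlgebra.lift k f, by
    rintro _ _ ⟨hx, hy⟩
    rw [map_mul, map_smul, map_mul, TensorAlgebra.lift_ι_apply, TensorAlgebra.lift_ι_apply]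
    exact hf _ _ _ hx _ hy⟩

@[simp]
theorem lift_ι (𝒰 : ℤ → Submodule k U) {A : Type*} [Semiring A] [Algebra k A] (f : U →ₗ[k] A)
    (hf : ∀ (i j : ℤ), ∀ x ∈ 𝒰 i, ∀ y ∈ 𝒰 j, f x * f y = ((-1 : k) ^ (i * j)) • (f y * f x))
    (x : U) : lift 𝒰 f hf (ι 𝒰 x) = f x := by
  unfold lift ι
  erw [RingQuot.liftAlgHom_mkAlgHom_apply]
  simp

theorem algHom_ext (𝒰 : ℤ → Submodule k U) {A : Type*} [Semiring A] [Algebra k A]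
    {f g : GrSym 𝒰 →ₐ[k] A} (h : ∀ x, f (ι 𝒰 x) = g (ι 𝒰 x)) : f = g := by
  apply RingQuot.ringQuot_ext'
  apply TensorAlgebra.hom_ext
  ext x
  exact h x

theorem adjoin_ι (𝒰 : ℤ → Submodule k U) : Algebra.adjoin k (Set.range (ι 𝒰)) = ⊤ := by
  rw [eq_top_iff]
  intro a _
  obtain ⟨a, rfl⟩ := RingQuot.mkAlgHom_surjective k (GrSym.Rel 𝒰) a
  induction a using TensorAlgebra.induction with
  | algebraMap r => rw [AlgHom.commutes]; exact Subalgebra.algebraMap_mem _ r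
  | ι x => exact Algebra.subset_adjoin ⟨x, rfl⟩
  | mul a b ha hb => rw [map_mul]; exact mul_mem (ha trivial) (hb trivial)
  | add a b ha hb => rw [map_add]; exact add_mem (ha trivial) (hb trivial)

/-- A subspace that contains `1` and is stable under left multiplication by homogeneous elements
of `U` is everything. -/
theorem mem_of_mul_mem (𝒰 : ℤ → Submodule k U) [Decomposition 𝒰] (N : Submodule k (GrSym 𝒰))
    (h1 : 1 ∈ N) (hm : ∀ (i : ℤ), ∀ x ∈ 𝒰 i, ∀ a ∈ N, ι 𝒰 x * a ∈ N) (a : GrSym 𝒰) : a ∈ N := by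
  have hU : ∀ (x : U), ∀ a ∈ N, ι 𝒰 x * a ∈ N := by
    intro x
    induction x using Decomposition.inductionOn 𝒰 with
    | zero => intro a _; simp
    | homogeneous x => exact hm _ _ x.2
    | add x y hx hy => intro a ha; rw [map_add, add_mul]; exact add_mem (hx a ha) (hy a ha)
  have ha : a ∈ Algebra.adjoin k (Set.range (ι 𝒰)) := by rw [adjoin_ι]; trivial
  have key : ∀ b ∈ N, a * b ∈ N := by
    induction ha using Algebra.adjoin_induction with
    | mem a h => obtain ⟨x, rfl⟩ := h; exact hU x
    | algebraMap r => intro b hb; rw [← Algebra.smul_def]; exact N.smul_mem r hb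
    | add a c _ _ h1 h2 => intro b hb; rw [add_mul]; exact add_mem (h1 b hb) (h2 b hb)
    | mul a c _ _ h1 h2 => intro b hb; rw [mul_assoc]; exact h1 _ (h2 b hb)
  simpa using key 1 h1

theorem linearMap_ext (𝒰 : ℤ → Submodule k U) [Decomposition 𝒰] {M : Type*} [AddCommGroup M]
    [Module k M] {f g : GrSym 𝒰 →ₗ[k] M} (h1 : f 1 = g 1)
    (hm : ∀ (i : ℤ), ∀ x ∈ 𝒰 i, ∀ a, f a = g a → f (ι 𝒰 x * a) = g (ι 𝒰 x * a)) : f = g := by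
  ext a
  exact mem_of_mul_mem 𝒰 (LinearMap.eqLocus f g) h1 hm a

/-- The part of (internal) degree `n` of `S(U)`: the span of the products `x₁ ⋯ xₘ` of homogeneous
elements of `U` with `|x₁| + ⋯ + |xₘ| = n`. -/
def deg (𝒰 : ℤ → Submodule k U) (n : ℤ) : Submodule k (GrSym 𝒰) :=
  Submodule.span k {a | ∃ l : List (Σ i : ℤ, 𝒰 i),
    (l.map Sigma.fst).sum = n ∧ (l.map fun x => ι 𝒰 x.2).prod = a}

/-- The `m`-th symmetric power `Sᵐ(U)`, spanned by the products `x₁ ⋯ xₘ` with `xᵢ ∈ U`. -/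
def symPow (𝒰 : ℤ → Submodule k U) (m : ℕ) : Submodule k (GrSym 𝒰) :=
  LinearMap.range (ι 𝒰) ^ m

theorem ι_mem_deg (𝒰 : ℤ → Submodule k U) {i : ℤ} {x : U} (hx : x ∈ 𝒰 i) :
    ι 𝒰 x ∈ deg 𝒰 i :=
  Submodule.subset_span ⟨[⟨i, ⟨x, hx⟩⟩], by simp, by simp⟩

instance deg.gradedMonoid (𝒰 : ℤ → Submodule k U) : SetLike.GradedMonoid (deg 𝒰) where
  one_mem := Submodule.subset_span ⟨[], by simp, by simp⟩
  mul_mem i j a b ha hb := by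
    have h := Submodule.mul_mem_mul ha hb
    rw [deg, deg, Submodule.span_mul_span] at h
    refine Submodule.span_mono ?_ h
    rintro _ ⟨_, ⟨l, hl, rfl⟩, _, ⟨l', hl', rfl⟩, rfl⟩
    exact ⟨l ++ l', by simp [hl, hl'], by simp⟩

/-- The map `U → ⨁ₙ S(U)ₙ` that defines the decomposition into degrees. -/
def degι (𝒰 : ℤ → Submodule k U) [Decomposition 𝒰] : U →ₗ[k] ⨁ i, deg 𝒰 i :=
  DirectSum.toModule k ℤ _ (fun i => DirectSum.lof k ℤ (fun i => deg 𝒰 i) i ∘ₗ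
    ((ι 𝒰).restrict fun _ hx => ι_mem_deg 𝒰 hx)) ∘ₗ (decomposeLinearEquiv 𝒰).toLinearMap

theorem degι_of_mem (𝒰 : ℤ → Submodule k U) [Decomposition 𝒰] {i : ℤ} {x : U} (hx : x ∈ 𝒰 i) :
    degι 𝒰 x = DirectSum.of (fun i => deg 𝒰 i) i ⟨ι 𝒰 x, ι_mem_deg 𝒰 hx⟩ := by
  simp only [degι, LinearMap.comp_apply, LinearEquiv.coe_coe, decomposeLinearEquiv_apply,
    decompose_of_mem 𝒰 hx]
  rw [← DirectSum.lof_eq_of k, DirectSum.toModule_lof, ← DirectSum.lof_eq_of k]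
  rfl

theorem degι_comm (𝒰 : ℤ → Submodule k U) [Decomposition 𝒰] (i j : ℤ) (x : U) (hx : x ∈ 𝒰 i)
    (y : U) (hy : y ∈ 𝒰 j) :
    degι 𝒰 x * degι 𝒰 y = ((-1 : k) ^ (i * j)) • (degι 𝒰 y * degι 𝒰 x) := by
  rw [degι_of_mem 𝒰 hx, degι_of_mem 𝒰 hy, DirectSum.of_mul_of, DirectSum.of_mul_of,
    ← DirectSum.lof_eq_of k, ← DirectSum.lof_eq_of k, ← map_smul, DirectSum.lof_eq_of,
    DirectSum.lof_eq_of]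
  apply DirectSum.of_eq_of_gradedMonoid_eq
  refine Sigma.subtype_ext (add_comm _ _) ?_
  exact ι_mul_ι 𝒰 hx hy

instance deg.gradedAlgebra (𝒰 : ℤ → Submodule k U) [Decomposition 𝒰] : GradedAlgebra (deg 𝒰) :=
  GradedAlgebra.ofAlgHom _ (lift 𝒰 (degι 𝒰) (degι_comm 𝒰))
    (by
      apply algHom_ext 𝒰
      intro x
      induction x using Decomposition.inductionOn 𝒰 with
      | zero => simp
      | homogeneous x => simp [degι_of_mem 𝒰 x.2]
      | add x y hx hy => simp only [map_add, hx, hy])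
    (by
      rintro i ⟨a, ha⟩
      induction ha using Submodule.span_induction with
      | mem a h =>
        obtain ⟨l, rfl, rfl⟩ := h
        induction l with
        | nil => simp; rfl
        | cons x l ih =>
          dsimp only at ih ⊢
          simp only [List.map_cons, List.prod_cons, map_mul, lift_ι]
          rw [ih, degι_of_mem 𝒰 x.2.2, DirectSum.of_mul_of]
          apply DirectSum.of_eq_of_gradedMonoid_eq
          exact Sigma.subtype_ext List.sum_cons.symm rfl
      | zero => simp only [map_zero]; exact (map_zero _).symm
      | add a b ha hb h1 h2 =>
        simp only [map_add] at h1 h2 ⊢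
        rw [h1, h2, ← map_add]; rfl
      | smul r a ha h =>
        simp only [map_smul] at h ⊢
        rw [h, ← DirectSum.lof_eq_of k, ← map_smul]; rfl)

theorem ι_mem_symPow (𝒰 : ℤ → Submodule k U) (x : U) : ι 𝒰 x ∈ symPow 𝒰 1 := by
  rw [symPow, pow_one]; exact LinearMap.mem_range_self _ x

instance symPow.gradedMonoid (𝒰 : ℤ → Submodule k U) : SetLike.GradedMonoid (symPow 𝒰) :=
  inferInstanceAs (SetLike.GradedMonoid (fun m : ℕ => LinearMap.range (ι 𝒰) ^ m))

/-- The map `U → ⨁ₘ Sᵐ(U)` that defines the decomposition into symmetric powers. -/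
def symPowι (𝒰 : ℤ → Submodule k U) : U →ₗ[k] ⨁ m, symPow 𝒰 m :=
  DirectSum.lof k ℕ (fun m => symPow 𝒰 m) 1 ∘ₗ (ι 𝒰).codRestrict _ (ι_mem_symPow 𝒰)

theorem symPowι_comm (𝒰 : ℤ → Submodule k U) (i j : ℤ) (x : U) (hx : x ∈ 𝒰 i)
    (y : U) (hy : y ∈ 𝒰 j) :
    symPowι 𝒰 x * symPowι 𝒰 y = ((-1 : k) ^ (i * j)) • (symPowι 𝒰 y * symPowι 𝒰 x) := by
  simp only [symPowι, LinearMap.comp_apply, DirectSum.lof_eq_of]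
  rw [DirectSum.of_mul_of, DirectSum.of_mul_of, ← DirectSum.lof_eq_of k, ← DirectSum.lof_eq_of k,
    ← map_smul]
  congr 1
  exact Subtype.ext (ι_mul_ι 𝒰 hx hy)

instance symPow.gradedAlgebra (𝒰 : ℤ → Submodule k U) : GradedAlgebra (symPow 𝒰) :=
  GradedAlgebra.ofAlgHom _ (lift 𝒰 (symPowι 𝒰) (symPowι_comm 𝒰))
    (by
      apply algHom_ext 𝒰
      intro x
      simp [symPowι, DirectSum.lof_eq_of])
    (by
      rintro i ⟨a, ha⟩
      unfold symPow at ha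
      induction ha using Submodule.pow_induction_on_left' with
      | algebraMap r => simp only [AlgHom.commutes, DirectSum.algebraMap_apply]; rfl
      | add x y i hx hy ihx ihy =>
        simp only [map_add] at ihx ihy ⊢
        rw [ihx, ihy, ← map_add]; rfl
      | mem_mul m hm i x hx ih =>
        obtain ⟨y, rfl⟩ := hm
        simp only [map_mul, lift_ι] at ih ⊢
        rw [ih, symPowι, LinearMap.comp_apply, DirectSum.lof_eq_of, DirectSum.of_mul_of]
        exact DirectSum.of_eq_of_gradedMonoid_eq (Sigma.subtype_ext (add_comm _ _) rfl))

/-- `x ⊗ 1 + 1 ⊗ x`. -/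
def comulι (𝒰 : ℤ → Submodule k U) [Decomposition 𝒰] :
    U →ₗ[k] GradedTensorProduct k (deg 𝒰) (deg 𝒰) :=
  (GradedTensorProduct.includeLeft (deg 𝒰) (deg 𝒰)).toLinearMap ∘ₗ ι 𝒰 +
    (GradedTensorProduct.includeRight (deg 𝒰) (deg 𝒰)).toLinearMap ∘ₗ ι 𝒰

theorem uzpow_smul {M : Type*} [AddCommGroup M] [Module k M] (n : ℤ) (x : M) :
    ((-1 : ℤˣ) ^ n) • x = ((-1 : k) ^ n) • x := by
  rcases Int.even_or_odd n with h | h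
  · rw [h.neg_one_zpow, h.neg_one_zpow]; simp
  · rw [h.neg_one_zpow, h.neg_one_zpow]; simp

/-- Left multiplication by `x ⊗ 1 + 1 ⊗ x`, for `x ∈ U` of degree `i`. -/
def comulStep (𝒰 : ℤ → Submodule k U) [Decomposition 𝒰] (i : ℤ) (x : U) :
    GrSym 𝒰 ⊗[k] GrSym 𝒰 →ₗ[k] GrSym 𝒰 ⊗[k] GrSym 𝒰 :=
  TensorProduct.map (LinearMap.mulLeft k (ι 𝒰 x)) LinearMap.id +
    TensorProduct.map (gradeSign (deg 𝒰) i) (LinearMap.mulLeft k (ι 𝒰 x))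

theorem comulStep_tmul (𝒰 : ℤ → Submodule k U) [Decomposition 𝒰] (i : ℤ) (x : U) (a b : GrSym 𝒰) :
    comulStep 𝒰 i x (a ⊗ₜ b) =
      (ι 𝒰 x * a) ⊗ₜ b + gradeSign (deg 𝒰) i a ⊗ₜ (ι 𝒰 x * b) := by
  simp [comulStep]

theorem comulι_mul (𝒰 : ℤ → Submodule k U) [Decomposition 𝒰] {i : ℤ} {x : U} (hx : x ∈ 𝒰 i)
    (t : GrSym 𝒰 ⊗[k] GrSym 𝒰) :
    comulι 𝒰 x * GradedTensorProduct.of k (deg 𝒰) (deg 𝒰) t =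
      GradedTensorProduct.of k (deg 𝒰) (deg 𝒰) (comulStep 𝒰 i x t) := by
  induction t using TensorProduct.induction_on with
  | zero => simp
  | add s t hs ht => rw [map_add, mul_add, hs, ht, map_add, map_add]
  | tmul a b =>
    induction a using Decomposition.inductionOn (deg 𝒰) with
    | zero => simp
    | add a c ha hc =>
      rw [TensorProduct.add_tmul, map_add, mul_add, ha, hc, map_add, map_add]
    | @homogeneous j a =>
      have h1 := GradedTensorProduct.tmul_one_mul_coe_tmul (R := k) (deg 𝒰) (deg 𝒰) (ι 𝒰 x) a b
      have h2 := GradedTensorProduct.tmul_coe_mul_coe_tmul (R := k) (deg 𝒰) (deg 𝒰) 1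
        ⟨ι 𝒰 x, ι_mem_deg 𝒰 hx⟩ a b
      simp only [comulι, LinearMap.add_apply, LinearMap.comp_apply, AlgHom.toLinearMap_apply,
        GradedTensorProduct.includeLeft_apply, GradedTensorProduct.includeRight_apply, add_mul,
        comulStep_tmul, map_add]
      rw [h1, h2, gradeSign_of_mem (deg 𝒰) i a.2, one_mul, ← TensorProduct.smul_tmul', map_smul]
      congr 1
      exact uzpow_smul (i * j) _

theorem gradeSign_one (𝒰 : ℤ → Submodule k U) [Decomposition 𝒰] (p : ℤ) :
    gradeSign (deg 𝒰) p (1 : GrSym 𝒰) = 1 := by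
  rw [gradeSign_of_mem (deg 𝒰) p (SetLike.GradedOne.one_mem)]; simp

theorem comulι_comm (𝒰 : ℤ → Submodule k U) [Decomposition 𝒰] (i j : ℤ) (x : U) (hx : x ∈ 𝒰 i)
    (y : U) (hy : y ∈ 𝒰 j) :
    comulι 𝒰 x * comulι 𝒰 y = ((-1 : k) ^ (i * j)) • (comulι 𝒰 y * comulι 𝒰 x) := by
  have h1 := comulι_mul 𝒰 hx (ι 𝒰 y ⊗ₜ 1 + 1 ⊗ₜ ι 𝒰 y)
  have h2 := comulι_mul 𝒰 hy (ι 𝒰 x ⊗ₜ 1 + 1 ⊗ₜ ι 𝒰 x)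
  have h0 : ∀ z, GradedTensorProduct.of k (deg 𝒰) (deg 𝒰) (ι 𝒰 z ⊗ₜ 1 + 1 ⊗ₜ ι 𝒰 z) =
    comulι 𝒰 z := fun z => rfl
  rw [h0] at h1 h2
  rw [h1, h2, ← map_smul]
  congr 1
  have hs : ((-1 : k) ^ (i * j)) * ((-1 : k) ^ (i * j)) = 1 := by
    rw [← mul_zpow]; simp
  simp only [map_add, comulStep_tmul, mul_one, gradeSign_one,
    gradeSign_of_mem (deg 𝒰) _ (ι_mem_deg 𝒰 hx),
    gradeSign_of_mem (deg 𝒰) _ (ι_mem_deg 𝒰 hy), smul_add, ← TensorProduct.smul_tmul']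
  rw [ι_mul_ι 𝒰 hx hy, ← TensorProduct.smul_tmul', TensorProduct.tmul_smul, mul_comm j i,
    smul_smul, hs, one_smul]
  abel

/-- The shuffle comultiplication of `S(U)` as a morphism of algebras into the graded tensor product:
the one with `x ↦ x ⊗ 1 + 1 ⊗ x` for `x ∈ U`. Multiplying out `∏ (xᵢ ⊗ 1 + 1 ⊗ xᵢ)` gives the signed
sum over all shuffles. -/
def comulAlgHom (𝒰 : ℤ → Submodule k U) [Decomposition 𝒰] :
    GrSym 𝒰 →ₐ[k] GradedTensorProduct k (deg 𝒰) (deg 𝒰) :=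
  lift 𝒰 (comulι 𝒰) (comulι_comm 𝒰)

/-- The comultiplication of `S(U)`. -/
def comulLin (𝒰 : ℤ → Submodule k U) [Decomposition 𝒰] :
    GrSym 𝒰 →ₗ[k] GrSym 𝒰 ⊗[k] GrSym 𝒰 :=
  (GradedTensorProduct.of k (deg 𝒰) (deg 𝒰)).symm.toLinearMap ∘ₗ (comulAlgHom 𝒰).toLinearMap

/-- The augmentation of `S(U)`: the algebra morphism to `k` that is zero on `U`. -/
def counitAlgHom (𝒰 : ℤ → Submodule k U) : GrSym 𝒰 →ₐ[k] k :=
  lift 𝒰 0 (by simp)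

theorem counitAlgHom_ι (𝒰 : ℤ → Submodule k U) (x : U) : counitAlgHom 𝒰 (ι 𝒰 x) = 0 :=
  lift_ι 𝒰 _ _ x

theorem comulLin_one (𝒰 : ℤ → Submodule k U) [Decomposition 𝒰] :
    comulLin 𝒰 1 = 1 ⊗ₜ 1 := by
  simp only [comulLin, LinearMap.comp_apply, AlgHom.toLinearMap_apply, map_one]
  rfl

theorem comulLin_ι_mul (𝒰 : ℤ → Submodule k U) [Decomposition 𝒰] {i : ℤ} {x : U} (hx : x ∈ 𝒰 i)
    (a : GrSym 𝒰) : comulLin 𝒰 (ι 𝒰 x * a) = comulStep 𝒰 i x (comulLin 𝒰 a) := by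
  have h := comulι_mul 𝒰 hx (comulLin 𝒰 a)
  simp only [comulLin, LinearMap.comp_apply, AlgHom.toLinearMap_apply, map_mul, LinearEquiv.coe_coe,
    LinearEquiv.apply_symm_apply] at h ⊢
  rw [LinearEquiv.symm_apply_eq, ← h]
  congr 1
  exact lift_ι 𝒰 _ _ x

theorem gradeSign_ι_mul (𝒰 : ℤ → Submodule k U) [Decomposition 𝒰] (p : ℤ) {i : ℤ} {x : U}
    (hx : x ∈ 𝒰 i) (a : GrSym 𝒰) :
    gradeSign (deg 𝒰) p (ι 𝒰 x * a) = ((-1 : k) ^ (p * i)) • (ι 𝒰 x * gradeSign (deg 𝒰) p a) := by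
  induction a using Decomposition.inductionOn (deg 𝒰) with
  | zero => simp
  | add a b ha hb => rw [mul_add, map_add, ha, hb, map_add, mul_add, smul_add]
  | @homogeneous j a =>
    rw [gradeSign_of_mem (deg 𝒰) p (SetLike.GradedMul.mul_mem (ι_mem_deg 𝒰 hx) a.2),
      gradeSign_of_mem (deg 𝒰) p a.2, mul_smul_comm, smul_smul, mul_add,
      zpow_add₀ (by simp : (-1 : k) ≠ 0)]

theorem gradeSign_comm (𝒰 : ℤ → Submodule k U) [Decomposition 𝒰] (p q : ℤ) (a : GrSym 𝒰) :
    gradeSign (deg 𝒰) p (gradeSign (deg 𝒰) q a) = gradeSign (deg 𝒰) q (gradeSign (deg 𝒰) p a) := by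
  induction a using Decomposition.inductionOn (deg 𝒰) with
  | zero => simp
  | add a b ha hb => simp only [map_add, ha, hb]
  | @homogeneous j a =>
    simp only [gradeSign_of_mem (deg 𝒰) _ a.2, map_smul, smul_smul, mul_comm]

theorem counitAlgHom_gradeSign (𝒰 : ℤ → Submodule k U) [Decomposition 𝒰] (p : ℤ) (a : GrSym 𝒰) :
    counitAlgHom 𝒰 (gradeSign (deg 𝒰) p a) = counitAlgHom 𝒰 a := by
  revert a
  apply LinearMap.congr_fun (f := (counitAlgHom 𝒰).toLinearMap ∘ₗ gradeSign (deg 𝒰) p)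
    (g := (counitAlgHom 𝒰).toLinearMap)
  apply linearMap_ext 𝒰
  · simp [gradeSign_one]
  · intro i x hx a _
    simp [gradeSign_ι_mul 𝒰 p hx, counitAlgHom_ι]

theorem comulLin_gradeSign (𝒰 : ℤ → Submodule k U) [Decomposition 𝒰] (p : ℤ) (a : GrSym 𝒰) :
    comulLin 𝒰 (gradeSign (deg 𝒰) p a) =
      TensorProduct.map (gradeSign (deg 𝒰) p) (gradeSign (deg 𝒰) p) (comulLin 𝒰 a) := by
  revert a
  apply LinearMap.congr_fun (f := comulLin 𝒰 ∘ₗ gradeSign (deg 𝒰) p)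
    (g := TensorProduct.map (gradeSign (deg 𝒰) p) (gradeSign (deg 𝒰) p) ∘ₗ comulLin 𝒰)
  apply linearMap_ext 𝒰
  · simp [comulLin_one, gradeSign_one]
  · intro i x hx a ha
    simp only [LinearMap.comp_apply] at ha ⊢
    rw [gradeSign_ι_mul 𝒰 p hx, map_smul, comulLin_ι_mul 𝒰 hx, ha, comulLin_ι_mul 𝒰 hx]
    generalize comulLin 𝒰 a = t
    induction t using TensorProduct.induction_on with
    | zero => simp
    | add s t hs ht => simp only [map_add, smul_add] at hs ht ⊢; rw [hs, ht]
    | tmul b c =>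
      simp only [comulStep_tmul, map_add, TensorProduct.map_tmul, gradeSign_ι_mul 𝒰 p hx, smul_add,
        TensorProduct.tmul_smul, ← TensorProduct.smul_tmul', gradeSign_comm 𝒰 i p]

theorem comulLin_coassoc (𝒰 : ℤ → Submodule k U) [Decomposition 𝒰] :
    (TensorProduct.assoc k (GrSym 𝒰) (GrSym 𝒰) (GrSym 𝒰)).toLinearMap ∘ₗ
        (comulLin 𝒰).rTensor (GrSym 𝒰) ∘ₗ comulLin 𝒰 =
      (comulLin 𝒰).lTensor (GrSym 𝒰) ∘ₗ comulLin 𝒰 := by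
  apply linearMap_ext 𝒰
  · simp [comulLin_one]
  · intro i x hx a ha
    set N : GrSym 𝒰 ⊗[k] (GrSym 𝒰 ⊗[k] GrSym 𝒰) →ₗ[k] GrSym 𝒰 ⊗[k] (GrSym 𝒰 ⊗[k] GrSym 𝒰) :=
      TensorProduct.map (LinearMap.mulLeft k (ι 𝒰 x)) LinearMap.id +
        TensorProduct.map (gradeSign (deg 𝒰) i) (comulStep 𝒰 i x) with hN
    have key1 : ∀ t : GrSym 𝒰 ⊗[k] GrSym 𝒰, (comulLin 𝒰).lTensor (GrSym 𝒰) (comulStep 𝒰 i x t) =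
        N ((comulLin 𝒰).lTensor (GrSym 𝒰) t) := by
      intro t
      induction t using TensorProduct.induction_on with
      | zero => simp
      | add s t hs ht => simp only [map_add] at hs ht ⊢; rw [hs, ht]
      | tmul b c => simp [comulStep_tmul, comulLin_ι_mul 𝒰 hx, hN]
    have key2 : ∀ (s : GrSym 𝒰 ⊗[k] GrSym 𝒰) (c : GrSym 𝒰),
        (TensorProduct.assoc k (GrSym 𝒰) (GrSym 𝒰) (GrSym 𝒰)) (comulStep 𝒰 i x s ⊗ₜ c +
          TensorProduct.map (gradeSign (deg 𝒰) i) (gradeSign (deg 𝒰) i) s ⊗ₜ (ι 𝒰 x * c)) =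
        N ((TensorProduct.assoc k (GrSym 𝒰) (GrSym 𝒰) (GrSym 𝒰)) (s ⊗ₜ c)) := by
      intro s c
      induction s using TensorProduct.induction_on with
      | zero => simp
      | add s t hs ht =>
        simp only [map_add, TensorProduct.add_tmul] at hs ht ⊢
        rw [← hs, ← ht]; abel
      | tmul a b =>
        simp [comulStep_tmul, hN, TensorProduct.add_tmul, TensorProduct.tmul_add, add_assoc]
    have key3 : ∀ t : GrSym 𝒰 ⊗[k] GrSym 𝒰,
        (TensorProduct.assoc k (GrSym 𝒰) (GrSym 𝒰) (GrSym 𝒰))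
          ((comulLin 𝒰).rTensor (GrSym 𝒰) (comulStep 𝒰 i x t)) =
        N ((TensorProduct.assoc k (GrSym 𝒰) (GrSym 𝒰) (GrSym 𝒰))
          ((comulLin 𝒰).rTensor (GrSym 𝒰) t)) := by
      intro t
      induction t using TensorProduct.induction_on with
      | zero => simp
      | add s t hs ht => simp only [map_add] at hs ht ⊢; rw [hs, ht]
      | tmul b c =>
        rw [comulStep_tmul, map_add, LinearMap.rTensor_tmul, LinearMap.rTensor_tmul,
          LinearMap.rTensor_tmul, comulLin_ι_mul 𝒰 hx, comulLin_gradeSign, key2]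
    simp only [LinearMap.comp_apply, LinearEquiv.coe_coe] at ha ⊢
    rw [comulLin_ι_mul 𝒰 hx, key3, ha, key1]

/-- The graded cocommutative coalgebra `S(U)`. -/
instance instCoalgebra (𝒰 : ℤ → Submodule k U) [Decomposition 𝒰] : Coalgebra k (GrSym 𝒰) where
  comul := comulLin 𝒰
  counit := (counitAlgHom 𝒰).toLinearMap
  coassoc := comulLin_coassoc 𝒰
  rTensor_counit_comp_comul := by
    apply linearMap_ext 𝒰
    · simp [comulLin_one]
    · intro i x hx a ha
      have key : ∀ t : GrSym 𝒰 ⊗[k] GrSym 𝒰,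
          (counitAlgHom 𝒰).toLinearMap.rTensor (GrSym 𝒰) (comulStep 𝒰 i x t) =
          (LinearMap.mulLeft k (ι 𝒰 x)).lTensor k
            ((counitAlgHom 𝒰).toLinearMap.rTensor (GrSym 𝒰) t) := by
        intro t
        induction t using TensorProduct.induction_on with
        | zero => simp
        | add s t hs ht => simp only [map_add] at hs ht ⊢; rw [hs, ht]
        | tmul b c => simp [comulStep_tmul, counitAlgHom_ι, counitAlgHom_gradeSign]
      simp only [LinearMap.comp_apply] at ha ⊢
      rw [comulLin_ι_mul 𝒰 hx, key, ha]
      simp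
  lTensor_counit_comp_comul := by
    apply linearMap_ext 𝒰
    · simp [comulLin_one]
    · intro i x hx a ha
      have key : ∀ t : GrSym 𝒰 ⊗[k] GrSym 𝒰,
          (counitAlgHom 𝒰).toLinearMap.lTensor (GrSym 𝒰) (comulStep 𝒰 i x t) =
          (LinearMap.mulLeft k (ι 𝒰 x)).rTensor k
            ((counitAlgHom 𝒰).toLinearMap.lTensor (GrSym 𝒰) t) := by
        intro t
        induction t using TensorProduct.induction_on with
        | zero => simp
        | add s t hs ht => simp only [map_add] at hs ht ⊢; rw [hs, ht]
        | tmul b c => simp [comulStep_tmul, counitAlgHom_ι]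
      simp only [LinearMap.comp_apply] at ha ⊢
      rw [comulLin_ι_mul 𝒰 hx, key, ha]
      simp

/-- For a bilinear `l : U × U → U`, the action `x · (c, u, w) = (0, c x, l(x, u))` of `U` on
`k ⊕ U ⊕ U`. -/
def quadAct (l : U →ₗ[k] U →ₗ[k] U) : U →ₗ[k] Module.End k (k × U × U) where
  toFun x :=
    { toFun := fun p => (0, p.1 • x, l x p.2.1)
      map_add' := fun p q => by simp [add_smul]
      map_smul' := fun r p => by simp [mul_smul] }
  map_add' x y := by ext <;> simp
  map_smul' r x := by ext <;> simp

/-- Graded symmetry of a bilinear operation on `(U, 𝒰)`. -/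
def GradedSymm (𝒰 : ℤ → Submodule k U) (l : U →ₗ[k] U →ₗ[k] U) : Prop :=
  ∀ (i j : ℤ), ∀ x ∈ 𝒰 i, ∀ y ∈ 𝒰 j, l x y = ((-1 : k) ^ (i * j)) • l y x

theorem quadAct_comm (𝒰 : ℤ → Submodule k U) (l : U →ₗ[k] U →ₗ[k] U) (hl : GradedSymm 𝒰 l)
    (i j : ℤ) (x : U) (hx : x ∈ 𝒰 i) (y : U) (hy : y ∈ 𝒰 j) :
    quadAct l x * quadAct l y = ((-1 : k) ^ (i * j)) • (quadAct l y * quadAct l x) := by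
  apply LinearMap.ext
  rintro ⟨c, u, w⟩
  simp [quadAct, hl i j x hx y hy, smul_comm c]

/-- The action of `S(U)` on `k ⊕ U ⊕ U` that extends `quadAct`. -/
def quadLift (𝒰 : ℤ → Submodule k U) (l : U →ₗ[k] U →ₗ[k] U) (hl : GradedSymm 𝒰 l) :
    GrSym 𝒰 →ₐ[k] Module.End k (k × U × U) :=
  lift 𝒰 (quadAct l) (quadAct_comm 𝒰 l hl)

/-- The linear map `S(U) → U` that is `x y ↦ l(x, y)` on `S²(U)` and zero on the other symmetric
powers, for a graded symmetric bilinear `l`. -/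
def extendTwo (𝒰 : ℤ → Submodule k U) (l : U →ₗ[k] U →ₗ[k] U) (hl : GradedSymm 𝒰 l) :
    GrSym 𝒰 →ₗ[k] U :=
  LinearMap.snd k U U ∘ₗ LinearMap.snd k k (U × U) ∘ₗ
    LinearMap.applyₗ ((1, 0, 0) : k × U × U) ∘ₗ (quadLift 𝒰 l hl).toLinearMap

/-- The projection `p₁ : S(U) → U` to the linear component. -/
def proj (𝒰 : ℤ → Submodule k U) : GrSym 𝒰 →ₗ[k] U :=
  LinearMap.fst k U U ∘ₗ LinearMap.snd k k (U × U) ∘ₗ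
    LinearMap.applyₗ ((1, 0, 0) : k × U × U) ∘ₗ
      (quadLift 𝒰 0 (fun _ _ _ _ _ _ => by simp)).toLinearMap

theorem extendTwo_ι_mul_ι (𝒰 : ℤ → Submodule k U) (l : U →ₗ[k] U →ₗ[k] U) (hl : GradedSymm 𝒰 l)
    (x y : U) : extendTwo 𝒰 l hl (ι 𝒰 x * ι 𝒰 y) = l x y := by
  simp [extendTwo, quadLift, quadAct]

theorem proj_ι (𝒰 : ℤ → Submodule k U) (x : U) : proj 𝒰 (ι 𝒰 x) = x := by
  simp [proj, quadLift, quadAct]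

/-- The linear map on `S(U)` that agrees with `T m` on `Sᵐ(U)`, for every `m`. -/
def assemble (𝒰 : ℤ → Submodule k U) {B : Type*} [AddCommGroup B] [Module k B]
    (T : ℕ → GrSym 𝒰 →ₗ[k] B) : GrSym 𝒰 →ₗ[k] B :=
  DirectSum.toModule k ℕ B (fun m => T m ∘ₗ (symPow 𝒰 m).subtype) ∘ₗ
    (decomposeLinearEquiv (symPow 𝒰)).toLinearMap

/-- The projection of `S(U)` to `Sⁿ(U)`. -/
def projPow (𝒰 : ℤ → Submodule k U) (n : ℕ) : GrSym 𝒰 →ₗ[k] GrSym 𝒰 :=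
  GradedAlgebra.proj (symPow 𝒰) n

/-- The coderivation of `S(U)` with projection `l : S(U) → U` to the cogenerators, namely
`μ ∘ (l ⊗ id) ∘ δ`: if `l` vanishes outside `Sⁿ(U)`, it sends `x₁ ⋯ xₘ` to
`∑ ± l(x_σ(1) ⋯ x_σ(n)) x_σ(n+1) ⋯ x_σ(m)`, the sum over the `(n, m - n)`-shuffles `σ`. -/
def coder (𝒰 : ℤ → Submodule k U) [Decomposition 𝒰] (l : GrSym 𝒰 →ₗ[k] U) :
    GrSym 𝒰 →ₗ[k] GrSym 𝒰 :=
  LinearMap.mul' k (GrSym 𝒰) ∘ₗ TensorProduct.map (ι 𝒰 ∘ₗ l) LinearMap.id ∘ₗ Coalgebra.comul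

/-- The exponential of `φ : S(U) → B` (with `φ 1 = 0`): on `Sᵐ(U)` it is `∑_{j ≤ m} φ^j / j!`, where
powers are taken for the convolution product `φ * ψ = μ ∘ (φ ⊗ ψ) ∘ δ`. Thus
`φ^j (x₁ ⋯ xₘ) = ∑ ± φ(x_σ(1) ⋯ x_σ(i₁)) ⋯ φ(x_σ(m - iⱼ + 1) ⋯ x_σ(m))`, over all
`i₁ + ⋯ + iⱼ = m` and all `(i₁, …, iⱼ)`-shuffles `σ`; equivalently, over all `σ ∈ Sₘ` with weights
`1 / (i₁! ⋯ iⱼ!)`. -/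
def exp (𝒰 : ℤ → Submodule k U) [Decomposition 𝒰] {B : Type*} [Ring B] [Algebra k B]
    (φ : GrSym 𝒰 →ₗ[k] B) : GrSym 𝒰 →ₗ[k] B :=
  assemble 𝒰 fun m =>
    ∑ j ∈ Finset.range (m + 1), (j.factorial : k)⁻¹ • ((WithConv.toConv φ) ^ j).ofConv

/-- The logarithm of `Φ : S(U) → B` (with `Φ 1 = 1`): on `Sᵐ(U)` it is
`∑_{1 ≤ j ≤ m} (-1)^(j-1) / j • (Φ - 1)^j`, where powers are taken for the convolution product and
`1` is its unit; note that `Φ - 1` vanishes at `1` and agrees with `Φ` on `Sⁱ(U)` for `i ≥ 1`. -/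
def log (𝒰 : ℤ → Submodule k U) [Decomposition 𝒰] {B : Type*} [Ring B] [Algebra k B]
    (Φ : GrSym 𝒰 →ₗ[k] B) : GrSym 𝒰 →ₗ[k] B :=
  assemble 𝒰 fun m =>
    ∑ j ∈ Finset.Icc 1 m,
      ((-1 : k) ^ (j - 1) * (j : k)⁻¹) • ((WithConv.toConv Φ - 1) ^ j).ofConv

end GrSym
end GrSym

section Hbar

variable {k : Type u} [Field k] {V : Type*} [Ring V] [Algebra k V] {B : Type*} [Ring B]
  [Algebra k B]

/-- The map `(1 / ħ) ∑_{n ≥ 1} ħⁿ aₙ : V → B[[ħ]]`; the value `a 0` plays no role. -/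
def hbarSum (a : ℕ → V →ₗ[k] B) : V →ₗ[k] PowerSeries B where
  toFun v := PowerSeries.mk fun n => a (n + 1) v
  map_add' v w := by ext n; simp
  map_smul' r v := by ext n; simp

/-- The continuous `k[[ħ]]`-linear extension `V[[ħ]] → B[[ħ]]` of `f : V → B[[ħ]]`. -/
def hbarExt (f : V →ₗ[k] PowerSeries B) : PowerSeries V →ₗ[k] PowerSeries B where
  toFun v := PowerSeries.mk fun n =>
    ∑ p ∈ Finset.HasAntidiagonal.antidiagonal n, PowerSeries.coeff p.1 (f (PowerSeries.coeff p.2 v))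
  map_add' v w := by ext n; simp [Finset.sum_add_distrib]
  map_smul' r v := by ext n; simp [Finset.smul_sum]

/-- `f : V → B[[ħ]]` has degree `d`, where `ħ` has degree `2`. -/
def HbarDegree (𝒱 : ℤ → Submodule k V) (ℬ : ℤ → Submodule k B) (d : ℤ)
    (f : V →ₗ[k] PowerSeries B) : Prop :=
  ∀ (i : ℤ), ∀ a ∈ 𝒱 i, ∀ n : ℕ, PowerSeries.coeff n (f a) ∈ ℬ (i + d - 2 * n)

/-- The graded commutator `[D, L_a]` of an operator `D` of degree `p` and left multiplication by an
element `a` of degree `i`. -/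
def gradedCommLeft (p : ℤ) (D : V →ₗ[k] V) (i : ℤ) (a : V) : V →ₗ[k] V :=
  D ∘ₗ LinearMap.mulLeft k a - ((-1 : k) ^ (p * i)) • (LinearMap.mulLeft k a ∘ₗ D)

/-- `D`, an operator of degree `p` on the graded commutative algebra `(V, 𝒱)`, is a differential
operator of order `≤ n`: all `[[…[D, L_{a₀}], …], L_{aₙ}]` vanish. -/
def IsDiffOp (𝒱 : ℤ → Submodule k V) : ℕ → ℤ → (V →ₗ[k] V) → Prop
  | 0, p, D => ∀ (i : ℤ), ∀ a ∈ 𝒱 i, gradedCommLeft p D i a = 0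
  | n + 1, p, D => ∀ (i : ℤ), ∀ a ∈ 𝒱 i, IsDiffOp 𝒱 n (p + i) (gradedCommLeft p D i a)

/-- `Δ = (1 / ħ) ∑_{n ≥ 1} ħⁿ Δₙ` makes the graded commutative algebra `(V, 𝒱)` a `BV∞`-algebra. -/
structure IsBVInf (𝒱 : ℤ → Submodule k V) (Δ : ℕ → V →ₗ[k] V) : Prop where
  degree : HbarDegree 𝒱 𝒱 1 (hbarSum Δ)
  order : ∀ n : ℕ, 1 ≤ n → IsDiffOp 𝒱 n (3 - 2 * n) (Δ n)
  sq_zero : hbarExt (hbarSum Δ) ∘ₗ hbarSum Δ = 0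
  map_one : hbarSum Δ 1 = 0

/-- The sequence with terms `Δ₁`, `Δ₂` and `Δₙ = 0` for `n ≥ 3`. -/
def dgBVSeq (Δ₁ Δ₂ : V →ₗ[k] V) : ℕ → V →ₗ[k] V
  | 1 => Δ₁
  | 2 => Δ₂
  | _ => 0

/-- A dg BV algebra structure: a `BV∞` structure with `Δₙ = 0` for `n ≥ 3`. -/
def IsDGBV (𝒱 : ℤ → Submodule k V) (Δ₁ Δ₂ : V →ₗ[k] V) : Prop :=
  IsBVInf 𝒱 (dgBVSeq Δ₁ Δ₂)

variable {U : Type v} [AddCommGroup U] [Module k U]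
  {U' : Type v} [AddCommGroup U'] [Module k U']

/-- Purity of a `BV∞` structure on `S(U)`: each `Δₙ` maps `Sⁿ(U)` to `U` and `S^{<n}(U)` to `0`. -/
def IsPureBV (𝒰 : ℤ → Submodule k U) (Δ : ℕ → GrSym 𝒰 →ₗ[k] GrSym 𝒰) : Prop :=
  ∀ n : ℕ, 1 ≤ n → (∀ a ∈ GrSym.symPow 𝒰 n, Δ n a ∈ LinearMap.range (GrSym.ι 𝒰)) ∧
    ∀ m < n, ∀ a ∈ GrSym.symPow 𝒰 m, Δ n a = 0

/-- A `BV∞`-morphism `φ : (S(U), Δ) → (B, Δ')`. The term `φₙ` of `φ = (1 / ħ) ∑_{n ≥ 1} ħⁿ φₙ` is the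
coefficient of `φ` at `ħⁿ⁻¹`. -/
structure IsBVInfMorphism (𝒰 : ℤ → Submodule k U) [Decomposition 𝒰]
    (Δ : ℕ → GrSym 𝒰 →ₗ[k] GrSym 𝒰) (ℬ : ℤ → Submodule k B) (Δ' : ℕ → B →ₗ[k] B)
    (φ : GrSym 𝒰 →ₗ[k] PowerSeries B) : Prop where
  degree : HbarDegree (GrSym.deg 𝒰) ℬ 0 φ
  map_one : φ 1 = 0
  comm : hbarExt (GrSym.exp 𝒰 φ) ∘ₗ hbarSum Δ = hbarExt (hbarSum Δ') ∘ₗ GrSym.exp 𝒰 φ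
  order : ∀ n : ℕ, 1 ≤ n → ∀ m > n, ∀ a ∈ GrSym.symPow 𝒰 m, PowerSeries.coeff (n - 1) (φ a) = 0

/-- Purity of a morphism `φ : S(U) → S(U')[[ħ]]`: each `φₙ` maps `Sⁿ(U)` to `U'` and all other
symmetric powers to `0`. -/
def IsPureMap (𝒰 : ℤ → Submodule k U) (𝒰' : ℤ → Submodule k U')
    (φ : GrSym 𝒰 →ₗ[k] PowerSeries (GrSym 𝒰')) : Prop :=
  ∀ n : ℕ, 1 ≤ n →
    (∀ a ∈ GrSym.symPow 𝒰 n, PowerSeries.coeff (n - 1) (φ a) ∈ LinearMap.range (GrSym.ι 𝒰')) ∧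
    ∀ m ≠ n, ∀ a ∈ GrSym.symPow 𝒰 m, PowerSeries.coeff (n - 1) (φ a) = 0

/-- The composition `ψ ⋄ φ = log (exp ψ ∘ exp φ)`. -/
def diamond (𝒰 : ℤ → Submodule k U) [Decomposition 𝒰] (𝒰' : ℤ → Submodule k U') [Decomposition 𝒰']
    (ψ : GrSym 𝒰' →ₗ[k] PowerSeries B) (φ : GrSym 𝒰 →ₗ[k] PowerSeries (GrSym 𝒰')) :
    GrSym 𝒰 →ₗ[k] PowerSeries B :=
  GrSym.log 𝒰 (hbarExt (GrSym.exp 𝒰' ψ) ∘ₗ GrSym.exp 𝒰 φ)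

/-- The identity morphism `φ = φ₁ = id_U`. -/
def bvId (𝒰 : ℤ → Submodule k U) : GrSym 𝒰 →ₗ[k] PowerSeries (GrSym 𝒰) :=
  hbarSum (Pi.single 1 (GrSym.ι 𝒰 ∘ₗ GrSym.proj 𝒰))

end Hbar

/-- A pure dg BV algebra `(V = S(U), Δ₁, Δ₂)`. -/
structure PureDGBVAlgebra (k : Type u) [Field k] where
  carrier : Type v
  [addCommGroup : AddCommGroup carrier]
  [module : Module k carrier]
  grading : ℤ → Submodule k carrier
  [decomposition : Decomposition grading]
  Δ₁ : GrSym grading →ₗ[k] GrSym grading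
  Δ₂ : GrSym grading →ₗ[k] GrSym grading
  isDGBV : IsDGBV (GrSym.deg grading) Δ₁ Δ₂
  isPure : IsPureBV grading (dgBVSeq Δ₁ Δ₂)

namespace PureDGBVAlgebra

attribute [instance] addCommGroup module decomposition

variable {k : Type u} [Field k]

/-- `φ` is a pure `BV∞`-morphism between pure dg BV algebras. -/
def IsHom (V W : PureDGBVAlgebra.{u, v} k)
    (φ : GrSym V.grading →ₗ[k] PowerSeries (GrSym W.grading)) : Prop :=
  IsBVInfMorphism V.grading (dgBVSeq V.Δ₁ V.Δ₂) (GrSym.deg W.grading) (dgBVSeq W.Δ₁ W.Δ₂) φ ∧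
    IsPureMap V.grading W.grading φ

/-- Pure `BV∞`-morphisms. -/
@[ext]
structure Hom (V W : PureDGBVAlgebra.{u, v} k) where
  φ : GrSym V.grading →ₗ[k] PowerSeries (GrSym W.grading)
  isHom : IsHom V W φ

/-- The composition `⋄` and the morphisms `id_U` define a category of pure dg BV algebras and pure
`BV∞`-morphisms. -/
structure FormsCategory (k : Type u) [Field k] : Prop where
  id_mem : ∀ V : PureDGBVAlgebra.{u, v} k, IsHom V V (bvId V.grading)
  comp_mem : ∀ {V W X : PureDGBVAlgebra.{u, v} k} (φ : Hom V W) (ψ : Hom W X),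
    IsHom V X (diamond V.grading W.grading ψ.φ φ.φ)
  id_comp : ∀ {V W : PureDGBVAlgebra.{u, v} k} (φ : Hom V W),
    diamond V.grading V.grading φ.φ (bvId V.grading) = φ.φ
  comp_id : ∀ {V W : PureDGBVAlgebra.{u, v} k} (φ : Hom V W),
    diamond V.grading W.grading (bvId W.grading) φ.φ = φ.φ
  assoc : ∀ {V W X Y : PureDGBVAlgebra.{u, v} k} (φ : Hom V W) (ψ : Hom W X) (χ : Hom X Y),
    diamond V.grading X.grading χ.φ (diamond V.grading W.grading ψ.φ φ.φ) =
      diamond V.grading W.grading (diamond W.grading X.grading χ.φ ψ.φ) φ.φ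

/-- The category of pure dg BV algebras with pure `BV∞`-morphisms. -/
abbrev category (h : FormsCategory.{u, v} k) :
    CategoryTheory.Category (PureDGBVAlgebra.{u, v} k) where
  Hom := Hom
  id V := ⟨bvId V.grading, h.id_mem V⟩
  comp φ ψ := ⟨diamond _ _ ψ.φ φ.φ, h.comp_mem φ ψ⟩
  id_comp φ := Hom.ext (h.id_comp φ)
  comp_id φ := Hom.ext (h.comp_id φ)
  assoc φ ψ χ := Hom.ext (h.assoc φ ψ χ)

end PureDGBVAlgebra

/-- A dg Lie algebra, with differential of degree `1`. -/
structure DGLieAlgebra (k : Type u) [Field k] where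
  carrier : Type v
  [addCommGroup : AddCommGroup carrier]
  [module : Module k carrier]
  grading : ℤ → Submodule k carrier
  [decomposition : Decomposition grading]
  d : carrier →ₗ[k] carrier
  bracket : carrier →ₗ[k] carrier →ₗ[k] carrier
  d_mem : ∀ (i : ℤ), ∀ x ∈ grading i, d x ∈ grading (i + 1)
  bracket_mem : ∀ (i j : ℤ), ∀ x ∈ grading i, ∀ y ∈ grading j, bracket x y ∈ grading (i + j)
  d_d : ∀ x, d (d x) = 0
  antisymm : ∀ (i j : ℤ), ∀ x ∈ grading i, ∀ y ∈ grading j,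
    bracket x y = -(((-1 : k) ^ (i * j)) • bracket y x)
  leibniz : ∀ (i : ℤ), ∀ x ∈ grading i, ∀ y,
    d (bracket x y) = bracket (d x) y + ((-1 : k) ^ i) • bracket x (d y)
  jacobi : ∀ (i j : ℤ), ∀ x ∈ grading i, ∀ y ∈ grading j, ∀ z,
    bracket x (bracket y z) = bracket (bracket x y) z + ((-1 : k) ^ (i * j)) • bracket y (bracket x z)

namespace DGLieAlgebra

attribute [instance] addCommGroup module decomposition

variable {k : Type u} [Field k]

/-- The graded vector space `𝔤[1]`. -/
abbrev shiftUp (g : DGLieAlgebra.{u, v} k) : ℤ → Submodule k g.carrier := gradedShift 1 g.grading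

/-- The graded vector space `𝔤[-1]`. -/
abbrev shiftDown (g : DGLieAlgebra.{u, v} k) : ℤ → Submodule k g.carrier :=
  gradedShift (-1) g.grading

/-- The bracket `l₂(x, y) = (-1)^|x| [x, y]` on `𝔤[1]`, where `|x|` is the degree of `x` in `𝔤[1]`
(which has the parity of its degree in `𝔤[-1]`). -/
def l₂ (g : DGLieAlgebra.{u, v} k) : g.carrier →ₗ[k] g.carrier →ₗ[k] g.carrier :=
  g.bracket ∘ₗ gradeSign g.shiftUp 1

theorem l₂_symm (g : DGLieAlgebra.{u, v} k) : GrSym.GradedSymm g.shiftUp g.l₂ := by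
  intro i j x hx y hy
  have h := g.antisymm _ _ x hx y hy
  simp only [l₂, LinearMap.comp_apply, gradeSign_of_mem g.shiftUp 1 hx,
    gradeSign_of_mem g.shiftUp 1 hy, map_smul, LinearMap.smul_apply, h, smul_neg, smul_smul]
  rw [← neg_smul]
  congr 1
  have h0 : (-1 : k) ≠ 0 := by simp
  have hj : (-1 : k) ^ j * (-1 : k) ^ j = 1 := by rw [← mul_zpow]; simp
  have hi : (-1 : k) ^ i * (-1 : k) ^ i = 1 := by rw [← mul_zpow]; simp
  rw [show (1 + i) * (1 + j) = 1 + (i + (j + i * j)) by ring, zpow_add₀ h0, zpow_add₀ h0,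
    zpow_add₀ h0, one_mul, one_mul, zpow_one]
  linear_combination (-1 : k) ^ (i * j) * (-1 : k) ^ j * hi

/-- The coderivation of `S(𝔤[1])` that extends `l₁ = d`. -/
def D₁ (g : DGLieAlgebra.{u, v} k) : GrSym g.shiftUp →ₗ[k] GrSym g.shiftUp :=
  GrSym.coder g.shiftUp (g.d ∘ₗ GrSym.proj g.shiftUp)

/-- The coderivation of `S(𝔤[1])` that extends `l₂`. -/
def D₂ (g : DGLieAlgebra.{u, v} k) : GrSym g.shiftUp →ₗ[k] GrSym g.shiftUp :=
  GrSym.coder g.shiftUp (GrSym.extendTwo g.shiftUp g.l₂ g.l₂_symm)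

/-- An `L∞`-morphism of dg Lie algebras: a morphism `S(𝔤[1]) → S(𝔥[1])` of graded coalgebras that
commutes with the codifferentials `D₁ + D₂` and maps `1` to `1`. -/
@[ext]
structure LInfHom (g h : DGLieAlgebra.{u, v} k) where
  toCoalgHom : GrSym g.shiftUp →ₗc[k] GrSym h.shiftUp
  map_deg : ∀ (i : ℤ), ∀ a ∈ GrSym.deg g.shiftUp i, toCoalgHom a ∈ GrSym.deg h.shiftUp i
  map_one : toCoalgHom 1 = 1
  comm : ∀ a, toCoalgHom (g.D₁ a + g.D₂ a) = h.D₁ (toCoalgHom a) + h.D₂ (toCoalgHom a)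

/-- The category of dg Lie algebras with `L∞`-morphisms. -/
instance category : CategoryTheory.Category (DGLieAlgebra.{u, v} k) where
  Hom := LInfHom
  id g := ⟨CoalgHom.id k _, fun _ _ h => h, rfl, fun _ => rfl⟩
  comp Φ Ψ := ⟨Ψ.toCoalgHom.comp Φ.toCoalgHom, fun i a h => Ψ.map_deg i _ (Φ.map_deg i a h),
    by simp [Φ.map_one, Ψ.map_one], fun a => by simp only [CoalgHom.comp_apply, Φ.comm, Ψ.comm]⟩

theorem double_comm (k : Type u) [Field k] {U : Type v} [AddCommGroup U] [Module k U]
    (𝒰 : ℤ → Submodule k U) (n m : ℤ) (hnm : Even (n - m)) (i j : ℤ) (x : U)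
    (hx : x ∈ gradedShift n 𝒰 i) (y : U) (hy : y ∈ gradedShift n 𝒰 j) :
    GrSym.ι (gradedShift m 𝒰) x * GrSym.ι (gradedShift m 𝒰) y =
      ((-1 : k) ^ (i * j)) • (GrSym.ι (gradedShift m 𝒰) y * GrSym.ι (gradedShift m 𝒰) x) := by
  have hx' : x ∈ gradedShift m 𝒰 (n - m + i) := by
    have : m + (n - m + i) = n + i := by ring
    simpa only [gradedShift, this] using hx
  have hy' : y ∈ gradedShift m 𝒰 (n - m + j) := by
    have : m + (n - m + j) = n + j := by ring
    simpa only [gradedShift, this] using hy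
  rw [GrSym.ι_mul_ι _ hx' hy',
    show (n - m + i) * (n - m + j) = (n - m) * (n - m + i + j) + i * j by ring,
    zpow_add₀ (by simp : (-1 : k) ≠ 0), (hnm.mul_right _).neg_one_zpow, one_mul]

/-- The isomorphism `S(𝔤[1]) ≃ S(𝔤[-1])` of algebras, the identity on `𝔤`; double suspension does not
affect signs. -/
def doubleSusp (g : DGLieAlgebra.{u, v} k) : GrSym g.shiftUp ≃ₐ[k] GrSym g.shiftDown :=
  AlgEquiv.ofAlgHom
    (GrSym.lift g.shiftUp (GrSym.ι g.shiftDown)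
      (double_comm k g.grading 1 (-1) (by decide)))
    (GrSym.lift g.shiftDown (GrSym.ι g.shiftUp)
      (double_comm k g.grading (-1) 1 (by decide)))
    (GrSym.algHom_ext _ fun x => by simp) (GrSym.algHom_ext _ fun x => by simp)

/-- The operator `Δ₁` on `S(𝔤[-1])`. -/
def Δ₁ (g : DGLieAlgebra.{u, v} k) : GrSym g.shiftDown →ₗ[k] GrSym g.shiftDown :=
  g.doubleSusp.toLinearMap ∘ₗ g.D₁ ∘ₗ g.doubleSusp.symm.toLinearMap

/-- The operator `Δ₂` on `S(𝔤[-1])`. -/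
def Δ₂ (g : DGLieAlgebra.{u, v} k) : GrSym g.shiftDown →ₗ[k] GrSym g.shiftDown :=
  g.doubleSusp.toLinearMap ∘ₗ g.D₂ ∘ₗ g.doubleSusp.symm.toLinearMap

/-- The map `S(𝔤[-1]) → S(𝔥[-1])[[ħ]]` assigned to an `L∞`-morphism `Φ`: it is
`(1 / ħ) ∑_{n ≥ 1} ħⁿ φₙ`, where `φₙ` is zero outside `Sⁿ(𝔤[-1])` and is there the projection of `Φ`
to the cogenerators. -/
def bvMap {g h : DGLieAlgebra.{u, v} k} (Φ : LInfHom g h) :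
    GrSym g.shiftDown →ₗ[k] PowerSeries (GrSym h.shiftDown) :=
  hbarSum fun n =>
    (GrSym.ι h.shiftDown ∘ₗ GrSym.proj h.shiftUp) ∘ₗ Φ.toCoalgHom.toLinearMap ∘ₗ
      g.doubleSusp.symm.toLinearMap ∘ₗ GrSym.projPow g.shiftDown n

/-- `(S(𝔤[-1]), Δ₁, Δ₂)` is a pure dg BV algebra. -/
def IsPureDGBV (g : DGLieAlgebra.{u, v} k) : Prop :=
  IsDGBV (GrSym.deg g.shiftDown) g.Δ₁ g.Δ₂ ∧ IsPureBV g.shiftDown (dgBVSeq g.Δ₁ g.Δ₂)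

/-- The pure dg BV algebra `(S(𝔤[-1]), Δ₁, Δ₂)`. -/
abbrev toBV (g : DGLieAlgebra.{u, v} k) (hg : g.IsPureDGBV) : PureDGBVAlgebra.{u, v} k where
  carrier := g.carrier
  grading := g.shiftDown
  Δ₁ := g.Δ₁
  Δ₂ := g.Δ₂
  isDGBV := hg.1
  isPure := hg.2

/-- The assignment `𝔤 ↦ S(𝔤[-1])`, `Φ ↦ bvMap Φ` is functorial. -/
structure BVFunctorial (hobj : ∀ g : DGLieAlgebra.{u, v} k, g.IsPureDGBV) : Prop where
  map_mem : ∀ {g h : DGLieAlgebra.{u, v} k} (Φ : g ⟶ h),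
    PureDGBVAlgebra.IsHom (g.toBV (hobj g)) (h.toBV (hobj h)) (bvMap Φ)
  map_id : ∀ g : DGLieAlgebra.{u, v} k,
    bvMap (CategoryTheory.CategoryStruct.id g) = bvId g.shiftDown
  map_comp : ∀ {g h l : DGLieAlgebra.{u, v} k} (Φ : g ⟶ h) (Ψ : h ⟶ l),
    bvMap (CategoryTheory.CategoryStruct.comp Φ Ψ) =
      diamond g.shiftDown h.shiftDown (bvMap Ψ) (bvMap Φ)

/-- The functor `𝔤 ↦ S(𝔤[-1])` from dg Lie algebras with `L∞`-morphisms to pure dg BV algebras with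
pure `BV∞`-morphisms. -/
abbrev bvFunctor (hcat : PureDGBVAlgebra.FormsCategory.{u, v} k)
    (hobj : ∀ g : DGLieAlgebra.{u, v} k, g.IsPureDGBV) (hfun : BVFunctorial hobj) :
    letI := PureDGBVAlgebra.category hcat
    CategoryTheory.Functor (DGLieAlgebra.{u, v} k) (PureDGBVAlgebra.{u, v} k) :=
  letI := PureDGBVAlgebra.category hcat
  { obj := fun g => g.toBV (hobj g)
    map := fun Φ => ⟨bvMap Φ, hfun.map_mem Φ⟩
    map_id := fun g => PureDGBVAlgebra.Hom.ext (hfun.map_id g)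
    map_comp := fun Φ Ψ => PureDGBVAlgebra.Hom.ext (hfun.map_comp Φ Ψ) }

end DGLieAlgebra

end

set_option linter.unusedSectionVars false

/-! The point is to remove `ħ`. Give `S^m(U)` weight `m` and `ħ` weight `1`. A pure map `φ = (1/ħ) ∑
ħⁿ φₙ` sends `S^n(U)` to `ħⁿ⁻¹ U'`, so it is homogeneous of weight zero, and so are `exp φ` and `Δ₁
+ ħ Δ₂` for a pure dg BV algebra: `Δ₁` preserves symmetric powers, while `Δ₂` lowers them by one and
`ħ` makes up for it. A weighted map is the same thing as its value at `ħ = 1`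
(`IsWeighted.injective`, `IsWeighted.unique`), and this specialization respects composition,
convolution and `exp`. All identities with `ħ` thus become identities between linear maps of
symmetric coalgebras.

At `ħ = 1` the classical dictionary applies. For an even `f : S(U) → U'` with `f 1 = 0`, `exp (ι ∘
f)` is a coalgebra morphism with linear component `f` (`comul_exp`, `proj_exp`). In characteristic
zero the primitive elements of `S(U)` are those of `U`, hence a unital coalgebra morphism is
determined by its linear component (`coalgHom_ext_proj`) and, if it preserves parity, is the
exponential of that component (`coalgHom_eq_exp`). So pure maps of degree zero correspond to
coalgebra morphisms, `⋄` corresponds to composition (`diamond_spec`), and the category axioms follow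
since `log` inverts `exp` (`log_exp`).

On objects, a differential operator of order `≤ n` on `S(U)` is determined by its restriction to
`S^m(U)` for `m ≤ n`. Purity therefore forces `Δ₁` and `Δ₂` to be the coderivations given by a
linear `d` and a graded symmetric bilinear `l` (`eq_coder_of_isDiffOp`, `exists_lieCoder`). The
square of the odd coderivation `Δ₁ + Δ₂` is again a coderivation, so it vanishes once its linear
component does; on `S¹`, `S²`, `S³` this says `d² = 0`, the Leibniz rule and the Jacobi identity,
and on the other powers it says nothing (`lieCoder_sq_zero_iff`).

Passing between `𝔤[1]` and `𝔤[-1]` changes no sign, only degrees, by `2` for each letter. A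
component `S^n → U'` of degree zero thereby acquires degree `2 - 2n`, exactly what the degree of
`ħⁿ⁻¹` compensates. Hence the functor is faithful (`bvMap_injective`), full (`exists_bvMap_eq`) and
surjective on objects (`exists_toBV_eq`). -/

noncomputable section

open DirectSum TensorProduct

/-! ### Signs and parity operators. -/

section Parity
variable {k : Type u} [Field k] {M : Type v} [AddCommGroup M] [Module k M]

theorem neg_one_zpow_mul_self (n : ℤ) : (-1 : k) ^ n * (-1 : k) ^ n = 1 := by
  rw [← mul_zpow]; simp

theorem neg_one_zpow_congr {m n : ℤ} (h : Even (m - n)) : (-1 : k) ^ m = (-1 : k) ^ n := by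
  have h0 : (-1 : k) ≠ 0 := by simp
  rw [show m = (m - n) + n by ring, zpow_add₀ h0, h.neg_one_zpow, one_mul]

theorem gradeSign_congr (𝒰 : ℤ → Submodule k M) [Decomposition 𝒰] {p q : ℤ} (h : Even (p - q)) :
    gradeSign 𝒰 p = gradeSign 𝒰 q := by
  ext x
  induction x using Decomposition.inductionOn 𝒰 with
  | zero => simp
  | add x y hx hy => simp only [map_add, hx, hy]
  | @homogeneous i x =>
    rw [gradeSign_of_mem 𝒰 p x.2, gradeSign_of_mem 𝒰 q x.2,
      neg_one_zpow_congr (show Even (p * i - q * i) by rw [← sub_mul]; exact h.mul_right i)]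

theorem gradeSign_zero (𝒰 : ℤ → Submodule k M) [Decomposition 𝒰] :
    gradeSign 𝒰 0 = LinearMap.id := by
  ext x
  induction x using Decomposition.inductionOn 𝒰 with
  | zero => simp
  | add x y hx hy => simp only [map_add, hx, hy]
  | @homogeneous i x => simp [gradeSign_of_mem 𝒰 0 x.2]

theorem gradeSign_gradeSign (𝒰 : ℤ → Submodule k M) [Decomposition 𝒰] (p q : ℤ) (x : M) :
    gradeSign 𝒰 p (gradeSign 𝒰 q x) = gradeSign 𝒰 (p + q) x := by
  induction x using Decomposition.inductionOn 𝒰 with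
  | zero => simp
  | add x y hx hy => simp only [map_add, hx, hy]
  | @homogeneous i x =>
    rw [gradeSign_of_mem 𝒰 q x.2, gradeSign_of_mem 𝒰 _ x.2, map_smul, gradeSign_of_mem 𝒰 p x.2,
      smul_smul, add_mul, zpow_add₀ (by simp), mul_comm]

theorem gradeSign_self (𝒰 : ℤ → Submodule k M) [Decomposition 𝒰] (p : ℤ) (x : M) :
    gradeSign 𝒰 p (gradeSign 𝒰 p x) = x := by
  rw [gradeSign_gradeSign, gradeSign_congr 𝒰 (q := 0) (by simp), gradeSign_zero]; rfl

end Parity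

/-! ### Words in `S(U)`: linear component, signs and shuffle comultiplication. -/

namespace GrSym

variable {k : Type u} [Field k] {U : Type v} [AddCommGroup U] [Module k U]

/-- The product of a list of homogeneous elements of `U`. -/
def word (𝒰 : ℤ → Submodule k U) (l : List (Σ i : ℤ, 𝒰 i)) : GrSym 𝒰 :=
  (l.map fun x => ι 𝒰 x.2).prod

/-- The total degree of a list of homogeneous elements. -/
def wdeg {𝒰 : ℤ → Submodule k U} (l : List (Σ i : ℤ, 𝒰 i)) : ℤ := (l.map Sigma.fst).sum

section
variable (𝒰 : ℤ → Submodule k U)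

@[simp] theorem word_nil : word 𝒰 [] = 1 := rfl

@[simp] theorem word_cons (x : Σ i : ℤ, 𝒰 i) (l : List (Σ i : ℤ, 𝒰 i)) :
    word 𝒰 (x :: l) = ι 𝒰 x.2 * word 𝒰 l := rfl

@[simp] theorem wdeg_nil : wdeg ([] : List (Σ i : ℤ, 𝒰 i)) = 0 := rfl

@[simp] theorem wdeg_cons (x : Σ i : ℤ, 𝒰 i) (l : List (Σ i : ℤ, 𝒰 i)) :
    wdeg (x :: l) = x.1 + wdeg l := List.sum_cons

theorem word_mem_deg (l : List (Σ i : ℤ, 𝒰 i)) : word 𝒰 l ∈ deg 𝒰 (wdeg l) :=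
  Submodule.subset_span ⟨l, rfl, rfl⟩

theorem word_mem_symPow (l : List (Σ i : ℤ, 𝒰 i)) : word 𝒰 l ∈ symPow 𝒰 l.length := by
  induction l with
  | nil => exact SetLike.GradedOne.one_mem
  | cons x l ih =>
    rw [word_cons, List.length_cons, add_comm]
    exact SetLike.GradedMul.mul_mem (ι_mem_symPow 𝒰 _) ih

/-- Together with `symPow_le` and `ext_word`, this reduces linear statements about `S(U)` to words
in homogeneous letters, where degree and length are both visible. -/
theorem deg_le {n : ℤ} {N : Submodule k (GrSym 𝒰)} (h : ∀ l, wdeg l = n → word 𝒰 l ∈ N) :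
    deg 𝒰 n ≤ N :=
  Submodule.span_le.2 fun _ ⟨l, hl, e⟩ => e ▸ h l hl

theorem symPow_le [Decomposition 𝒰] {m : ℕ} {N : Submodule k (GrSym 𝒰)}
    (h : ∀ l : List (Σ i : ℤ, 𝒰 i), l.length = m → word 𝒰 l ∈ N) : symPow 𝒰 m ≤ N := by
  have hr : LinearMap.range (ι 𝒰) ≤
      Submodule.span k (Set.range fun x : Σ i : ℤ, 𝒰 i => ι 𝒰 x.2) := by
    rintro _ ⟨x, rfl⟩
    induction x using Decomposition.inductionOn 𝒰 with
    | zero => simp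
    | @homogeneous i x => exact Submodule.subset_span ⟨⟨i, x⟩, rfl⟩
    | add x y hx hy => rw [map_add]; exact add_mem hx hy
  have key : ∀ m, symPow 𝒰 m ≤
      Submodule.span k {a | ∃ l : List (Σ i : ℤ, 𝒰 i), l.length = m ∧ word 𝒰 l = a} := by
    intro m
    induction m with
    | zero =>
      rw [symPow, pow_zero, Submodule.one_le]
      exact Submodule.subset_span ⟨[], rfl, rfl⟩
    | succ m ih =>
      rw [symPow, pow_succ']
      refine (mul_le_mul' hr ih).trans ?_
      rw [Submodule.span_mul_span]
      refine Submodule.span_mono ?_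
      rintro _ ⟨_, ⟨x, rfl⟩, _, ⟨l, hl, rfl⟩, rfl⟩
      exact ⟨x :: l, by simp [hl], rfl⟩
  refine (key m).trans (Submodule.span_le.2 ?_)
  rintro _ ⟨l, hl, rfl⟩
  exact h l hl

theorem mem_of_word_mem [Decomposition 𝒰] {N : Submodule k (GrSym 𝒰)}
    (h : ∀ l : List (Σ i : ℤ, 𝒰 i), word 𝒰 l ∈ N) (a : GrSym 𝒰) : a ∈ N := by
  induction a using Decomposition.inductionOn (symPow 𝒰) with
  | zero => exact zero_mem _
  | homogeneous a => exact symPow_le 𝒰 (fun l _ => h l) a.2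
  | add a b ha hb => exact add_mem ha hb

theorem ext_word [Decomposition 𝒰] {M : Type*} [AddCommGroup M] [Module k M]
    {f g : GrSym 𝒰 →ₗ[k] M} (h : ∀ l, f (word 𝒰 l) = g (word 𝒰 l)) : f = g := by
  ext a
  exact mem_of_word_mem 𝒰 (N := LinearMap.eqLocus f g) h a

theorem ext_symPow {M : Type*} [AddCommGroup M] [Module k M]
    {f g : GrSym 𝒰 →ₗ[k] M} (h : ∀ m, ∀ a ∈ symPow 𝒰 m, f a = g a) : f = g := by
  ext a
  induction a using Decomposition.inductionOn (symPow 𝒰) with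
  | zero => simp
  | homogeneous a => exact h _ _ a.2
  | add a b ha hb => rw [map_add, map_add, ha, hb]

theorem assemble_of_mem {B : Type*} [AddCommGroup B] [Module k B]
    (T : ℕ → GrSym 𝒰 →ₗ[k] B) {m : ℕ} {a : GrSym 𝒰} (ha : a ∈ symPow 𝒰 m) :
    assemble 𝒰 T a = T m a := by
  rw [assemble, LinearMap.comp_apply, LinearEquiv.coe_coe, decomposeLinearEquiv_apply,
    decompose_of_mem _ ha, ← DirectSum.lof_eq_of k, DirectSum.toModule_lof]
  rfl

theorem projPow_of_mem {m : ℕ} {a : GrSym 𝒰} (ha : a ∈ symPow 𝒰 m) (n : ℕ) :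
    projPow 𝒰 n a = if n = m then a else 0 := by
  rw [projPow, GradedAlgebra.proj_apply]
  split_ifs with h
  · subst h; exact decompose_of_mem_same _ ha
  · exact decompose_of_mem_ne _ ha (Ne.symm h)

theorem projPow_mem (n : ℕ) (a : GrSym 𝒰) : projPow 𝒰 n a ∈ symPow 𝒰 n := by
  rw [projPow, GradedAlgebra.proj_apply]; exact SetLike.coe_mem _

theorem eq_zero_of_projPow {a : GrSym 𝒰} (h : ∀ n, projPow 𝒰 n a = 0) : a = 0 := by
  apply (decompose (symPow 𝒰)).injective
  ext n
  simpa [projPow, GradedAlgebra.proj_apply] using h n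

/-! ### The linear component and the augmentation -/

/-- This recursion explains the auxiliary module `k ⊕ U ⊕ U`: acting on `(1, 0, 0)`, an element of
`S(U)` leaves its augmentation, its linear component and the value of `extendTwo` in the three
slots. -/
theorem quadLift_mul_ι (l : U →ₗ[k] U →ₗ[k] U) (hl : GradedSymm 𝒰 l) (x : U) (a : GrSym 𝒰)
    (p : k × U × U) :
    quadLift 𝒰 l hl (ι 𝒰 x * a) p =
      (0, (quadLift 𝒰 l hl a p).1 • x, l x (quadLift 𝒰 l hl a p).2.1) := by
  simp [quadLift, quadAct]

theorem proj_one : proj 𝒰 1 = 0 := by simp [proj]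

theorem extendTwo_one (l : U →ₗ[k] U →ₗ[k] U) (hl : GradedSymm 𝒰 l) : extendTwo 𝒰 l hl 1 = 0 := by
  simp [extendTwo]

theorem quadLift_fst (l : U →ₗ[k] U →ₗ[k] U) (hl : GradedSymm 𝒰 l) [Decomposition 𝒰]
    (a : GrSym 𝒰) : (quadLift 𝒰 l hl a (1, 0, 0)).1 = counitAlgHom 𝒰 a := by
  revert a
  apply LinearMap.congr_fun (f := LinearMap.fst k k (U × U) ∘ₗ
    LinearMap.applyₗ ((1, 0, 0) : k × U × U) ∘ₗ (quadLift 𝒰 l hl).toLinearMap)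
    (g := (counitAlgHom 𝒰).toLinearMap)
  apply linearMap_ext
  · simp
  · intro i x hx a _
    simp only [LinearMap.comp_apply, AlgHom.toLinearMap_apply, LinearMap.applyₗ_apply_apply,
      quadLift_mul_ι, LinearMap.fst_apply]
    simp [counitAlgHom_ι]

theorem proj_ι_mul [Decomposition 𝒰] (x : U) (a : GrSym 𝒰) :
    proj 𝒰 (ι 𝒰 x * a) = counitAlgHom 𝒰 a • x := by
  rw [← quadLift_fst 𝒰 0 (fun _ _ _ _ _ _ => by simp) a]
  exact congrArg (fun p => p.2.1) (quadLift_mul_ι 𝒰 0 _ x a (1, 0, 0))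

theorem quadLift_snd (l : U →ₗ[k] U →ₗ[k] U) (hl : GradedSymm 𝒰 l) [Decomposition 𝒰]
    (a : GrSym 𝒰) : (quadLift 𝒰 l hl a (1, 0, 0)).2.1 = proj 𝒰 a := by
  revert a
  apply LinearMap.congr_fun (f := LinearMap.fst k U U ∘ₗ LinearMap.snd k k (U × U) ∘ₗ
    LinearMap.applyₗ ((1, 0, 0) : k × U × U) ∘ₗ (quadLift 𝒰 l hl).toLinearMap)
    (g := proj 𝒰)
  apply linearMap_ext
  · simp [proj_one]
  · intro i x hx a _
    simp only [LinearMap.comp_apply, AlgHom.toLinearMap_apply, LinearMap.applyₗ_apply_apply,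
      quadLift_mul_ι, LinearMap.fst_apply, LinearMap.snd_apply, proj_ι_mul, quadLift_fst]

theorem extendTwo_ι_mul [Decomposition 𝒰] (l : U →ₗ[k] U →ₗ[k] U) (hl : GradedSymm 𝒰 l) (x : U)
    (a : GrSym 𝒰) : extendTwo 𝒰 l hl (ι 𝒰 x * a) = l x (proj 𝒰 a) := by
  rw [← quadLift_snd 𝒰 l hl a]
  simp only [extendTwo, LinearMap.comp_apply, AlgHom.toLinearMap_apply, LinearMap.applyₗ_apply_apply,
    quadLift_mul_ι, LinearMap.snd_apply]

/-- Graded commutativity of `S(U)`. -/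
theorem mul_comm_of_mem {i j : ℤ} {a b : GrSym 𝒰} (ha : a ∈ deg 𝒰 i) (hb : b ∈ deg 𝒰 j) :
    a * b = ((-1 : k) ^ (i * j)) • (b * a) := by
  have key : ∀ {j : ℤ} {x : U}, x ∈ 𝒰 j → ∀ l : List (Σ i : ℤ, 𝒰 i),
      word 𝒰 l * ι 𝒰 x = ((-1 : k) ^ (wdeg l * j)) • (ι 𝒰 x * word 𝒰 l) := by
    intro j x hx l
    induction l with
    | nil => simp
    | cons y l ih =>
      rw [word_cons, mul_assoc, ih, mul_smul_comm, ← mul_assoc, ι_mul_ι 𝒰 y.2.2 hx, wdeg_cons,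
        add_mul, zpow_add₀ (by simp), smul_mul_assoc, smul_smul, mul_assoc, mul_comm]
  have key2 : ∀ l l' : List (Σ i : ℤ, 𝒰 i),
      word 𝒰 l * word 𝒰 l' = ((-1 : k) ^ (wdeg l * wdeg l')) • (word 𝒰 l' * word 𝒰 l) := by
    intro l l'
    induction l' with
    | nil => simp
    | cons y l' ih =>
      rw [word_cons, ← mul_assoc, key y.2.2, smul_mul_assoc, mul_assoc, ih, mul_smul_comm,
        smul_smul, wdeg_cons, mul_add, zpow_add₀ (by simp), mul_assoc]
  have h1 : deg 𝒰 i ≤ LinearMap.eqLocus (LinearMap.mulRight k b)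
      (((-1 : k) ^ (i * j)) • LinearMap.mulLeft k b) := by
    apply deg_le
    intro l hl
    have h2 : deg 𝒰 j ≤ LinearMap.eqLocus (LinearMap.mulLeft k (word 𝒰 l))
        (((-1 : k) ^ (i * j)) • LinearMap.mulRight k (word 𝒰 l)) := by
      apply deg_le
      intro l' hl'
      simpa [hl, hl'] using key2 l l'
    simpa using h2 hb
  simpa using h1 ha

theorem counit_word (l : List (Σ i : ℤ, 𝒰 i)) (h : l ≠ []) : counitAlgHom 𝒰 (word 𝒰 l) = 0 := by
  cases l with
  | nil => exact absurd rfl h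
  | cons x l => simp [counitAlgHom_ι]

theorem ι_proj_of_mem {a : GrSym 𝒰} (ha : a ∈ symPow 𝒰 1) : ι 𝒰 (proj 𝒰 a) = a := by
  rw [symPow, pow_one] at ha
  obtain ⟨x, rfl⟩ := ha
  rw [proj_ι]

theorem symPow_zero_eq {a : GrSym 𝒰} (ha : a ∈ symPow 𝒰 0) :
    a = algebraMap k _ (counitAlgHom 𝒰 a) := by
  rw [symPow, pow_zero, Submodule.mem_one] at ha
  obtain ⟨r, rfl⟩ := ha
  rw [AlgHom.commutes]; rfl

variable [Decomposition 𝒰]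

theorem counit_of_mem {m : ℕ} (hm : m ≠ 0) {a : GrSym 𝒰} (ha : a ∈ symPow 𝒰 m) :
    counitAlgHom 𝒰 a = 0 := by
  refine symPow_le 𝒰 (N := LinearMap.ker (counitAlgHom 𝒰).toLinearMap) ?_ ha
  intro l hl
  exact counit_word 𝒰 l (by rintro rfl; exact hm hl.symm)

theorem proj_word (l : List (Σ i : ℤ, 𝒰 i)) (h : l.length ≠ 1) : proj 𝒰 (word 𝒰 l) = 0 := by
  rcases l with _ | ⟨x, _ | ⟨y, l⟩⟩
  · exact proj_one 𝒰
  · simp at h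
  · rw [word_cons, proj_ι_mul, counit_word 𝒰 _ (by simp), zero_smul]

theorem proj_of_mem {m : ℕ} (hm : m ≠ 1) {a : GrSym 𝒰} (ha : a ∈ symPow 𝒰 m) : proj 𝒰 a = 0 := by
  refine symPow_le 𝒰 (N := LinearMap.ker (proj 𝒰)) ?_ ha
  intro l hl
  exact proj_word 𝒰 l (by omega)

theorem extendTwo_of_mem (l : U →ₗ[k] U →ₗ[k] U) (hl : GradedSymm 𝒰 l) {m : ℕ} (hm : m ≠ 2)
    {a : GrSym 𝒰} (ha : a ∈ symPow 𝒰 m) : extendTwo 𝒰 l hl a = 0 := by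
  refine symPow_le 𝒰 (N := LinearMap.ker (extendTwo 𝒰 l hl)) ?_ ha
  rintro (_ | ⟨x, w⟩) hw
  · exact extendTwo_one 𝒰 l hl
  · rw [LinearMap.mem_ker, word_cons, extendTwo_ι_mul, proj_word 𝒰 w (by simp at hw; omega),
      map_zero]

theorem ι_proj (a : GrSym 𝒰) : ι 𝒰 (proj 𝒰 a) = projPow 𝒰 1 a := by
  revert a
  apply LinearMap.congr_fun (f := ι 𝒰 ∘ₗ proj 𝒰)
  apply ext_symPow
  intro m a ha
  rw [projPow_of_mem 𝒰 ha, LinearMap.comp_apply]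
  split_ifs with h
  · exact ι_proj_of_mem 𝒰 (h ▸ ha)
  · rw [proj_of_mem 𝒰 (Ne.symm h) ha, map_zero]

/-! ### Signs -/

theorem gradeSign_word (p : ℤ) (l : List (Σ i : ℤ, 𝒰 i)) :
    gradeSign (deg 𝒰) p (word 𝒰 l) = ((-1 : k) ^ (p * wdeg l)) • word 𝒰 l :=
  gradeSign_of_mem _ _ (word_mem_deg 𝒰 l)

theorem gradeSign_ι (p : ℤ) (x : U) :
    gradeSign (deg 𝒰) p (ι 𝒰 x) = ι 𝒰 (gradeSign 𝒰 p x) := by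
  induction x using Decomposition.inductionOn 𝒰 with
  | zero => simp
  | @homogeneous i x =>
    rw [gradeSign_of_mem _ _ (ι_mem_deg 𝒰 x.2), gradeSign_of_mem _ _ x.2, map_smul]
  | add x y hx hy => rw [map_add, map_add, map_add, map_add, hx, hy]

theorem gradeSign_mul (p : ℤ) (a b : GrSym 𝒰) :
    gradeSign (deg 𝒰) p (a * b) = gradeSign (deg 𝒰) p a * gradeSign (deg 𝒰) p b := by
  induction a using Decomposition.inductionOn (deg 𝒰) with
  | zero => simp
  | add a c ha hc => simp only [add_mul, map_add, ha, hc]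
  | @homogeneous i a =>
    induction b using Decomposition.inductionOn (deg 𝒰) with
    | zero => simp
    | add b c hb hc => simp only [mul_add, map_add, hb, hc]
    | @homogeneous j b =>
      rw [gradeSign_of_mem _ _ a.2, gradeSign_of_mem _ _ b.2,
        gradeSign_of_mem _ _ (SetLike.GradedMul.mul_mem a.2 b.2), smul_mul_smul_comm, mul_add,
        zpow_add₀ (by simp)]

theorem proj_gradeSign (p : ℤ) (a : GrSym 𝒰) :
    proj 𝒰 (gradeSign (deg 𝒰) p a) = gradeSign 𝒰 p (proj 𝒰 a) := by
  revert a
  apply LinearMap.congr_fun (f := proj 𝒰 ∘ₗ gradeSign (deg 𝒰) p) (g := gradeSign 𝒰 p ∘ₗ proj 𝒰)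
  apply linearMap_ext 𝒰
  · simp [gradeSign_one, proj_one]
  · intro i x hx a _
    simp only [LinearMap.comp_apply, gradeSign_ι_mul 𝒰 p hx, map_smul, proj_ι_mul,
      counitAlgHom_gradeSign, gradeSign_of_mem 𝒰 p hx]
    rw [smul_comm]

theorem gradeSign_mem_symPow (p : ℤ) {m : ℕ} {a : GrSym 𝒰} (ha : a ∈ symPow 𝒰 m) :
    gradeSign (deg 𝒰) p a ∈ symPow 𝒰 m := by
  refine symPow_le 𝒰 (N := (symPow 𝒰 m).comap (gradeSign (deg 𝒰) p)) ?_ ha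
  intro l hl
  rw [Submodule.mem_comap, gradeSign_word]
  exact Submodule.smul_mem _ _ (hl ▸ word_mem_symPow 𝒰 l)

/-! ### The comultiplication on words -/

/-- All that later arguments need from the shuffle formula: total length and total degree are
preserved. No permutation has to be written down. -/
theorem comul_word (w : List (Σ i : ℤ, 𝒰 i)) :
    (Coalgebra.comul (word 𝒰 w) : GrSym 𝒰 ⊗[k] GrSym 𝒰) ∈
      Submodule.span k {t | ∃ l l' : List (Σ i : ℤ, 𝒰 i), l.length + l'.length = w.length ∧
        wdeg l + wdeg l' = wdeg w ∧ word 𝒰 l ⊗ₜ[k] word 𝒰 l' = t} := by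
  change comulLin 𝒰 _ ∈ _
  induction w with
  | nil =>
    rw [word_nil, comulLin_one]
    exact Submodule.subset_span ⟨[], [], rfl, rfl, rfl⟩
  | cons x w ih =>
    rw [word_cons, comulLin_ι_mul 𝒰 x.2.2]
    generalize comulLin 𝒰 (word 𝒰 w) = t at ih
    induction ih using Submodule.span_induction with
    | zero => simp
    | add s t _ _ hs ht => rw [map_add]; exact add_mem hs ht
    | smul r s _ hs => rw [map_smul]; exact Submodule.smul_mem _ _ hs
    | mem t ht =>
      obtain ⟨l, l', h1, h2, rfl⟩ := ht
      rw [comulStep_tmul]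
      refine add_mem (Submodule.subset_span
        ⟨x :: l, l', by simp [← h1]; ring, by simp [← h2]; ring, rfl⟩) ?_
      rw [gradeSign_word, ← TensorProduct.smul_tmul']
      exact Submodule.smul_mem _ _ (Submodule.subset_span
        ⟨l, x :: l', by simp [← h1]; ring, by simp [← h2]; ring, rfl⟩)

/-- Multiplication after comultiplication is `2^m` on `S^m(U)`. -/
theorem mul_comul {m : ℕ} {a : GrSym 𝒰} (ha : a ∈ symPow 𝒰 m) :
    LinearMap.mul' k (GrSym 𝒰) (Coalgebra.comul a) = (2 : k) ^ m • a := by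
  refine symPow_le 𝒰 (N := LinearMap.eqLocus (LinearMap.mul' k (GrSym 𝒰) ∘ₗ Coalgebra.comul)
    ((2 : k) ^ m • LinearMap.id)) ?_ ha
  rintro w rfl
  clear ha
  change LinearMap.mul' k (GrSym 𝒰) (comulLin 𝒰 _) = (2 : k) ^ w.length • word 𝒰 w
  induction w with
  | nil => simp [comulLin_one]
  | cons x w ih =>
    -- Both summands of `comulStep` multiply out to `x` times the old product, because graded
    -- commutativity cancels the sign of moving `x` past the left factor. Each letter therefore
    -- contributes a factor `2`.
    have key : ∀ t, LinearMap.mul' k (GrSym 𝒰) (comulStep 𝒰 x.1 x.2 t) =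
        (2 : k) • (ι 𝒰 x.2 * LinearMap.mul' k (GrSym 𝒰) t) := by
      intro t
      induction t using TensorProduct.induction_on with
      | zero => simp
      | add s t hs ht => rw [map_add, map_add, hs, ht, map_add, mul_add, smul_add]
      | tmul a b =>
        rw [comulStep_tmul, map_add, LinearMap.mul'_apply, LinearMap.mul'_apply,
          LinearMap.mul'_apply, two_smul, mul_assoc]
        congr 1
        rw [← mul_assoc, ← mul_assoc]
        congr 1
        induction a using Decomposition.inductionOn (deg 𝒰) with
        | zero => simp
        | add a c ha hc => rw [map_add, add_mul, ha, hc, mul_add]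
        | @homogeneous j a =>
          rw [gradeSign_of_mem _ _ a.2, mul_comm_of_mem 𝒰 (ι_mem_deg 𝒰 x.2.2) a.2, smul_mul_assoc]
    rw [word_cons, comulLin_ι_mul 𝒰 x.2.2, key, ih, mul_smul_comm, smul_smul, List.length_cons,
      pow_succ']

end

end GrSym

/-! ### The convolution algebra: power series, exponential and logarithm. -/

namespace GrSym

variable {k : Type u} [Field k] {U : Type v} [AddCommGroup U] [Module k U]
variable (𝒰 : ℤ → Submodule k U) [Decomposition 𝒰]

section Convolution
variable {B : Type*} [Ring B] [Algebra k B] {B' : Type*} [Ring B'] [Algebra k B']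

/-- The ideal of the maps that vanish on `S^m(U)` for `m < n`, in the convolution algebra of the
linear maps `S(U) → B`. -/
def vanishing (B : Type*) [Ring B] [Algebra k B] (n : ℕ) :
    Submodule k (WithConv (GrSym 𝒰 →ₗ[k] B)) where
  carrier := {Φ | ∀ m < n, ∀ a ∈ symPow 𝒰 m, Φ a = 0}
  add_mem' hΦ hΨ m hm a ha := by
    simp [hΦ m hm a ha, hΨ m hm a ha]
  zero_mem' m hm a ha := by simp
  smul_mem' r Φ hΦ m hm a ha := by
    simp [hΦ m hm a ha]

variable {𝒰}

theorem vanishing_anti {m n : ℕ} (h : m ≤ n) : vanishing 𝒰 B n ≤ vanishing 𝒰 B m :=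
  fun _ hΦ i hi => hΦ i (hi.trans_le h)

theorem mem_vanishing_zero (Φ : WithConv (GrSym 𝒰 →ₗ[k] B)) : Φ ∈ vanishing 𝒰 B 0 :=
  fun _ h => absurd h (Nat.not_lt_zero _)

theorem mem_vanishing_one {Φ : WithConv (GrSym 𝒰 →ₗ[k] B)} (h : Φ 1 = 0) :
    Φ ∈ vanishing 𝒰 B 1 := by
  intro m hm a ha
  obtain rfl : m = 0 := by omega
  rw [symPow_zero_eq 𝒰 ha, Algebra.algebraMap_eq_smul_one, map_smul, h, smul_zero]

/-- If a word of length less than `m + n` is cut in two, the left piece is shorter than `m` or the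
right piece is shorter than `n`. -/
theorem mul_mem_vanishing {m n : ℕ} {Φ Ψ : WithConv (GrSym 𝒰 →ₗ[k] B)}
    (hΦ : Φ ∈ vanishing 𝒰 B m) (hΨ : Ψ ∈ vanishing 𝒰 B n) : Φ * Ψ ∈ vanishing 𝒰 B (m + n) := by
  intro p hp a ha
  refine symPow_le 𝒰 (N := LinearMap.ker (Φ * Ψ).ofConv) ?_ ha
  intro w hw
  rw [LinearMap.mem_ker, LinearMap.convMul_apply]
  have h := comul_word 𝒰 w
  revert h
  generalize (Coalgebra.comul (word 𝒰 w) : GrSym 𝒰 ⊗[k] GrSym 𝒰) = t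
  intro h
  induction h using Submodule.span_induction with
  | zero => simp
  | add s t _ _ hs ht => rw [map_add, map_add, hs, ht, add_zero]
  | smul r s _ hs => rw [map_smul, map_smul, hs, smul_zero]
  | mem t ht =>
    obtain ⟨l, l', h1, _, rfl⟩ := ht
    rw [TensorProduct.map_tmul, LinearMap.mul'_apply]
    by_cases hl : l.length < m
    · rw [hΦ _ hl _ (word_mem_symPow 𝒰 l), zero_mul]
    · rw [hΨ _ (by omega) _ (word_mem_symPow 𝒰 l'), mul_zero]

theorem pow_mem_vanishing {Φ : WithConv (GrSym 𝒰 →ₗ[k] B)}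
    (hΦ : Φ ∈ vanishing 𝒰 B 1) (n : ℕ) : Φ ^ n ∈ vanishing 𝒰 B n := by
  induction n with
  | zero => exact mem_vanishing_zero _
  | succ n ih => rw [pow_succ]; exact mul_mem_vanishing ih hΦ

/-- The filtration by `vanishing` is separated, so identities in the convolution algebra may be
checked modulo each of its steps. -/
theorem eq_of_sub_mem_vanishing {Φ Ψ : WithConv (GrSym 𝒰 →ₗ[k] B)}
    (h : ∀ n, Φ - Ψ ∈ vanishing 𝒰 B n) : Φ = Ψ := by
  apply WithConv.ext
  apply ext_symPow
  intro m a ha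
  have := h (m + 1) m (Nat.lt_succ_self m) a ha
  exact sub_eq_zero.1 this

theorem mul_sub_mul_mem_vanishing {n : ℕ} {Φ Φ' Ψ Ψ' : WithConv (GrSym 𝒰 →ₗ[k] B)}
    (hΦ : Φ - Φ' ∈ vanishing 𝒰 B n) (hΨ : Ψ - Ψ' ∈ vanishing 𝒰 B n) :
    Φ * Ψ - Φ' * Ψ' ∈ vanishing 𝒰 B n := by
  rw [show Φ * Ψ - Φ' * Ψ' = (Φ - Φ') * Ψ + Φ' * (Ψ - Ψ') by noncomm_ring]
  refine add_mem ?_ ?_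
  · simpa using mul_mem_vanishing hΦ (mem_vanishing_zero Ψ)
  · simpa using mul_mem_vanishing (mem_vanishing_zero Φ') hΨ

theorem aeval_mem_vanishing {Φ : WithConv (GrSym 𝒰 →ₗ[k] B)} (hΦ : Φ ∈ vanishing 𝒰 B 1) {n : ℕ}
    {P : Polynomial k} (hP : ∀ i < n, P.coeff i = 0) :
    Polynomial.aeval Φ P ∈ vanishing 𝒰 B n := by
  obtain ⟨Q, rfl⟩ := Polynomial.X_pow_dvd_iff.2 hP
  rw [map_mul, map_pow, Polynomial.aeval_X]
  simpa using mul_mem_vanishing (pow_mem_vanishing hΦ n) (mem_vanishing_zero _)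

/-- The value `∑ pₙ φⁿ` of a power series at a linear map `φ : S(U) → B` with `φ 1 = 0`. -/
def powerSeriesEval (φ : GrSym 𝒰 →ₗ[k] B) (p : PowerSeries k) : GrSym 𝒰 →ₗ[k] B :=
  assemble 𝒰 fun m => (Polynomial.aeval (WithConv.toConv φ) (PowerSeries.trunc (m + 1) p)).ofConv

/-- Since `φ 1 = 0`, the powers `φ^j` with `j ≥ n` vanish below `S^n(U)`. There a polynomial with
the right coefficients below `n` already computes the series. -/
theorem powerSeriesEval_sub_aeval {φ : GrSym 𝒰 →ₗ[k] B} (hφ : φ 1 = 0) {n : ℕ}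
    {p : PowerSeries k} {P : Polynomial k} (h : ∀ i < n, P.coeff i = PowerSeries.coeff i p) :
    WithConv.toConv (powerSeriesEval φ p) - Polynomial.aeval (WithConv.toConv φ) P ∈
      vanishing 𝒰 B n := by
  intro m hm a ha
  have h1 := aeval_mem_vanishing (mem_vanishing_one (Φ := WithConv.toConv φ) hφ) (n := m + 1)
    (P := PowerSeries.trunc (m + 1) p - P) (fun i hi => by
      rw [Polynomial.coeff_sub, PowerSeries.coeff_trunc, if_pos hi, h i (by omega), sub_self])
    m (Nat.lt_succ_self m) a ha
  rw [map_sub] at h1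
  rw [← h1]
  simp only [WithConv.ofConv_sub, LinearMap.sub_apply, powerSeriesEval, assemble_of_mem 𝒰 _ ha]

/-- The criterion by which evaluation at `φ` is shown to be multiplicative, so that the inversion of
`exp` by `log` becomes an identity of formal power series. -/
theorem eq_powerSeriesEval {φ Φ : GrSym 𝒰 →ₗ[k] B} (hφ : φ 1 = 0) {p : PowerSeries k}
    (h : ∀ n, ∃ P : Polynomial k, (∀ i < n, P.coeff i = PowerSeries.coeff i p) ∧
      WithConv.toConv Φ - Polynomial.aeval (WithConv.toConv φ) P ∈ vanishing 𝒰 B n) :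
    Φ = powerSeriesEval φ p := by
  apply WithConv.toConv_injective
  apply eq_of_sub_mem_vanishing
  intro n
  obtain ⟨P, hP, h1⟩ := h n
  have := sub_mem h1 (powerSeriesEval_sub_aeval hφ hP)
  simpa using this

theorem powerSeriesEval_mul {φ : GrSym 𝒰 →ₗ[k] B} (hφ : φ 1 = 0) (p q : PowerSeries k) :
    (WithConv.toConv (powerSeriesEval φ p) * WithConv.toConv (powerSeriesEval φ q)).ofConv =
      powerSeriesEval φ (p * q) := by
  apply eq_powerSeriesEval hφ
  intro n
  refine ⟨p.trunc n * q.trunc n, ?_, ?_⟩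
  · intro i hi
    rw [Polynomial.coeff_mul, PowerSeries.coeff_mul]
    refine Finset.sum_congr rfl fun x hx => ?_
    have := Finset.HasAntidiagonal.mem_antidiagonal.1 hx
    rw [PowerSeries.coeff_trunc, PowerSeries.coeff_trunc, if_pos (by omega), if_pos (by omega)]
  · rw [map_mul]
    exact mul_sub_mul_mem_vanishing
      (powerSeriesEval_sub_aeval hφ fun i hi => by rw [PowerSeries.coeff_trunc, if_pos hi])
      (powerSeriesEval_sub_aeval hφ fun i hi => by rw [PowerSeries.coeff_trunc, if_pos hi])

theorem powerSeriesEval_one {φ : GrSym 𝒰 →ₗ[k] B} (hφ : φ 1 = 0) :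
    powerSeriesEval φ 1 = (1 : WithConv (GrSym 𝒰 →ₗ[k] B)).ofConv := by
  symm
  apply eq_powerSeriesEval hφ
  intro n
  exact ⟨1, fun i _ => by simp [Polynomial.coeff_one, PowerSeries.coeff_one], by simp⟩

theorem powerSeriesEval_pow {φ : GrSym 𝒰 →ₗ[k] B} (hφ : φ 1 = 0) (p : PowerSeries k) (n : ℕ) :
    (WithConv.toConv (powerSeriesEval φ p) ^ n).ofConv = powerSeriesEval φ (p ^ n) := by
  induction n with
  | zero => rw [pow_zero, pow_zero, powerSeriesEval_one hφ]
  | succ n ih => rw [pow_succ, pow_succ, ← powerSeriesEval_mul hφ, ← ih]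

theorem powerSeriesEval_apply (φ : GrSym 𝒰 →ₗ[k] B) (p : PowerSeries k) {m : ℕ}
    {a : GrSym 𝒰} (ha : a ∈ symPow 𝒰 m) : powerSeriesEval φ p a =
      Polynomial.aeval (WithConv.toConv φ) (PowerSeries.trunc (m + 1) p) a := by
  rw [powerSeriesEval, assemble_of_mem 𝒰 _ ha]

theorem powerSeriesEval_sub (φ : GrSym 𝒰 →ₗ[k] B) (p q : PowerSeries k) :
    powerSeriesEval φ (p - q) = powerSeriesEval φ p - powerSeriesEval φ q := by
  apply ext_symPow
  intro m a ha
  rw [LinearMap.sub_apply, powerSeriesEval_apply _ _ ha, powerSeriesEval_apply _ _ ha,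
    powerSeriesEval_apply _ _ ha, PowerSeries.trunc_sub, map_sub]
  rfl

/-- The exponential series. -/
def expSeries (k : Type u) [Field k] : PowerSeries k := PowerSeries.mk fun n => (n.factorial : k)⁻¹

theorem exp_eq_powerSeriesEval (φ : GrSym 𝒰 →ₗ[k] B) :
    exp 𝒰 φ = powerSeriesEval φ (expSeries k) := by
  apply ext_symPow
  intro m a ha
  rw [powerSeriesEval_apply _ _ ha, exp, assemble_of_mem 𝒰 _ ha,
    Polynomial.aeval_eq_sum_range' (PowerSeries.natDegree_trunc_lt _ m), WithConv.ofConv_sum,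
    LinearMap.sum_apply, LinearMap.sum_apply]
  refine Finset.sum_congr rfl fun j hj => ?_
  rw [PowerSeries.coeff_trunc, if_pos (Finset.mem_range.1 hj), expSeries, PowerSeries.coeff_mk]
  rfl

theorem exp_apply (φ : GrSym 𝒰 →ₗ[k] B) {m : ℕ} {a : GrSym 𝒰} (ha : a ∈ symPow 𝒰 m) :
    exp 𝒰 φ a =
      ∑ j ∈ Finset.range (m + 1), (j.factorial : k)⁻¹ • (WithConv.toConv φ ^ j) a := by
  rw [exp, assemble_of_mem 𝒰 _ ha]
  simp [LinearMap.sum_apply]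

theorem exp_one (φ : GrSym 𝒰 →ₗ[k] B) : exp 𝒰 φ 1 = 1 := by
  rw [exp_apply φ (m := 0) SetLike.GradedOne.one_mem]
  simp only [zero_add, Finset.sum_range_one, Nat.factorial_zero, Nat.cast_one, inv_one, pow_zero,
    one_smul, LinearMap.convOne_apply]
  rw [show Coalgebra.counit (R := k) (1 : GrSym 𝒰) = 1 from map_one (counitAlgHom 𝒰), map_one]

/-- Put `e = exp - 1`, so that `e' = 1 + e`. The derivative of the `m`-th partial sum of `log (1 +
e)` is then `1 - (-e)^m`, which agrees with the derivative of `X` modulo `X^m`. In characteristic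
zero this gives agreement of the two series up to order `m`, since both have constant term zero. -/
theorem coeff_logSeries_comp_expSeries [CharZero k] (m n : ℕ) (h : n ≤ m) :
    PowerSeries.coeff n (∑ j ∈ Finset.Icc 1 m,
      ((-1 : k) ^ (j - 1) * (j : k)⁻¹) • (expSeries k - 1) ^ j) =
      PowerSeries.coeff n (PowerSeries.X : PowerSeries k) := by
  set e : PowerSeries k := expSeries k - 1 with he
  have he0 : PowerSeries.constantCoeff e = 0 := by
    rw [← PowerSeries.coeff_zero_eq_constantCoeff_apply]
    simp [he, expSeries]
  have hder : PowerSeries.derivative k e = 1 + e := by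
    ext i
    rw [show (1 : PowerSeries k) + e = expSeries k by simp [he], he, map_sub,
      PowerSeries.derivative_one, sub_zero, PowerSeries.coeff_derivative, expSeries,
      PowerSeries.coeff_mk, PowerSeries.coeff_mk, Nat.factorial_succ]
    have h1 : (i : k) + 1 ≠ 0 := by exact_mod_cast Nat.succ_ne_zero i
    have h2 : (i.factorial : k) ≠ 0 := by exact_mod_cast i.factorial_ne_zero
    push_cast
    field_simp
  set G : ℕ → PowerSeries k := fun m => ∑ j ∈ Finset.Icc 1 m,
      ((-1 : k) ^ (j - 1) * (j : k)⁻¹) • e ^ j with hG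
  -- Differentiation cancels the denominators `j`, and the resulting geometric sum telescopes
  -- against the factor `1 + e`.
  have hG' : ∀ m, PowerSeries.derivative k (G m) = 1 - (-e) ^ m := by
    intro m
    induction m with
    | zero => simp [hG]
    | succ m ih =>
      have h1 : ((m + 1 : ℕ) : k) ≠ 0 := by exact_mod_cast Nat.succ_ne_zero m
      rw [show G (m + 1) = G m + ((-1 : k) ^ m * ((m + 1 : ℕ) : k)⁻¹) • e ^ (m + 1) from
        Finset.sum_Icc_succ_top (by omega) _, map_add, ih, Derivation.map_smul, PowerSeries.derivative_pow,
        hder, Nat.add_sub_cancel]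
      have h2 : ((-1 : k) ^ m * ((m + 1 : ℕ) : k)⁻¹) •
          (((m + 1 : ℕ) : PowerSeries k) * e ^ m * (1 + e)) = (-e) ^ m * (1 + e) := by
        rw [← map_natCast (algebraMap k (PowerSeries k)), mul_assoc, ← Algebra.smul_def, smul_smul,
          mul_assoc, inv_mul_cancel₀ h1, mul_one, neg_pow e, mul_assoc, Algebra.smul_def]
        simp
      rw [h2]
      ring
  have hG0 : PowerSeries.coeff 0 (G m) = 0 := by
    rw [hG, map_sum]
    refine Finset.sum_eq_zero fun j hj => ?_
    have hj1 : j ≠ 0 := by have := (Finset.mem_Icc.1 hj).1; omega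
    rw [map_smul, PowerSeries.coeff_zero_eq_constantCoeff_apply, map_pow, he0, zero_pow hj1,
      smul_zero]
  change PowerSeries.coeff n (G m) = _
  rcases n with _ | n
  · rw [hG0]; simp
  · have h1 : ((n + 1 : ℕ) : k) ≠ 0 := by exact_mod_cast Nat.succ_ne_zero n
    have h2 := PowerSeries.coeff_derivative (G m) n
    -- The coefficient of order `n + 1` of the partial sum is read off from that of order `n` of its
    -- derivative, so `n + 1 ≤ m` is just enough for the term `(-e)^m` not to interfere.
    have h4 : (PowerSeries.X : PowerSeries k) ^ m ∣ (-e) ^ m :=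
      pow_dvd_pow_of_dvd (PowerSeries.X_dvd_iff.2 (by rw [map_neg, he0, neg_zero])) m
    rw [hG', map_sub, PowerSeries.X_pow_dvd_iff.1 h4 n h, sub_zero] at h2
    apply mul_right_cancel₀ h1
    push_cast
    rw [← h2]
    have h3 := PowerSeries.coeff_derivative (PowerSeries.X : PowerSeries k) n
    rw [PowerSeries.derivative_X] at h3
    exact h3

/-- The logarithm inverts the exponential. -/
theorem log_exp [CharZero k] {φ : GrSym 𝒰 →ₗ[k] B} (hφ : φ 1 = 0) : log 𝒰 (exp 𝒰 φ) = φ := by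
  have h1 : WithConv.toConv (exp 𝒰 φ) - 1 =
      WithConv.toConv (powerSeriesEval φ (expSeries k - 1)) := by
    rw [powerSeriesEval_sub, powerSeriesEval_one hφ, exp_eq_powerSeriesEval]; rfl
  apply ext_symPow
  intro m a ha
  rw [log, assemble_of_mem 𝒰 _ ha, h1]
  -- On `S⁰(U)` the sum defining `log` is empty, which matches `φ 1 = 0`.
  rcases m with _ | m
  · rw [symPow_zero_eq 𝒰 ha, Algebra.algebraMap_eq_smul_one, map_smul, map_smul, hφ]
    simp
  simp only [powerSeriesEval_pow hφ]
  have h2 : ∀ c : ℕ → k, (∑ j ∈ Finset.Icc 1 (m + 1),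
      c j • powerSeriesEval φ ((expSeries k - 1) ^ j)) a =
      powerSeriesEval φ (∑ j ∈ Finset.Icc 1 (m + 1), c j • (expSeries k - 1) ^ j) a := by
    intro c
    rw [powerSeriesEval_apply _ _ ha, map_sum, map_sum, LinearMap.sum_apply, WithConv.ofConv_sum,
      LinearMap.sum_apply]
    refine Finset.sum_congr rfl fun j _ => ?_
    rw [LinearMap.smul_apply, powerSeriesEval_apply _ _ ha, map_smul, map_smul]
    rfl
  rw [h2, powerSeriesEval_apply _ _ ha]
  have h3 : PowerSeries.trunc (m + 1 + 1) (∑ j ∈ Finset.Icc 1 (m + 1),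
      ((-1 : k) ^ (j - 1) * (j : k)⁻¹) • (expSeries k - 1) ^ j) = Polynomial.X := by
    ext i
    rw [PowerSeries.coeff_trunc, Polynomial.coeff_X]
    split_ifs with h h' h'
    · rw [coeff_logSeries_comp_expSeries _ _ (by omega), PowerSeries.coeff_X, if_pos h'.symm]
    · rw [coeff_logSeries_comp_expSeries _ _ (by omega), PowerSeries.coeff_X,
        if_neg (Ne.symm h')]
    · omega
    · rfl
  rw [h3, Polynomial.aeval_X]

/-- The functional equation of the exponential. -/
theorem exp_add [CharZero k] {φ ψ : GrSym 𝒰 →ₗ[k] B} (hφ : φ 1 = 0) (hψ : ψ 1 = 0)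
    (h : Commute (WithConv.toConv φ) (WithConv.toConv ψ)) :
    WithConv.toConv (exp 𝒰 (φ + ψ)) = WithConv.toConv (exp 𝒰 φ) * WithConv.toConv (exp 𝒰 ψ) := by
  have hE : ∀ {χ : GrSym 𝒰 →ₗ[k] B}, χ 1 = 0 → ∀ n, WithConv.toConv (exp 𝒰 χ) -
      ∑ j ∈ Finset.range n, (j.factorial : k)⁻¹ • WithConv.toConv χ ^ j ∈ vanishing 𝒰 B n := by
    intro χ hχ n
    have := powerSeriesEval_sub_aeval hχ (n := n) (p := expSeries k)
      (P := ∑ j ∈ Finset.range n, Polynomial.monomial j (j.factorial : k)⁻¹) (fun i hi => by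
        rw [Polynomial.finsetSum_coeff]
        simp [Polynomial.coeff_monomial, hi, expSeries])
    rw [← exp_eq_powerSeriesEval, map_sum] at this
    simpa only [Polynomial.aeval_monomial, ← Algebra.smul_def] using this
  apply eq_of_sub_mem_vanishing
  intro n
  have h1 := hE (χ := φ + ψ) (by simp [hφ, hψ]) n
  have h2 := mul_sub_mul_mem_vanishing (hE hφ n) (hE hψ n)
  set a := WithConv.toConv φ with ha
  set b := WithConv.toConv ψ with hb
  have ha1 : a ∈ vanishing 𝒰 B 1 := mem_vanishing_one hφ
  have hb1 : b ∈ vanishing 𝒰 B 1 := mem_vanishing_one hψ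
  -- The product of the truncated exponentials is a sum over the square of exponents below `n`. The
  -- binomial formula, which uses that the maps commute, turns the truncated exponential of the sum
  -- into the triangle `x.1 + x.2 < n`. The remaining terms have total exponent at least `n` and lie
  -- in `vanishing 𝒰 B n`.
  have h3 : (∑ j ∈ Finset.range n, (j.factorial : k)⁻¹ • a ^ j) *
      (∑ j ∈ Finset.range n, (j.factorial : k)⁻¹ • b ^ j) -
      ∑ j ∈ Finset.range n, (j.factorial : k)⁻¹ • WithConv.toConv (φ + ψ) ^ j ∈
        vanishing 𝒰 B n := by
    set f : ℕ × ℕ → WithConv (GrSym 𝒰 →ₗ[k] B) := fun x =>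
      ((x.1.factorial : k)⁻¹ * (x.2.factorial : k)⁻¹) • (a ^ x.1 * b ^ x.2) with hf
    have e1 : (∑ j ∈ Finset.range n, (j.factorial : k)⁻¹ • a ^ j) *
        (∑ j ∈ Finset.range n, (j.factorial : k)⁻¹ • b ^ j) =
        ∑ x ∈ Finset.range n ×ˢ Finset.range n, f x := by
      rw [Finset.sum_mul_sum, Finset.sum_product]
      simp only [hf, smul_mul_smul_comm]
    have e2 : ∑ j ∈ Finset.range n, (j.factorial : k)⁻¹ • WithConv.toConv (φ + ψ) ^ j =
        ∑ x ∈ (Finset.range n ×ˢ Finset.range n) with x.1 + x.2 < n, f x := by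
      rw [← Finset.sum_fiberwise_of_maps_to (t := Finset.range n) (g := fun x : ℕ × ℕ => x.1 + x.2)
        (fun x hx => Finset.mem_range.2 (Finset.mem_filter.1 hx).2)]
      refine Finset.sum_congr rfl fun j hj => ?_
      have hj' := Finset.mem_range.1 hj
      have e3 : (((Finset.range n ×ˢ Finset.range n).filter fun x => x.1 + x.2 < n).filter
          fun x => x.1 + x.2 = j) = Finset.HasAntidiagonal.antidiagonal j := by
        ext x
        simp only [Finset.mem_filter, Finset.mem_product, Finset.mem_range,
          Finset.HasAntidiagonal.mem_antidiagonal]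
        omega
      rw [e3, WithConv.toConv_add, h.add_pow', Finset.smul_sum]
      refine Finset.sum_congr rfl fun x hx => ?_
      have hx' := Finset.HasAntidiagonal.mem_antidiagonal.1 hx
      subst hx'
      rw [← Nat.cast_smul_eq_nsmul k, smul_smul, hf]
      congr 1
      have f1 : (x.1.factorial : k) ≠ 0 := by exact_mod_cast x.1.factorial_ne_zero
      have f2 : (x.2.factorial : k) ≠ 0 := by exact_mod_cast x.2.factorial_ne_zero
      have f3 : ((x.1 + x.2).factorial : k) ≠ 0 := by exact_mod_cast (x.1 + x.2).factorial_ne_zero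
      have f4 : ((x.1 + x.2).choose x.1 : k) * x.1.factorial * x.2.factorial =
          (x.1 + x.2).factorial := by
        rw [Nat.choose_symm_add]; exact_mod_cast Nat.add_choose_mul_factorial_mul_factorial x.1 x.2
      field_simp
      linear_combination f4
    rw [e1, e2, ← Finset.sum_filter_add_sum_filter_not (Finset.range n ×ˢ Finset.range n)
      (fun x => x.1 + x.2 < n), add_sub_cancel_left]
    refine Submodule.sum_mem _ fun x hx => Submodule.smul_mem _ _ ?_
    exact vanishing_anti (not_lt.1 (Finset.mem_filter.1 hx).2)
      (mul_mem_vanishing (pow_mem_vanishing ha1 _) (pow_mem_vanishing hb1 _))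
  have := sub_mem (sub_mem h1 h2) h3
  convert this using 1
  abel

theorem algHom_comp_pow (f : B →ₐ[k] B') (φ : GrSym 𝒰 →ₗ[k] B) (n : ℕ) :
    f.toLinearMap ∘ₗ (WithConv.toConv φ ^ n).ofConv =
      (WithConv.toConv (f.toLinearMap ∘ₗ φ) ^ n).ofConv := by
  induction n with
  | zero =>
    ext a
    simp
  | succ n ih =>
    rw [pow_succ, pow_succ, LinearMap.algHom_comp_convMul_distrib, ih]

/-- Convolution involves only the product of the target, so an algebra morphism out of the target
passes through it. The cases of interest are the two inclusions into the tensor square, the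
comultiplication and the augmentation. -/
theorem algHom_comp_exp (f : B →ₐ[k] B') (φ : GrSym 𝒰 →ₗ[k] B) :
    f.toLinearMap ∘ₗ exp 𝒰 φ = exp 𝒰 (f.toLinearMap ∘ₗ φ) := by
  apply ext_symPow
  intro m a ha
  rw [LinearMap.comp_apply, exp_apply φ ha, exp_apply _ ha, map_sum]
  refine Finset.sum_congr rfl fun j _ => ?_
  rw [map_smul, ← algHom_comp_pow]
  rfl

end Convolution
end GrSym

/-! ### The graded tensor square, its braiding, and graded cocommutativity. -/

namespace GrSym

variable {k : Type u} [Field k] {U : Type v} [AddCommGroup U] [Module k U]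
  {U' : Type v} [AddCommGroup U'] [Module k U']
variable (𝒰 : ℤ → Submodule k U) [Decomposition 𝒰] (𝒰' : ℤ → Submodule k U') [Decomposition 𝒰']

section Braiding

/-- The inclusion of the left factor. -/
abbrev inL : GrSym 𝒰 →ₐ[k] GradedTensorProduct k (deg 𝒰) (deg 𝒰) :=
  GradedTensorProduct.includeLeft (deg 𝒰) (deg 𝒰)

/-- The inclusion of the right factor. -/
abbrev inR : GrSym 𝒰 →ₐ[k] GradedTensorProduct k (deg 𝒰) (deg 𝒰) :=
  GradedTensorProduct.includeRight (deg 𝒰) (deg 𝒰)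

/-- The identification of the tensor square of `S(U)` with the graded tensor product. -/
abbrev tmulEquiv : GrSym 𝒰 ⊗[k] GrSym 𝒰 ≃ₗ[k] GradedTensorProduct k (deg 𝒰) (deg 𝒰) :=
  GradedTensorProduct.of k (deg 𝒰) (deg 𝒰)

/-- The braiding. -/
abbrev braid : GradedTensorProduct k (deg 𝒰) (deg 𝒰) ≃ₐ[k]
    GradedTensorProduct k (deg 𝒰) (deg 𝒰) := GradedTensorProduct.comm (deg 𝒰) (deg 𝒰)

/-- The parity operator `x ↦ (-1)^|x| x` on `S(U)`. -/
abbrev par : GrSym 𝒰 →ₗ[k] GrSym 𝒰 := gradeSign (deg 𝒰) 1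

theorem inL_mul_inR (a b : GrSym 𝒰) : inL 𝒰 a * inR 𝒰 b = tmulEquiv 𝒰 (a ⊗ₜ b) :=
  GradedTensorProduct.tmul_one_mul_one_tmul _ _ a b

/-- Twice the Koszul sign `(-1)^(ij)` is `1 + (-1)^i + (-1)^j - (-1)^i (-1)^j`. This expresses the
braiding through parity operators alone, so that it can be compared with linear maps without
homogeneous elements. -/
theorem braid_tmul (a b : GrSym 𝒰) : (2 : k) • braid 𝒰 (tmulEquiv 𝒰 (a ⊗ₜ b)) =
    tmulEquiv 𝒰 (b ⊗ₜ a + b ⊗ₜ par 𝒰 a + par 𝒰 b ⊗ₜ a - par 𝒰 b ⊗ₜ par 𝒰 a) := by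
  induction a using Decomposition.inductionOn (deg 𝒰) with
  | zero => simp
  | add a c ha hc =>
    simp only [TensorProduct.add_tmul, TensorProduct.tmul_add, map_add, smul_add, map_sub] at ha hc ⊢
    rw [ha, hc]; abel
  | @homogeneous i a =>
    induction b using Decomposition.inductionOn (deg 𝒰) with
    | zero => simp
    | add b c hb hc =>
      simp only [TensorProduct.add_tmul, TensorProduct.tmul_add, map_add, smul_add, map_sub]
        at hb hc ⊢
      rw [hb, hc]; abel
    | @homogeneous j b =>
      have h := GradedTensorProduct.comm_coe_tmul_coe (R := k) (deg 𝒰) (deg 𝒰) a b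
      have h' : (2 : k) • (-1 : k) ^ (j * i) • tmulEquiv 𝒰 ((b : GrSym 𝒰) ⊗ₜ[k] (a : GrSym 𝒰)) =
          tmulEquiv 𝒰 ((b : GrSym 𝒰) ⊗ₜ (a : GrSym 𝒰) + (b : GrSym 𝒰) ⊗ₜ par 𝒰 a +
            par 𝒰 b ⊗ₜ (a : GrSym 𝒰) - par 𝒰 b ⊗ₜ par 𝒰 a) := by
        rw [par, gradeSign_of_mem _ _ a.2, gradeSign_of_mem _ _ b.2, ← map_smul, ← map_smul]
        congr 1
        simp only [TensorProduct.tmul_smul, ← TensorProduct.smul_tmul', one_mul]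
        rw [smul_smul]
        have h4 : (2 : k) * (-1) ^ (j * i) =
            1 + (-1) ^ i + (-1) ^ j - (-1) ^ i * (-1) ^ j := by
          rcases Int.even_or_odd i with hi | hi <;> rcases Int.even_or_odd j with hj | hj
          · rw [hi.neg_one_zpow, hj.neg_one_zpow, (hj.mul_right _).neg_one_zpow]; ring
          · rw [hi.neg_one_zpow, hj.neg_one_zpow, (hi.mul_left _).neg_one_zpow]; ring
          · rw [hi.neg_one_zpow, hj.neg_one_zpow, (hj.mul_right _).neg_one_zpow]; ring
          · rw [hi.neg_one_zpow, hj.neg_one_zpow, (hj.mul hi).neg_one_zpow]; ring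
        rw [h4, sub_smul, add_smul, add_smul, one_smul, mul_smul]
      rw [← h']
      congr 1
      exact h.trans (uzpow_smul (j * i) _)

theorem braid_inL (a : GrSym 𝒰) : braid 𝒰 (inL 𝒰 a) = inR 𝒰 a := by
  induction a using Decomposition.inductionOn (deg 𝒰) with
  | zero => rw [map_zero, map_zero, map_zero]
  | add a c ha hc => rw [map_add, map_add, ha, hc, map_add]
  | @homogeneous i a =>
    have h := GradedTensorProduct.comm_coe_tmul_coe (R := k) (deg 𝒰) (deg 𝒰) a
      ⟨1, SetLike.GradedOne.one_mem⟩
    rw [zero_mul, uzpow_zero, one_smul] at h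
    exact h

theorem braid_inR (a : GrSym 𝒰) : braid 𝒰 (inR 𝒰 a) = inL 𝒰 a := by
  induction a using Decomposition.inductionOn (deg 𝒰) with
  | zero => rw [map_zero, map_zero, map_zero]
  | add a c ha hc => rw [map_add, map_add, ha, hc, map_add]
  | @homogeneous i a =>
    have h := GradedTensorProduct.comm_coe_tmul_coe (R := k) (deg 𝒰) (deg 𝒰)
      ⟨1, SetLike.GradedOne.one_mem⟩ a
    rw [mul_zero, uzpow_zero, one_smul] at h
    exact h

theorem comulAlgHom_ι (x : U) : comulAlgHom 𝒰 (ι 𝒰 x) = inL 𝒰 (ι 𝒰 x) + inR 𝒰 (ι 𝒰 x) :=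
  lift_ι 𝒰 _ _ x

theorem tmulEquiv_comul (a : GrSym 𝒰) : tmulEquiv 𝒰 (Coalgebra.comul a) = comulAlgHom 𝒰 a := rfl

/-- Graded cocommutativity of `S(U)`. -/
theorem braid_comul (a : GrSym 𝒰) : braid 𝒰 (comulAlgHom 𝒰 a) = comulAlgHom 𝒰 a := by
  have : (braid 𝒰).toAlgHom.comp (comulAlgHom 𝒰) = comulAlgHom 𝒰 := by
    apply algHom_ext
    intro x
    change braid 𝒰 (comulAlgHom 𝒰 (ι 𝒰 x)) = _
    rw [comulAlgHom_ι, map_add, braid_inL, braid_inR, add_comm]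
  exact DFunLike.congr_fun this a

variable {𝒰 𝒰'}

/-- A tensor product of maps after the comultiplication is a convolution product with values in the
tensor square. Coalgebra identities thereby become computations in a convolution algebra. -/
theorem inL_convMul_inR (F G : GrSym 𝒰 →ₗ[k] GrSym 𝒰') (a : GrSym 𝒰) :
    (WithConv.toConv ((inL 𝒰').toLinearMap ∘ₗ F) *
      WithConv.toConv ((inR 𝒰').toLinearMap ∘ₗ G)) a =
      tmulEquiv 𝒰' (TensorProduct.map F G (Coalgebra.comul a)) := by
  rw [LinearMap.convMul_apply]
  generalize (Coalgebra.comul a : GrSym 𝒰 ⊗[k] GrSym 𝒰) = t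
  induction t using TensorProduct.induction_on with
  | zero => simp only [map_zero]
  | add s t hs ht => simp only [map_add] at hs ht ⊢; rw [hs, ht]
  | tmul a b => exact inL_mul_inR 𝒰' _ _

theorem inR_convMul_inL (F G : GrSym 𝒰 →ₗ[k] GrSym 𝒰') (a : GrSym 𝒰) :
    (WithConv.toConv ((inR 𝒰').toLinearMap ∘ₗ G) *
      WithConv.toConv ((inL 𝒰').toLinearMap ∘ₗ F)) a =
      braid 𝒰' (tmulEquiv 𝒰' (TensorProduct.map G F (Coalgebra.comul a))) := by
  rw [LinearMap.convMul_apply]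
  generalize (Coalgebra.comul a : GrSym 𝒰 ⊗[k] GrSym 𝒰) = t
  induction t using TensorProduct.induction_on with
  | zero => simp only [map_zero]
  | add s t hs ht => simp only [map_add] at hs ht ⊢; rw [hs, ht]
  | tmul a b =>
    rw [TensorProduct.map_tmul, TensorProduct.map_tmul, ← inL_mul_inR, map_mul, braid_inL,
      braid_inR]
    rfl

/-- The hypothesis is the compatibility with the braiding in the doubled form of `braid_tmul`;
characteristic zero removes the factor. The freedom of `F'` serves two cases: `F' = F` when both
maps are even, and `F' = F ∘ₗ par 𝒰` when `G` is odd. -/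
theorem braid_map [CharZero k] {F G F' : GrSym 𝒰 →ₗ[k] GrSym 𝒰'} 
    (h : ∀ a b, F b ⊗ₜ[k] G a + F b ⊗ₜ par 𝒰' (G a) + par 𝒰' (F b) ⊗ₜ G a -
      par 𝒰' (F b) ⊗ₜ par 𝒰' (G a) = F' b ⊗ₜ G a + F' b ⊗ₜ G (par 𝒰 a) + F' (par 𝒰 b) ⊗ₜ G a -
      F' (par 𝒰 b) ⊗ₜ G (par 𝒰 a)) (t : GrSym 𝒰 ⊗[k] GrSym 𝒰) :
    braid 𝒰' (tmulEquiv 𝒰' (TensorProduct.map G F t)) =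
      tmulEquiv 𝒰' (TensorProduct.map F' G ((tmulEquiv 𝒰).symm (braid 𝒰 (tmulEquiv 𝒰 t)))) := by
  have h2 : (2 : k) ≠ 0 := two_ne_zero
  apply smul_right_injective _ h2
  induction t using TensorProduct.induction_on with
  | zero => simp
  | add s t hs ht => simp only [map_add, smul_add] at hs ht ⊢; rw [hs, ht]
  | tmul a b =>
    simp only [TensorProduct.map_tmul, braid_tmul, h]
    rw [← map_smul, ← map_smul, ← map_smul, braid_tmul]
    simp

theorem inR_convMul_inL_of_even [CharZero k] {F G : GrSym 𝒰 →ₗ[k] GrSym 𝒰'}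
    (hF : ∀ a, par 𝒰' (F a) = F (par 𝒰 a)) (hG : ∀ a, par 𝒰' (G a) = G (par 𝒰 a)) :
    WithConv.toConv ((inR 𝒰').toLinearMap ∘ₗ G) * WithConv.toConv ((inL 𝒰').toLinearMap ∘ₗ F) =
    WithConv.toConv ((inL 𝒰').toLinearMap ∘ₗ F) * WithConv.toConv ((inR 𝒰').toLinearMap ∘ₗ G) := by
  ext a
  rw [inL_convMul_inR, inR_convMul_inL]
  rw [braid_map (F' := F) (fun a b => by simp only [hF, hG]), tmulEquiv_comul, braid_comul]
  rfl

/-- Graded cocommutativity permits the exchange; carrying the odd `G` past `F` costs the sign of the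
argument of `F`, which `par` records. -/
theorem inR_convMul_inL_of_odd [CharZero k] {F G : GrSym 𝒰 →ₗ[k] GrSym 𝒰'}
    (hF : ∀ a, par 𝒰' (F a) = F (par 𝒰 a)) (hG : ∀ a, par 𝒰' (G a) = -G (par 𝒰 a)) :
    WithConv.toConv ((inR 𝒰').toLinearMap ∘ₗ G) * WithConv.toConv ((inL 𝒰').toLinearMap ∘ₗ F) =
    WithConv.toConv ((inL 𝒰').toLinearMap ∘ₗ F ∘ₗ par 𝒰) *
      WithConv.toConv ((inR 𝒰').toLinearMap ∘ₗ G) := by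
  ext a
  rw [inL_convMul_inR, inR_convMul_inL]
  rw [braid_map (F' := F ∘ₗ par 𝒰) (fun a b => by
    simp only [hF, hG, LinearMap.comp_apply, gradeSign_self, TensorProduct.tmul_neg]; abel),
    tmulEquiv_comul, braid_comul]
  rfl

end Braiding

/-! ### Primitive elements and coalgebra morphisms. -/

section Coalgebra
variable {𝒰 𝒰'}

theorem comul_ι (x : U) :
    (Coalgebra.comul (ι 𝒰 x) : GrSym 𝒰 ⊗[k] GrSym 𝒰) = ι 𝒰 x ⊗ₜ 1 + 1 ⊗ₜ ι 𝒰 x :=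
  comulAlgHom_ι 𝒰 x

theorem comul_one : (Coalgebra.comul (1 : GrSym 𝒰) : GrSym 𝒰 ⊗[k] GrSym 𝒰) = 1 ⊗ₜ 1 :=
  comulLin_one 𝒰

theorem counit_eq (a : GrSym 𝒰) : Coalgebra.counit (R := k) a = counitAlgHom 𝒰 a := rfl

/-- Primitive elements of `S(U)` lie in `U`. -/
theorem eq_ι_proj_of_primitive [CharZero k] {a : GrSym 𝒰}
    (h : (Coalgebra.comul a : GrSym 𝒰 ⊗[k] GrSym 𝒰) = a ⊗ₜ 1 + 1 ⊗ₜ a) : a = ι 𝒰 (proj 𝒰 a) := by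
  -- Multiplication after comultiplication is `2` on a primitive element but `2^n` on its component
  -- in `S^n(U)`. In characteristic zero `2^n = 2` only for `n = 1`, so the other components vanish.
  have h1 : LinearMap.mul' k (GrSym 𝒰) (Coalgebra.comul a) = (2 : k) • a := by
    rw [h]; simp [two_smul]
  rw [ι_proj, ← sub_eq_zero]
  apply eq_zero_of_projPow 𝒰
  intro n
  rw [map_sub, projPow_of_mem 𝒰 (projPow_mem 𝒰 1 a)]
  have h2 : ∀ b : GrSym 𝒰, projPow 𝒰 n (LinearMap.mul' k (GrSym 𝒰) (Coalgebra.comul b)) =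
      (2 : k) ^ n • projPow 𝒰 n b := by
    apply LinearMap.congr_fun
      (f := projPow 𝒰 n ∘ₗ LinearMap.mul' k (GrSym 𝒰) ∘ₗ Coalgebra.comul)
      (g := (2 : k) ^ n • projPow 𝒰 n)
    apply ext_symPow
    intro m b hb
    simp only [LinearMap.comp_apply, mul_comul 𝒰 hb, map_smul, LinearMap.smul_apply,
      projPow_of_mem 𝒰 hb]
    split_ifs with h
    · rw [h]
    · simp
  have h3 := h2 a
  rw [h1, map_smul] at h3
  split_ifs with hn
  · rw [hn, sub_self]
  · rw [sub_zero]
    have h4 : ((2 : k) ^ n - 2) ≠ 0 := by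
      rw [sub_ne_zero]
      intro h5
      have h6 : (2 : ℕ) ^ n = 2 ^ 1 := by exact_mod_cast h5
      exact hn (Nat.pow_right_injective le_rfl h6)
    have h7 : ((2 : k) ^ n - 2) • projPow 𝒰 n a = 0 := by rw [sub_smul, ← h3, sub_self]
    exact (smul_eq_zero.1 h7).resolve_left h4

/-- The comultiplication on a word of positive length, up to its reduced part. -/
theorem comul_word_reduced (w : List (Σ i : ℤ, 𝒰 i)) (hw : w ≠ []) :
    (Coalgebra.comul (word 𝒰 w) : GrSym 𝒰 ⊗[k] GrSym 𝒰) - word 𝒰 w ⊗ₜ 1 - 1 ⊗ₜ word 𝒰 w ∈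
      Submodule.span k {t | ∃ l l' : List (Σ i : ℤ, 𝒰 i), l.length < w.length ∧
        l'.length < w.length ∧ word 𝒰 l ⊗ₜ[k] word 𝒰 l' = t} := by
  induction w with
  | nil => exact absurd rfl hw
  | cons x w ih =>
    by_cases hw' : w = []
    · subst hw'
      simp [comul_ι]
    · have h1 := ih hw'
      have hlen : 0 < w.length := List.length_pos_iff.2 hw'
      have h2 : (Coalgebra.comul (word 𝒰 (x :: w)) : GrSym 𝒰 ⊗[k] GrSym 𝒰) =
        comulStep 𝒰 x.1 x.2 (Coalgebra.comul (word 𝒰 w)) := comulLin_ι_mul 𝒰 x.2.2 _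
      have h3 : comulStep 𝒰 x.1 x.2 (Coalgebra.comul (word 𝒰 w)) - word 𝒰 (x :: w) ⊗ₜ 1 -
          1 ⊗ₜ word 𝒰 (x :: w) = comulStep 𝒰 x.1 x.2 (Coalgebra.comul (word 𝒰 w) -
            word 𝒰 w ⊗ₜ 1 - 1 ⊗ₜ word 𝒰 w) + gradeSign (deg 𝒰) x.1 (word 𝒰 w) ⊗ₜ ι 𝒰 x.2 +
            ι 𝒰 x.2 ⊗ₜ word 𝒰 w := by
        simp only [map_sub, comulStep_tmul, gradeSign_one, mul_one, word_cons]
        abel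
      rw [h2, h3]
      refine add_mem (add_mem ?_ ?_) ?_
      · revert h1
        generalize (Coalgebra.comul (word 𝒰 w) : GrSym 𝒰 ⊗[k] GrSym 𝒰) - word 𝒰 w ⊗ₜ 1 -
          1 ⊗ₜ word 𝒰 w = t
        intro h1
        induction h1 using Submodule.span_induction with
        | zero => simp
        | add s t _ _ hs ht => rw [map_add]; exact add_mem hs ht
        | smul r s _ hs => rw [map_smul]; exact Submodule.smul_mem _ _ hs
        | mem t ht =>
          obtain ⟨l, l', e1, e2, rfl⟩ := ht
          rw [comulStep_tmul]
          refine add_mem (Submodule.subset_span ⟨x :: l, l', by simpa using e1,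
            by simp; omega, rfl⟩) ?_
          rw [gradeSign_word, ← TensorProduct.smul_tmul']
          exact Submodule.smul_mem _ _ (Submodule.subset_span
            ⟨l, x :: l', by simp; omega, by simpa using e2, rfl⟩)
      · rw [gradeSign_word, ← TensorProduct.smul_tmul']
        exact Submodule.smul_mem _ _ (Submodule.subset_span
            ⟨w, [x], by simp, by simpa using hlen, by simp⟩)
      · exact Submodule.subset_span ⟨[x], w, by simpa using hlen, by simp, by simp⟩

/-- Two coalgebra morphisms with the same linear component are equal. -/
theorem coalgHom_ext_proj [CharZero k] {F G : GrSym 𝒰 →ₗ[k] GrSym 𝒰'}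
    (hF : ∀ a, Coalgebra.comul (F a) = TensorProduct.map F F (Coalgebra.comul a))
    (hG : ∀ a, Coalgebra.comul (G a) = TensorProduct.map G G (Coalgebra.comul a))
    (hF1 : F 1 = 1) (hG1 : G 1 = 1) (h : ∀ a, proj 𝒰' (F a) = proj 𝒰' (G a)) : F = G := by
  apply ext_word 𝒰
  intro w
  induction hn : w.length using Nat.strong_induction_on generalizing w with
  | _ n ih =>
    by_cases hw : w = []
    · subst hw; rw [word_nil, hF1, hG1]
    subst hn
    rw [← sub_eq_zero]
    -- By induction `F` and `G` agree on shorter words, hence on the reduced comultiplication of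
    -- `w`. So the difference of their values at `w` is primitive and equals its own linear
    -- component, which is zero.
    have hp : F (word 𝒰 w) - G (word 𝒰 w) =
        ι 𝒰' (proj 𝒰' (F (word 𝒰 w) - G (word 𝒰 w))) := by
      apply eq_ι_proj_of_primitive
      have h1 := comul_word_reduced w hw
      have h2 : ∀ t ∈ Submodule.span k {t | ∃ l l' : List (Σ i : ℤ, 𝒰 i), l.length < w.length ∧
          l'.length < w.length ∧ word 𝒰 l ⊗ₜ[k] word 𝒰 l' = t},
          TensorProduct.map F F t = TensorProduct.map G G t := by
        intro t ht
        induction ht using Submodule.span_induction with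
        | zero => simp
        | add s t _ _ hs ht => rw [map_add, map_add, hs, ht]
        | smul r s _ hs => rw [map_smul, map_smul, hs]
        | mem t ht =>
          obtain ⟨l, l', e1, e2, rfl⟩ := ht
          rw [TensorProduct.map_tmul, TensorProduct.map_tmul, ih _ e1 l rfl, ih _ e2 l' rfl]
      have h3 := h2 _ h1
      simp only [map_sub, TensorProduct.map_tmul, hF1, hG1, ← hF, ← hG] at h3
      rw [map_sub, TensorProduct.sub_tmul, TensorProduct.tmul_sub]
      rw [← sub_eq_zero] at h3 ⊢
      rw [← h3]
      abel
    rw [hp, map_sub, h, sub_self, map_zero]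

/-- A coderivation (of even degree) with zero linear component is zero. -/
theorem coder_ext_proj [CharZero k] {E : GrSym 𝒰 →ₗ[k] GrSym 𝒰}
    (hE : ∀ a, Coalgebra.comul (E a) = TensorProduct.map E LinearMap.id (Coalgebra.comul a) +
      TensorProduct.map LinearMap.id E (Coalgebra.comul a))
    (h1 : E 1 = 0) (h : ∀ a, proj 𝒰 (E a) = 0) : E = 0 := by
  apply ext_word 𝒰
  intro w
  induction hn : w.length using Nat.strong_induction_on generalizing w with
  | _ n ih =>
    by_cases hw : w = []
    · subst hw; rw [word_nil, h1]; rfl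
    subst hn
    have hp : E (word 𝒰 w) = ι 𝒰 (proj 𝒰 (E (word 𝒰 w))) := by
      apply eq_ι_proj_of_primitive
      have h1' := comul_word_reduced w hw
      have h2 : ∀ t ∈ Submodule.span k {t | ∃ l l' : List (Σ i : ℤ, 𝒰 i), l.length < w.length ∧
          l'.length < w.length ∧ word 𝒰 l ⊗ₜ[k] word 𝒰 l' = t},
          TensorProduct.map E LinearMap.id t + TensorProduct.map LinearMap.id E t = 0 := by
        intro t ht
        induction ht using Submodule.span_induction with
        | zero => simp
        | add s t _ _ hs ht => rw [map_add, map_add, add_add_add_comm, hs, ht, add_zero]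
        | smul r s _ hs => rw [map_smul, map_smul, ← smul_add, hs, smul_zero]
        | mem t ht =>
          obtain ⟨l, l', e1, e2, rfl⟩ := ht
          rw [TensorProduct.map_tmul, TensorProduct.map_tmul, ih _ e1 l rfl, ih _ e2 l' rfl]
          simp
      have h3 := h2 _ h1'
      simp only [map_sub, TensorProduct.map_tmul, h1, LinearMap.id_apply, TensorProduct.zero_tmul,
        TensorProduct.tmul_zero, sub_zero] at h3
      rw [hE]
      rw [← sub_eq_zero] at h3 ⊢
      rw [← h3]
      abel
    rw [hp, h, map_zero]; rfl

/-- Because the `j`-th convolution power lands in `S^j(U')`, only the term `j = 1` contributes to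
the linear component of the exponential. -/
theorem pow_ι_comp_mem (f : GrSym 𝒰 →ₗ[k] U') (j : ℕ) (a : GrSym 𝒰) :
    (WithConv.toConv (ι 𝒰' ∘ₗ f) ^ j) a ∈ symPow 𝒰' j := by
  induction j generalizing a with
  | zero =>
    rw [pow_zero, LinearMap.convOne_apply, symPow, pow_zero]
    exact Submodule.algebraMap_mem _
  | succ j ih =>
    rw [pow_succ', LinearMap.convMul_apply, add_comm j 1]
    generalize (Coalgebra.comul a : GrSym 𝒰 ⊗[k] GrSym 𝒰) = t
    induction t using TensorProduct.induction_on with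
    | zero => simp
    | add s t hs ht => rw [map_add, map_add]; exact add_mem hs ht
    | tmul b c =>
      rw [TensorProduct.map_tmul, LinearMap.mul'_apply]
      exact SetLike.GradedMul.mul_mem (ι_mem_symPow 𝒰' _) (ih c)

theorem proj_exp (f : GrSym 𝒰 →ₗ[k] U') (hf : f 1 = 0) (a : GrSym 𝒰) :
    proj 𝒰' (exp 𝒰 (ι 𝒰' ∘ₗ f) a) = f a := by
  revert a
  apply LinearMap.congr_fun (f := proj 𝒰' ∘ₗ exp 𝒰 (ι 𝒰' ∘ₗ f))
  apply ext_symPow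
  intro m a ha
  rw [LinearMap.comp_apply, exp_apply _ ha, map_sum]
  rcases m with _ | m
  · rw [symPow_zero_eq 𝒰 ha, Algebra.algebraMap_eq_smul_one, map_smul f, hf, smul_zero]
    simp only [zero_add, Finset.sum_range_one, map_smul]
    rw [proj_of_mem 𝒰' (m := 0) (by simp) (pow_ι_comp_mem f 0 1), smul_zero, smul_zero]
  · rw [Finset.sum_eq_single 1]
    · simp [proj_ι]
    · intro j _ hj
      rw [map_smul, proj_of_mem 𝒰' hj (pow_ι_comp_mem f j a), smul_zero]
    · intro h; simp at h

theorem convMul_par {F G : GrSym 𝒰 →ₗ[k] GrSym 𝒰'}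
    (hF : ∀ a, par 𝒰' (F a) = F (par 𝒰 a)) (hG : ∀ a, par 𝒰' (G a) = G (par 𝒰 a)) (a : GrSym 𝒰) :
    par 𝒰' ((WithConv.toConv F * WithConv.toConv G) a) =
      (WithConv.toConv F * WithConv.toConv G) (par 𝒰 a) := by
  rw [LinearMap.convMul_apply, LinearMap.convMul_apply]
  have h : (Coalgebra.comul (par 𝒰 a) : GrSym 𝒰 ⊗[k] GrSym 𝒰) =
    TensorProduct.map (par 𝒰) (par 𝒰) (Coalgebra.comul a) := comulLin_gradeSign 𝒰 1 a
  rw [h]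
  generalize (Coalgebra.comul a : GrSym 𝒰 ⊗[k] GrSym 𝒰) = t
  induction t using TensorProduct.induction_on with
  | zero => simp
  | add s t hs ht => simp only [map_add] at hs ht ⊢; rw [hs, ht]
  | tmul b c =>
    simp only [TensorProduct.map_tmul, LinearMap.mul'_apply]
    rw [gradeSign_mul, hF, hG]

theorem pow_par {F : GrSym 𝒰 →ₗ[k] GrSym 𝒰'} (hF : ∀ a, par 𝒰' (F a) = F (par 𝒰 a)) (n : ℕ)
    (a : GrSym 𝒰) : par 𝒰' ((WithConv.toConv F ^ n) a) = (WithConv.toConv F ^ n) (par 𝒰 a) := by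
  induction n generalizing a with
  | zero =>
    rw [pow_zero, LinearMap.convOne_apply, LinearMap.convOne_apply, counit_eq, counit_eq,
      counitAlgHom_gradeSign, Algebra.algebraMap_eq_smul_one, map_smul, gradeSign_one]
  | succ n ih =>
    rw [pow_succ]
    exact convMul_par (F := (WithConv.toConv F ^ n).ofConv) ih hF a

theorem exp_par {F : GrSym 𝒰 →ₗ[k] GrSym 𝒰'} (hF : ∀ a, par 𝒰' (F a) = F (par 𝒰 a))
    (a : GrSym 𝒰) : par 𝒰' (exp 𝒰 F a) = exp 𝒰 F (par 𝒰 a) := by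
  revert a
  apply LinearMap.congr_fun (f := par 𝒰' ∘ₗ exp 𝒰 F) (g := exp 𝒰 F ∘ₗ par 𝒰)
  apply ext_symPow
  intro m a ha
  rw [LinearMap.comp_apply, LinearMap.comp_apply, exp_apply _ ha,
    exp_apply _ (gradeSign_mem_symPow 𝒰 1 ha), map_sum]
  refine Finset.sum_congr rfl fun j _ => ?_
  rw [map_smul, pow_par hF]

/-- The exponential of an even map to the cogenerators is a morphism of coalgebras. -/
theorem comul_exp [CharZero k] (f : GrSym 𝒰 →ₗ[k] U') (hf1 : f 1 = 0)
    (hf : ∀ a, gradeSign 𝒰' 1 (f a) = f (par 𝒰 a)) (a : GrSym 𝒰) :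
    Coalgebra.comul (exp 𝒰 (ι 𝒰' ∘ₗ f) a) =
      TensorProduct.map (exp 𝒰 (ι 𝒰' ∘ₗ f)) (exp 𝒰 (ι 𝒰' ∘ₗ f)) (Coalgebra.comul a) := by
  have hev : ∀ a, par 𝒰' ((ι 𝒰' ∘ₗ f) a) = (ι 𝒰' ∘ₗ f) (par 𝒰 a) := by
    intro a
    rw [LinearMap.comp_apply, gradeSign_ι, hf]; rfl
  have h1 := inL_convMul_inR (exp 𝒰 (ι 𝒰' ∘ₗ f)) (exp 𝒰 (ι 𝒰' ∘ₗ f)) a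
  rw [algHom_comp_exp, algHom_comp_exp, ← exp_add (by simp [hf1]) (by simp [hf1])
    (inR_convMul_inL_of_even hev hev).symm] at h1
  -- The values of `f` are primitive, so comultiplying them gives the sum of the two inclusions.
  -- These summands commute in the convolution algebra because `f` is even, and the functional
  -- equation of `exp` splits the exponential of the sum into the tensor product.
  have h2 : (inL 𝒰').toLinearMap ∘ₗ ι 𝒰' ∘ₗ f + (inR 𝒰').toLinearMap ∘ₗ ι 𝒰' ∘ₗ f =
      (comulAlgHom 𝒰').toLinearMap ∘ₗ ι 𝒰' ∘ₗ f := by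
    ext a
    exact (comulAlgHom_ι 𝒰' (f a)).symm
  rw [h2, ← algHom_comp_exp] at h1
  exact h1

/-- The augmentation is an algebra morphism that kills `U'`, so what remains is the exponential of
zero, the unit for convolution. -/
theorem counit_exp (f : GrSym 𝒰 →ₗ[k] U') (a : GrSym 𝒰) :
    counitAlgHom 𝒰' (exp 𝒰 (ι 𝒰' ∘ₗ f) a) = counitAlgHom 𝒰 a := by
  have h := algHom_comp_exp (counitAlgHom 𝒰') (ι 𝒰' ∘ₗ f)
  have h0 : (counitAlgHom 𝒰').toLinearMap ∘ₗ ι 𝒰' ∘ₗ f = 0 := by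
    ext a; simp [counitAlgHom_ι]
  rw [h0, exp_eq_powerSeriesEval (0 : GrSym 𝒰 →ₗ[k] k)] at h
  have h2 : powerSeriesEval (0 : GrSym 𝒰 →ₗ[k] k) (expSeries k) = (counitAlgHom 𝒰).toLinearMap := by
    symm
    apply eq_powerSeriesEval (by simp)
    intro n
    refine ⟨PowerSeries.trunc n (expSeries k), fun i hi => by
      rw [PowerSeries.coeff_trunc, if_pos hi], ?_⟩
    rw [WithConv.toConv_zero]
    rcases n with _ | n
    · exact mem_vanishing_zero _
    · rw [Polynomial.aeval_eq_sum_range' (PowerSeries.natDegree_trunc_lt _ n),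
        Finset.sum_range_succ', Finset.sum_eq_zero (fun i _ => by rw [zero_pow (by simp), smul_zero]),
        PowerSeries.coeff_trunc, if_pos (by simp), expSeries, PowerSeries.coeff_mk]
      simp only [Nat.factorial_zero, Nat.cast_one, inv_one, pow_zero, one_smul, zero_add]
      have h3 : WithConv.toConv (counitAlgHom 𝒰).toLinearMap =
        (1 : WithConv (GrSym 𝒰 →ₗ[k] k)) := rfl
      rw [h3, sub_self]
      exact Submodule.zero_mem _
  rw [h2] at h
  exact LinearMap.congr_fun h a

end Coalgebra
end GrSym

/-! ### Coderivations and their corestrictions. -/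

namespace GrSym

variable {k : Type u} [Field k] {U : Type v} [AddCommGroup U] [Module k U]
variable {𝒰 : ℤ → Submodule k U} [Decomposition 𝒰]

section Coderivation

theorem coder_apply (l : GrSym 𝒰 →ₗ[k] U) (a : GrSym 𝒰) : coder 𝒰 l a =
    LinearMap.mul' k _ (TensorProduct.map (ι 𝒰 ∘ₗ l) LinearMap.id (Coalgebra.comul a)) := rfl

theorem coder_add (l l' : GrSym 𝒰 →ₗ[k] U) : coder 𝒰 (l + l') = coder 𝒰 l + coder 𝒰 l' := by
  ext a
  simp [coder_apply, LinearMap.comp_add, TensorProduct.map_add_left]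

theorem coder_one (l : GrSym 𝒰 →ₗ[k] U) : coder 𝒰 l 1 = ι 𝒰 (l 1) := by
  rw [coder_apply, comul_one]; simp

theorem coder_ι (l : GrSym 𝒰 →ₗ[k] U) (x : U) :
    coder 𝒰 l (ι 𝒰 x) = ι 𝒰 (l (ι 𝒰 x)) + ι 𝒰 (l 1) * ι 𝒰 x := by
  rw [coder_apply, comul_ι]; simp

theorem coder_ι_mul_ι (l : GrSym 𝒰 →ₗ[k] U) {i : ℤ} {x : U} (hx : x ∈ 𝒰 i) (y : U) :
    coder 𝒰 l (ι 𝒰 x * ι 𝒰 y) = ι 𝒰 (l (ι 𝒰 x * ι 𝒰 y)) + ι 𝒰 (l (ι 𝒰 x)) * ι 𝒰 y +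
      ι 𝒰 (l (ι 𝒰 (gradeSign 𝒰 i y))) * ι 𝒰 x + ι 𝒰 (l 1) * (ι 𝒰 x * ι 𝒰 y) := by
  have h : (Coalgebra.comul (ι 𝒰 x * ι 𝒰 y) : GrSym 𝒰 ⊗[k] GrSym 𝒰) =
      comulStep 𝒰 i x (Coalgebra.comul (ι 𝒰 y)) := comulLin_ι_mul 𝒰 hx _
  rw [coder_apply, h, comul_ι, map_add, comulStep_tmul, comulStep_tmul, gradeSign_one, gradeSign_ι]
  simp
  abel

/-- The linear component of the coderivation `coder l` is `l`. -/
theorem proj_coder (l : GrSym 𝒰 →ₗ[k] U) (a : GrSym 𝒰) : proj 𝒰 (coder 𝒰 l a) = l a := by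
  have h : ∀ t : GrSym 𝒰 ⊗[k] GrSym 𝒰, proj 𝒰 (LinearMap.mul' k _
      (TensorProduct.map (ι 𝒰 ∘ₗ l) LinearMap.id t)) =
      TensorProduct.rid k U (TensorProduct.map l LinearMap.id
        (Coalgebra.counit.lTensor (GrSym 𝒰) t)) := by
    intro t
    induction t using TensorProduct.induction_on with
    | zero => simp
    | add s t hs ht => simp only [map_add] at hs ht ⊢; rw [hs, ht]
    | tmul a b => simp [proj_ι_mul, counit_eq]
  rw [coder_apply, h, Coalgebra.lTensor_counit_comul]
  simp

theorem coder_proj_of_odd_par {l : GrSym 𝒰 →ₗ[k] U}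
    (hl : ∀ a, gradeSign 𝒰 1 (l a) = -l (par 𝒰 a)) (a : GrSym 𝒰) :
    par 𝒰 (coder 𝒰 l a) = -coder 𝒰 l (par 𝒰 a) := by
  have h : (Coalgebra.comul (par 𝒰 a) : GrSym 𝒰 ⊗[k] GrSym 𝒰) =
    TensorProduct.map (par 𝒰) (par 𝒰) (Coalgebra.comul a) := comulLin_gradeSign 𝒰 1 a
  rw [coder_apply, coder_apply, h]
  generalize (Coalgebra.comul a : GrSym 𝒰 ⊗[k] GrSym 𝒰) = t
  induction t using TensorProduct.induction_on with
  | zero => simp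
  | add s t hs ht => simp only [map_add, neg_add] at hs ht ⊢; rw [hs, ht]
  | tmul b c =>
    simp only [TensorProduct.map_tmul, LinearMap.mul'_apply, LinearMap.comp_apply,
      LinearMap.id_apply]
    rw [gradeSign_mul, gradeSign_ι, hl, map_neg, neg_mul]

/-- `coder l` is a coderivation, for odd `l`. -/
theorem comul_coder [CharZero k] {l : GrSym 𝒰 →ₗ[k] U}
    (hl : ∀ a, gradeSign 𝒰 1 (l a) = -l (par 𝒰 a)) (a : GrSym 𝒰) :
    Coalgebra.comul (coder 𝒰 l a) =
      TensorProduct.map (coder 𝒰 l) LinearMap.id (Coalgebra.comul a) +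
      TensorProduct.map (par 𝒰) (coder 𝒰 l) (Coalgebra.comul a) := by
  have hev : ∀ a, par 𝒰 ((LinearMap.id : GrSym 𝒰 →ₗ[k] GrSym 𝒰) a) =
    (LinearMap.id : GrSym 𝒰 →ₗ[k] GrSym 𝒰) (par 𝒰 a) := fun a => rfl
  have hodd : ∀ a, par 𝒰 ((ι 𝒰 ∘ₗ l) a) = -(ι 𝒰 ∘ₗ l) (par 𝒰 a) := by
    intro a
    rw [LinearMap.comp_apply, gradeSign_ι, hl, map_neg]; rfl
  have h0 : WithConv.toConv (comulAlgHom 𝒰).toLinearMap =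
      WithConv.toConv ((inL 𝒰).toLinearMap ∘ₗ LinearMap.id) *
        WithConv.toConv ((inR 𝒰).toLinearMap ∘ₗ LinearMap.id) := by
    ext a
    rw [inL_convMul_inR, TensorProduct.map_id]
    rfl
  have h1 : WithConv.toConv ((comulAlgHom 𝒰).toLinearMap ∘ₗ ι 𝒰 ∘ₗ l) =
      WithConv.toConv ((inL 𝒰).toLinearMap ∘ₗ ι 𝒰 ∘ₗ l) +
        WithConv.toConv ((inR 𝒰).toLinearMap ∘ₗ ι 𝒰 ∘ₗ l) := by
    ext a
    exact comulAlgHom_ι 𝒰 (l a)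
  have h2 : WithConv.toConv ((comulAlgHom 𝒰).toLinearMap ∘ₗ coder 𝒰 l) =
      WithConv.toConv ((inL 𝒰).toLinearMap ∘ₗ coder 𝒰 l) *
        WithConv.toConv ((inR 𝒰).toLinearMap ∘ₗ LinearMap.id) +
      WithConv.toConv ((inL 𝒰).toLinearMap ∘ₗ par 𝒰) *
        WithConv.toConv ((inR 𝒰).toLinearMap ∘ₗ coder 𝒰 l) := by
    -- As a convolution product, `coder l` is `(ι ∘ l) * id`. The comultiplication turns it into
    -- `(inL l + inR l) * (inL * inR)`, with the inclusions abbreviated. In the second summand the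
    -- odd factor `inR l` moves past `inL` and leaves `par` behind.
    have e : coder 𝒰 l = (WithConv.toConv (ι 𝒰 ∘ₗ l) * WithConv.toConv LinearMap.id).ofConv := rfl
    rw [e, LinearMap.algHom_comp_convMul_distrib, LinearMap.algHom_comp_convMul_distrib,
      LinearMap.algHom_comp_convMul_distrib]
    simp only [WithConv.toConv_ofConv]
    rw [LinearMap.comp_id, h1, h0, add_mul, ← mul_assoc, ← mul_assoc,
      inR_convMul_inL_of_odd hev hodd, mul_assoc (WithConv.toConv
        ((inL 𝒰).toLinearMap ∘ₗ LinearMap.id ∘ₗ par 𝒰))]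
    rfl
  have h3 := congrArg (fun f => f.ofConv a) h2
  simp only [WithConv.ofConv_add, LinearMap.add_apply] at h3
  rw [inL_convMul_inR, inL_convMul_inR, ← map_add] at h3
  exact h3

/-- In the square of an odd coderivation the two mixed terms cancel by their signs, so the square is
a coderivation without signs and `coder_ext_proj` applies. Its linear component is `l ∘ coder l`. -/
theorem coder_coder_eq_zero [CharZero k] {l : GrSym 𝒰 →ₗ[k] U}
    (hl : ∀ a, gradeSign 𝒰 1 (l a) = -l (par 𝒰 a)) (h1 : l 1 = 0)
    (h : ∀ a, l (coder 𝒰 l a) = 0) (a : GrSym 𝒰) : coder 𝒰 l (coder 𝒰 l a) = 0 := by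
  have key : coder 𝒰 l ∘ₗ coder 𝒰 l = 0 := by
    apply coder_ext_proj
    · intro a
      rw [LinearMap.comp_apply, comul_coder hl, comul_coder hl]
      generalize (Coalgebra.comul a : GrSym 𝒰 ⊗[k] GrSym 𝒰) = t
      induction t using TensorProduct.induction_on with
      | zero => simp
      | add s t hs ht =>
        simp only [map_add] at hs ht ⊢
        rw [add_add_add_comm, add_add_add_comm (TensorProduct.map (coder 𝒰 l ∘ₗ coder 𝒰 l) _ s),
          ← hs, ← ht]
        abel
      | tmul b c =>
        simp only [map_add, TensorProduct.map_tmul, LinearMap.id_apply, LinearMap.comp_apply,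
          coder_proj_of_odd_par hl, gradeSign_self, TensorProduct.neg_tmul]
        abel
    · rw [LinearMap.comp_apply, coder_one, h1, map_zero, map_zero]
    · intro a
      rw [LinearMap.comp_apply, proj_coder, h]
  exact LinearMap.congr_fun key a

theorem gradeSign_of_odd {l : GrSym 𝒰 →ₗ[k] U}
    (hl : ∀ a, gradeSign 𝒰 1 (l a) = -l (par 𝒰 a)) (i : ℤ) (a : GrSym 𝒰) :
    l (gradeSign (deg 𝒰) i a) = ((-1 : k) ^ i) • gradeSign 𝒰 i (l a) := by
  rcases Int.even_or_odd i with hi | hi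
  · rw [gradeSign_congr _ (q := 0) (by simpa using hi), gradeSign_zero,
      gradeSign_congr 𝒰 (q := 0) (by simpa using hi), gradeSign_zero, hi.neg_one_zpow, one_smul]
    rfl
  · have h1 : Even (i - 1) := hi.sub_odd odd_one
    rw [gradeSign_congr _ h1, gradeSign_congr 𝒰 h1, hi.neg_one_zpow, hl]
    simp

theorem ι_gradeSign_mul_ι {i : ℤ} {x : U} (hx : x ∈ 𝒰 i) (y : U) :
    ι 𝒰 (gradeSign 𝒰 i y) * ι 𝒰 x = ι 𝒰 x * ι 𝒰 y := by
  induction y using Decomposition.inductionOn 𝒰 with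
  | zero => simp
  | @homogeneous j y =>
    rw [gradeSign_of_mem 𝒰 i y.2, map_smul, smul_mul_assoc, ι_mul_ι 𝒰 hx y.2]
  | add y z hy hz => rw [map_add, map_add, add_mul, hy, hz, map_add, mul_add]

/-- The commutator of a coderivation with the multiplication by an element of `U`. -/
theorem coder_ι_mul_of_sign {l : GrSym 𝒰 →ₗ[k] U} {i : ℤ} {c : k}
    (hl : ∀ a, l (gradeSign (deg 𝒰) i a) = c • gradeSign 𝒰 i (l a)) {x : U} (hx : x ∈ 𝒰 i)
    (a : GrSym 𝒰) : coder 𝒰 l (ι 𝒰 x * a) = coder 𝒰 (l ∘ₗ LinearMap.mulLeft k (ι 𝒰 x)) a +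
      c • (ι 𝒰 x * coder 𝒰 l a) := by
  have h : (Coalgebra.comul (ι 𝒰 x * a) : GrSym 𝒰 ⊗[k] GrSym 𝒰) =
      comulStep 𝒰 i x (Coalgebra.comul a) := comulLin_ι_mul 𝒰 hx _
  rw [coder_apply, coder_apply, coder_apply, h]
  generalize (Coalgebra.comul a : GrSym 𝒰 ⊗[k] GrSym 𝒰) = t
  induction t using TensorProduct.induction_on with
  | zero => simp
  | add s t hs ht =>
    simp only [map_add, mul_add, smul_add] at hs ht ⊢
    rw [hs, ht]
    abel
  | tmul b c =>
    simp only [comulStep_tmul, map_add, TensorProduct.map_tmul, LinearMap.mul'_apply,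
      LinearMap.comp_apply, LinearMap.id_apply, LinearMap.mulLeft_apply]
    congr 1
    rw [hl, map_smul, smul_mul_assoc, ← mul_assoc, ι_gradeSign_mul_ι hx, mul_assoc]

theorem coder_ι_mul {l : GrSym 𝒰 →ₗ[k] U}
    (hl : ∀ a, gradeSign 𝒰 1 (l a) = -l (par 𝒰 a)) {i : ℤ} {x : U} (hx : x ∈ 𝒰 i) (a : GrSym 𝒰) :
    coder 𝒰 l (ι 𝒰 x * a) = coder 𝒰 (l ∘ₗ LinearMap.mulLeft k (ι 𝒰 x)) a +
      ((-1 : k) ^ i) • (ι 𝒰 x * coder 𝒰 l a) :=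
  coder_ι_mul_of_sign (gradeSign_of_odd hl i) hx a

/-- Each term of the shuffle sum replaces `n` letters by a single one. -/
theorem coder_mem_symPow {l : GrSym 𝒰 →ₗ[k] U} {n : ℕ}
    (hl : ∀ m ≠ n, ∀ a ∈ symPow 𝒰 m, l a = 0) {m : ℕ} {a : GrSym 𝒰} (ha : a ∈ symPow 𝒰 (m + n)) :
    coder 𝒰 l a ∈ symPow 𝒰 (m + 1) := by
  refine symPow_le 𝒰 (N := (symPow 𝒰 (m + 1)).comap (coder 𝒰 l)) ?_ ha
  intro w hw
  rw [Submodule.mem_comap, coder_apply]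
  have h := comul_word 𝒰 w
  revert h
  generalize (Coalgebra.comul (word 𝒰 w) : GrSym 𝒰 ⊗[k] GrSym 𝒰) = t
  intro h
  induction h using Submodule.span_induction with
  | zero => simp
  | add s t _ _ hs ht => rw [map_add, map_add]; exact add_mem hs ht
  | smul r s _ hs => rw [map_smul, map_smul]; exact Submodule.smul_mem _ _ hs
  | mem t ht =>
    obtain ⟨v, v', h1, _, rfl⟩ := ht
    rw [TensorProduct.map_tmul, LinearMap.mul'_apply, LinearMap.comp_apply, LinearMap.id_apply]
    by_cases hv : v.length = n
    · obtain rfl : v'.length = m := by omega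
      rw [add_comm]
      exact SetLike.GradedMul.mul_mem (ι_mem_symPow 𝒰 _) (word_mem_symPow 𝒰 v')
    · rw [hl _ hv _ (word_mem_symPow 𝒰 v)]; simp

theorem coder_eq_zero_of_lt {l : GrSym 𝒰 →ₗ[k] U} {n : ℕ}
    (hl : ∀ m ≠ n, ∀ a ∈ symPow 𝒰 m, l a = 0) {m : ℕ} (hm : m < n) {a : GrSym 𝒰}
    (ha : a ∈ symPow 𝒰 m) : coder 𝒰 l a = 0 := by
  have h1 : WithConv.toConv (ι 𝒰 ∘ₗ l) ∈ vanishing 𝒰 (GrSym 𝒰) n := by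
    intro m hm a ha
    change ι 𝒰 (l a) = 0
    rw [hl m hm.ne a ha, map_zero]
  exact mul_mem_vanishing h1 (mem_vanishing_zero (WithConv.toConv LinearMap.id)) m (by omega) a ha

theorem coder_mem_deg {l : GrSym 𝒰 →ₗ[k] U} {p : ℤ}
    (hl : ∀ i, ∀ a ∈ deg 𝒰 i, l a ∈ 𝒰 (i + p)) {i : ℤ} {a : GrSym 𝒰} (ha : a ∈ deg 𝒰 i) :
    coder 𝒰 l a ∈ deg 𝒰 (i + p) := by
  refine deg_le 𝒰 (N := (deg 𝒰 (i + p)).comap (coder 𝒰 l)) ?_ ha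
  intro w hw
  rw [Submodule.mem_comap, coder_apply]
  have h := comul_word 𝒰 w
  revert h
  generalize (Coalgebra.comul (word 𝒰 w) : GrSym 𝒰 ⊗[k] GrSym 𝒰) = t
  intro h
  induction h using Submodule.span_induction with
  | zero => simp
  | add s t _ _ hs ht => rw [map_add, map_add]; exact add_mem hs ht
  | smul r s _ hs => rw [map_smul, map_smul]; exact Submodule.smul_mem _ _ hs
  | mem t ht =>
    obtain ⟨v, v', _, h1, rfl⟩ := ht
    rw [TensorProduct.map_tmul, LinearMap.mul'_apply, LinearMap.comp_apply, LinearMap.id_apply,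
      show i + p = (wdeg v + p) + wdeg v' by rw [← hw, ← h1]; ring]
    exact SetLike.GradedMul.mul_mem (ι_mem_deg 𝒰 (hl _ _ (word_mem_deg 𝒰 v))) (word_mem_deg 𝒰 v')

theorem proj_mem_of_mem_deg {i : ℤ} {a : GrSym 𝒰} (ha : a ∈ deg 𝒰 i) : proj 𝒰 a ∈ 𝒰 i := by
  refine deg_le 𝒰 (N := (𝒰 i).comap (proj 𝒰)) ?_ ha
  rintro w rfl
  rw [Submodule.mem_comap]
  by_cases hw : w.length = 1
  · obtain ⟨x, rfl⟩ := List.length_eq_one_iff.1 hw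
    simp [proj_ι]
  · rw [proj_word 𝒰 w hw]; exact zero_mem _

theorem extendTwo_mem_of_mem_deg {l : U →ₗ[k] U →ₗ[k] U} (hl : GradedSymm 𝒰 l) {p : ℤ}
    (hp : ∀ i j : ℤ, ∀ x ∈ 𝒰 i, ∀ y ∈ 𝒰 j, l x y ∈ 𝒰 (i + j + p)) {i : ℤ} {a : GrSym 𝒰}
    (ha : a ∈ deg 𝒰 i) : extendTwo 𝒰 l hl a ∈ 𝒰 (i + p) := by
  refine deg_le 𝒰 (N := (𝒰 (i + p)).comap (extendTwo 𝒰 l hl)) ?_ ha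
  rintro w rfl
  rw [Submodule.mem_comap]
  rcases w with _ | ⟨x, w⟩
  · rw [word_nil, extendTwo_one]; exact zero_mem _
  · rw [word_cons, extendTwo_ι_mul, wdeg_cons]
    exact hp _ _ _ x.2.2 _ (proj_mem_of_mem_deg (word_mem_deg 𝒰 w))

end Coderivation

/-! ### Square-zero coderivations and the axioms of a dg Lie algebra. -/

section LieCoder

/-- The corestriction `d + λ : S(U) → U` given by a linear and a graded symmetric bilinear
operation. -/
def lieCorestr (d : U →ₗ[k] U) (l : U →ₗ[k] U →ₗ[k] U) (hl : GradedSymm 𝒰 l) : GrSym 𝒰 →ₗ[k] U :=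
  d ∘ₗ proj 𝒰 + extendTwo 𝒰 l hl

variable {d : U →ₗ[k] U} {l : U →ₗ[k] U →ₗ[k] U} (hl : GradedSymm 𝒰 l)

theorem lieCorestr_apply (a : GrSym 𝒰) :
    lieCorestr d l hl a = d (proj 𝒰 a) + extendTwo 𝒰 l hl a := rfl

theorem lieCorestr_one : lieCorestr d l hl 1 = 0 := by
  rw [lieCorestr_apply, proj_one, map_zero, extendTwo_one, add_zero]

theorem lieCorestr_ι (x : U) : lieCorestr d l hl (ι 𝒰 x) = d x := by
  rw [lieCorestr_apply, proj_ι, extendTwo_of_mem 𝒰 l hl (by simp) (ι_mem_symPow 𝒰 x), add_zero]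

theorem lieCorestr_ι_mul_ι (x y : U) : lieCorestr d l hl (ι 𝒰 x * ι 𝒰 y) = l x y := by
  rw [lieCorestr_apply, proj_ι_mul, counitAlgHom_ι, extendTwo_ι_mul_ι, zero_smul, map_zero,
    zero_add]

theorem lieCorestr_of_mem {m : ℕ} (hm : 3 ≤ m) {a : GrSym 𝒰} (ha : a ∈ symPow 𝒰 m) :
    lieCorestr d l hl a = 0 := by
  rw [lieCorestr_apply, proj_of_mem 𝒰 (by omega) ha, extendTwo_of_mem 𝒰 l hl (by omega) ha,
    map_zero, add_zero]

theorem d_proj_odd (hd1 : ∀ x, gradeSign 𝒰 1 (d x) = -d (gradeSign 𝒰 1 x)) (a : GrSym 𝒰) :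
    gradeSign 𝒰 1 ((d ∘ₗ proj 𝒰) a) = -(d ∘ₗ proj 𝒰) (par 𝒰 a) := by
  rw [LinearMap.comp_apply, LinearMap.comp_apply, hd1, proj_gradeSign]

theorem extendTwo_odd
    (hl1 : ∀ x y, gradeSign 𝒰 1 (l x y) = -l (gradeSign 𝒰 1 x) (gradeSign 𝒰 1 y)) (a : GrSym 𝒰) :
    gradeSign 𝒰 1 (extendTwo 𝒰 l hl a) = -extendTwo 𝒰 l hl (par 𝒰 a) := by
  revert a
  apply LinearMap.congr_fun (f := gradeSign 𝒰 1 ∘ₗ extendTwo 𝒰 l hl)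
    (g := -(extendTwo 𝒰 l hl ∘ₗ par 𝒰))
  apply linearMap_ext 𝒰
  · simp [extendTwo_one, gradeSign_one]
  · intro i x hx a _
    simp only [LinearMap.comp_apply, LinearMap.neg_apply]
    rw [extendTwo_ι_mul, gradeSign_mul, gradeSign_ι, extendTwo_ι_mul, hl1, proj_gradeSign]

theorem lieCorestr_odd (hd1 : ∀ x, gradeSign 𝒰 1 (d x) = -d (gradeSign 𝒰 1 x))
    (hl1 : ∀ x y, gradeSign 𝒰 1 (l x y) = -l (gradeSign 𝒰 1 x) (gradeSign 𝒰 1 y)) (a : GrSym 𝒰) :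
    gradeSign 𝒰 1 (lieCorestr d l hl a) = -lieCorestr d l hl (par 𝒰 a) := by
  have h1 := d_proj_odd hd1 a
  rw [LinearMap.comp_apply, LinearMap.comp_apply] at h1
  rw [lieCorestr_apply, map_add, h1, extendTwo_odd hl hl1, lieCorestr_apply, neg_add]

theorem coder_lieCorestr : coder 𝒰 (lieCorestr d l hl) =
    coder 𝒰 (d ∘ₗ proj 𝒰) + coder 𝒰 (extendTwo 𝒰 l hl) := coder_add _ _

variable (hd1 : ∀ x, gradeSign 𝒰 1 (d x) = -d (gradeSign 𝒰 1 x))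
  (hl1 : ∀ x y, gradeSign 𝒰 1 (l x y) = -l (gradeSign 𝒰 1 x) (gradeSign 𝒰 1 y))

theorem lieCoder_ι (x : U) : coder 𝒰 (lieCorestr d l hl) (ι 𝒰 x) = ι 𝒰 (d x) := by
  rw [coder_ι, lieCorestr_ι, lieCorestr_one, map_zero, zero_mul, add_zero]

include hd1 hl1

theorem lieCoder_ι_mul_ι {i : ℤ} {x : U} (hx : x ∈ 𝒰 i) (y : U) :
    coder 𝒰 (lieCorestr d l hl) (ι 𝒰 x * ι 𝒰 y) = ι 𝒰 (l x y) + ι 𝒰 (d x) * ι 𝒰 y +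
      ((-1 : k) ^ i) • (ι 𝒰 x * ι 𝒰 (d y)) := by
  rw [coder_ι_mul (lieCorestr_odd hl hd1 hl1) hx, lieCoder_ι, coder_ι]
  simp only [LinearMap.comp_apply, LinearMap.mulLeft_apply, mul_one]
  rw [lieCorestr_ι_mul_ι, lieCorestr_ι]

theorem lieCorestr_lieCoder_two {i : ℤ} {x : U} (hx : x ∈ 𝒰 i) (y : U) :
    lieCorestr d l hl (coder 𝒰 (lieCorestr d l hl) (ι 𝒰 x * ι 𝒰 y)) =
      d (l x y) + l (d x) y + ((-1 : k) ^ i) • l x (d y) := by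
  rw [lieCoder_ι_mul_ι hl hd1 hl1 hx, map_add, map_add, map_smul, lieCorestr_ι,
    lieCorestr_ι_mul_ι, lieCorestr_ι_mul_ι]

theorem lieCorestr_lieCoder_three {i j : ℤ} {x y : U} (hx : x ∈ 𝒰 i) (hy : y ∈ 𝒰 j) (z : U) :
    lieCorestr d l hl (coder 𝒰 (lieCorestr d l hl) (ι 𝒰 x * (ι 𝒰 y * ι 𝒰 z))) =
      l (l x y) z + l (l x (gradeSign 𝒰 j z)) y + ((-1 : k) ^ i) • l x (l y z) := by
  have h3 : ∀ x y z : U, lieCorestr d l hl (ι 𝒰 x * (ι 𝒰 y * ι 𝒰 z)) = 0 := fun x y z =>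
    lieCorestr_of_mem hl (m := 1 + (1 + 1)) le_rfl
      (SetLike.GradedMul.mul_mem (ι_mem_symPow 𝒰 x)
        (SetLike.GradedMul.mul_mem (ι_mem_symPow 𝒰 y) (ι_mem_symPow 𝒰 z)))
  rw [coder_ι_mul (lieCorestr_odd hl hd1 hl1) hx, coder_ι_mul_ι _ hy,
    lieCoder_ι_mul_ι hl hd1 hl1 hy]
  simp only [LinearMap.comp_apply, LinearMap.mulLeft_apply, mul_one, mul_add, mul_smul_comm,
    map_add, map_smul, h3, lieCorestr_ι_mul_ι, lieCorestr_ι, smul_zero, add_zero, map_zero,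
    zero_add]

/-- The coderivation given by `d` and `λ` squares to zero if and only if the axioms of a dg Lie
algebra hold (up to a shift). -/
theorem lieCoder_sq_zero_iff [CharZero k] :
    (∀ a, coder 𝒰 (lieCorestr d l hl) (coder 𝒰 (lieCorestr d l hl) a) = 0) ↔
      (∀ x, d (d x) = 0) ∧
      (∀ i, ∀ x ∈ 𝒰 i, ∀ y, d (l x y) + l (d x) y + ((-1 : k) ^ i) • l x (d y) = 0) ∧
      (∀ i j, ∀ x ∈ 𝒰 i, ∀ y ∈ 𝒰 j, ∀ z,
        l (l x y) z + l (l x (gradeSign 𝒰 j z)) y + ((-1 : k) ^ i) • l x (l y z) = 0) := by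
  constructor
  · intro h
    have h' : ∀ a, lieCorestr d l hl (coder 𝒰 (lieCorestr d l hl) a) = 0 := by
      intro a
      rw [← proj_coder, h, map_zero]
    refine ⟨fun x => ?_, fun i x hx y => ?_, fun i j x hx y hy z => ?_⟩
    · rw [← h' (ι 𝒰 x), lieCoder_ι, lieCorestr_ι]
    · rw [← lieCorestr_lieCoder_two hl hd1 hl1 hx, h']
    · rw [← lieCorestr_lieCoder_three hl hd1 hl1 hx hy, h']
  · rintro ⟨h1, h2, h3⟩
    apply coder_coder_eq_zero (lieCorestr_odd hl hd1 hl1) (lieCorestr_one hl)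
    -- Only the linear component of the square is left to check. On words of length one, two and
    -- three it is given by the three axioms. From length four on, the coderivation yields elements
    -- of symmetric powers at least three, where the corestriction vanishes.
    apply LinearMap.congr_fun (f := lieCorestr d l hl ∘ₗ coder 𝒰 (lieCorestr d l hl)) (g := 0)
    apply ext_word
    intro w
    rw [LinearMap.comp_apply, LinearMap.zero_apply]
    rcases w with _ | ⟨x, _ | ⟨y, _ | ⟨z, w⟩⟩⟩
    · rw [word_nil, coder_one, lieCorestr_one, map_zero, map_zero]
    · rw [word_cons, word_nil, mul_one, lieCoder_ι, lieCorestr_ι, h1]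
    · rw [word_cons, word_cons, word_nil, mul_one, lieCorestr_lieCoder_two hl hd1 hl1 x.2.2,
        h2 _ _ x.2.2]
    · rcases w with _ | ⟨t, w⟩
      · rw [word_cons, word_cons, word_cons, word_nil, mul_one,
          lieCorestr_lieCoder_three hl hd1 hl1 x.2.2 y.2.2, h3 _ _ _ x.2.2 _ y.2.2]
      · have hm := word_mem_symPow 𝒰 (x :: y :: z :: t :: w)
        rw [coder_lieCorestr, LinearMap.add_apply, map_add,
          lieCorestr_of_mem hl (m := w.length + 3 + 1) (by omega)
            (coder_mem_symPow (n := 1) (m := w.length + 3) (fun m hm a ha => by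
              rw [LinearMap.comp_apply, proj_of_mem 𝒰 hm ha, map_zero]) (by simpa using hm)),
          lieCorestr_of_mem hl (m := w.length + 2 + 1) (by omega)
            (coder_mem_symPow (n := 2) (m := w.length + 2) (fun m hm a ha =>
              extendTwo_of_mem 𝒰 l hl hm ha) (by simpa using hm)), add_zero]

end LieCoder
end GrSym

/-! ### Differential operators on graded commutative algebras, and on `S(U)`. -/

section DiffOp
variable {k : Type u} [Field k] {V : Type*} [Ring V] [Algebra k V] {𝒱 : ℤ → Submodule k V}

theorem gradedCommLeft_apply (p : ℤ) (D : V →ₗ[k] V) (i : ℤ) (a b : V) :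
    gradedCommLeft p D i a b = D (a * b) - ((-1 : k) ^ (p * i)) • (a * D b) := rfl

theorem gradedCommLeft_zero (p i : ℤ) (a : V) : gradedCommLeft (k := k) p 0 i a = 0 := by
  ext b; simp [gradedCommLeft_apply]

theorem gradedCommLeft_add (p : ℤ) (D E : V →ₗ[k] V) (i : ℤ) (a : V) :
    gradedCommLeft p (D + E) i a = gradedCommLeft p D i a + gradedCommLeft p E i a := by
  ext b
  simp only [gradedCommLeft_apply, LinearMap.add_apply, mul_add, smul_add]
  abel

theorem gradedCommLeft_smul (p : ℤ) (r : k) (D : V →ₗ[k] V) (i : ℤ) (a : V) :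
    gradedCommLeft p (r • D) i a = r • gradedCommLeft p D i a := by
  ext b
  simp only [gradedCommLeft_apply, LinearMap.smul_apply, mul_smul_comm, smul_sub]
  rw [smul_comm]

theorem IsDiffOp.zero (n : ℕ) (p : ℤ) : IsDiffOp 𝒱 n p 0 := by
  induction n generalizing p with
  | zero => intro i a _; exact gradedCommLeft_zero p i a
  | succ n ih => intro i a _; rw [gradedCommLeft_zero]; exact ih _

theorem IsDiffOp.add {n : ℕ} {p : ℤ} {D E : V →ₗ[k] V} (hD : IsDiffOp 𝒱 n p D)
    (hE : IsDiffOp 𝒱 n p E) : IsDiffOp 𝒱 n p (D + E) := by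
  induction n generalizing p D E with
  | zero =>
    intro i a ha
    rw [gradedCommLeft_add, hD i a ha, hE i a ha, add_zero]
  | succ n ih =>
    intro i a ha
    rw [gradedCommLeft_add]
    exact ih (hD i a ha) (hE i a ha)

theorem IsDiffOp.smul {n : ℕ} {p : ℤ} {D : V →ₗ[k] V} (r : k) (hD : IsDiffOp 𝒱 n p D) :
    IsDiffOp 𝒱 n p (r • D) := by
  induction n generalizing p D with
  | zero =>
    intro i a ha
    rw [gradedCommLeft_smul, hD i a ha, smul_zero]
  | succ n ih =>
    intro i a ha
    rw [gradedCommLeft_smul]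
    exact ih (hD i a ha)

variable (hcomm : ∀ i j : ℤ, ∀ a ∈ 𝒱 i, ∀ b ∈ 𝒱 j, a * b = ((-1 : k) ^ (i * j)) • (b * a))
include hcomm

/-- Multiplication operators commute with each other up to sign, so the iterated commutators of the
composite are, up to sign, those of `D` composed with the same multiplication. This and
`IsDiffOp.mulLeft_comp` control the two terms of a commutator with a product. -/
theorem IsDiffOp.comp_mulLeft {n : ℕ} {p : ℤ} {D : V →ₗ[k] V} (hD : IsDiffOp 𝒱 n p D) {j : ℤ}
    {b : V} (hb : b ∈ 𝒱 j) : IsDiffOp 𝒱 n (p + j) (D ∘ₗ LinearMap.mulLeft k b) := by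
  have key : ∀ (p : ℤ) (D : V →ₗ[k] V) (i : ℤ), ∀ a ∈ 𝒱 i,
      gradedCommLeft (p + j) (D ∘ₗ LinearMap.mulLeft k b) i a =
        ((-1 : k) ^ (j * i)) • (gradedCommLeft p D i a ∘ₗ LinearMap.mulLeft k b) := by
    intro p D i a ha
    ext c
    simp only [gradedCommLeft_apply, LinearMap.comp_apply, LinearMap.mulLeft_apply,
      LinearMap.smul_apply]
    rw [← mul_assoc, hcomm _ _ b hb a ha, smul_mul_assoc, map_smul, smul_sub, mul_assoc, smul_smul,
      ← zpow_add₀ (by simp)]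
    ring_nf
  induction n generalizing p D with
  | zero =>
    intro i a ha
    rw [key p D i a ha, hD i a ha]
    simp
  | succ n ih =>
    intro i a ha
    rw [key p D i a ha, show p + j + i = p + i + j by ring]
    exact (ih (hD i a ha)).smul _

theorem IsDiffOp.mulLeft_comp {n : ℕ} {p : ℤ} {D : V →ₗ[k] V} (hD : IsDiffOp 𝒱 n p D) {j : ℤ}
    {b : V} (hb : b ∈ 𝒱 j) : IsDiffOp 𝒱 n (p + j) (LinearMap.mulLeft k b ∘ₗ D) := by
  have key : ∀ (p : ℤ) (D : V →ₗ[k] V) (i : ℤ), ∀ a ∈ 𝒱 i,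
      gradedCommLeft (p + j) (LinearMap.mulLeft k b ∘ₗ D) i a =
        LinearMap.mulLeft k b ∘ₗ gradedCommLeft p D i a := by
    intro p D i a ha
    ext c
    simp only [gradedCommLeft_apply, LinearMap.comp_apply, LinearMap.mulLeft_apply]
    rw [← mul_assoc a b, hcomm _ _ a ha b hb, smul_mul_assoc, mul_sub, mul_smul_comm, smul_smul,
      ← zpow_add₀ (by simp), mul_assoc]
    rw [neg_one_zpow_congr (n := p * i)]
    rw [show (p + j) * i + i * j - p * i = i * j + i * j by ring]
    exact ⟨_, rfl⟩
  induction n generalizing p D with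
  | zero =>
    intro i a ha
    rw [key p D i a ha, hD i a ha]
    simp
  | succ n ih =>
    intro i a ha
    rw [key p D i a ha, show p + j + i = p + i + j by ring]
    exact ih (hD i a ha)

theorem isDiffOp_mulLeft {p : ℤ} {c : V} (hc : c ∈ 𝒱 p) :
    IsDiffOp 𝒱 0 p (LinearMap.mulLeft k c) := by
  intro i a ha
  ext b
  simp only [gradedCommLeft_apply, LinearMap.mulLeft_apply, LinearMap.zero_apply]
  rw [← mul_assoc, hcomm _ _ c hc a ha, smul_mul_assoc, mul_assoc, sub_self]

end DiffOp

namespace GrSym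

variable {k : Type u} [Field k] {U : Type v} [AddCommGroup U] [Module k U]
variable {𝒰 : ℤ → Submodule k U} [Decomposition 𝒰]

/-- The commutator with a product is `[D, L_x L_w] = [D, L_x] L_w ± L_x [D, L_w]`. Induction on
words therefore permits testing the outermost commutator on `U` only. -/
theorem isDiffOp_of_generators {n : ℕ} {p : ℤ} {D : GrSym 𝒰 →ₗ[k] GrSym 𝒰}
    (h : ∀ i, ∀ x ∈ 𝒰 i, IsDiffOp (deg 𝒰) n (p + i) (gradedCommLeft p D i (ι 𝒰 x))) :
    IsDiffOp (deg 𝒰) (n + 1) p D := by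
  intro i a ha
  let N : Submodule k (GrSym 𝒰) :=
    { carrier := {a | IsDiffOp (deg 𝒰) n (p + i) (gradedCommLeft p D i a)}
      zero_mem' := by
        have : gradedCommLeft p D i 0 = 0 := by ext b; simp [gradedCommLeft_apply]
        rw [Set.mem_ofPred_eq, this]; exact IsDiffOp.zero _ _
      add_mem' := fun {a b} ha hb => by
        have : gradedCommLeft p D i (a + b) = gradedCommLeft p D i a + gradedCommLeft p D i b := by
          ext c
          simp only [gradedCommLeft_apply, LinearMap.add_apply, add_mul, map_add, smul_add]
          abel
        rw [Set.mem_ofPred_eq, this]; exact IsDiffOp.add ha hb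
      smul_mem' := fun r a ha => by
        have : gradedCommLeft p D i (r • a) = r • gradedCommLeft p D i a := by
          ext c
          simp only [gradedCommLeft_apply, LinearMap.smul_apply, smul_mul_assoc, map_smul, smul_sub]
          rw [smul_comm r]
        rw [Set.mem_ofPred_eq, this]; exact IsDiffOp.smul r ha }
  refine deg_le 𝒰 (N := N) ?_ ha
  rintro w rfl
  change IsDiffOp (deg 𝒰) n (p + wdeg w) (gradedCommLeft p D (wdeg w) (word 𝒰 w))
  clear ha N
  induction w with
  | nil =>
    have : gradedCommLeft p D 0 (1 : GrSym 𝒰) = 0 := by ext b; simp [gradedCommLeft_apply]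
    rw [wdeg_nil, word_nil, this]; exact IsDiffOp.zero _ _
  | cons x w ih =>
    have key : gradedCommLeft p D (wdeg (x :: w)) (word 𝒰 (x :: w)) =
        gradedCommLeft p D x.1 (ι 𝒰 x.2) ∘ₗ LinearMap.mulLeft k (word 𝒰 w) +
        ((-1 : k) ^ (p * x.1)) • (LinearMap.mulLeft k (ι 𝒰 x.2) ∘ₗ
          gradedCommLeft p D (wdeg w) (word 𝒰 w)) := by
      ext b
      simp only [gradedCommLeft_apply, LinearMap.comp_apply, LinearMap.mulLeft_apply,
        LinearMap.add_apply, LinearMap.smul_apply, word_cons, wdeg_cons, mul_add]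
      rw [zpow_add₀ (by simp), mul_sub, smul_sub, mul_smul_comm, smul_smul, mul_assoc, mul_assoc]
      abel
    have hc : ∀ i j : ℤ, ∀ a ∈ deg 𝒰 i, ∀ b ∈ deg 𝒰 j, a * b = ((-1 : k) ^ (i * j)) • (b * a) :=
      fun i j a ha b hb => mul_comm_of_mem 𝒰 ha hb
    rw [key]
    refine IsDiffOp.add ?_ (IsDiffOp.smul _ ?_)
    · rw [wdeg_cons, ← add_assoc]
      exact IsDiffOp.comp_mulLeft hc (h _ _ x.2.2) (word_mem_deg 𝒰 w)
    · rw [wdeg_cons, add_comm x.1, ← add_assoc]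
      exact IsDiffOp.mulLeft_comp hc ih (ι_mem_deg 𝒰 x.2.2)

theorem gradeSign_of_degree {l : GrSym 𝒰 →ₗ[k] U} {p : ℤ}
    (hl : ∀ i, ∀ a ∈ deg 𝒰 i, l a ∈ 𝒰 (i + p)) (i : ℤ) (a : GrSym 𝒰) :
    l (gradeSign (deg 𝒰) i a) = ((-1 : k) ^ (p * i)) • gradeSign 𝒰 i (l a) := by
  induction a using Decomposition.inductionOn (deg 𝒰) with
  | zero => simp
  | add a b ha hb => simp only [map_add, ha, hb, smul_add]
  | @homogeneous j a =>
    rw [gradeSign_of_mem _ _ a.2, map_smul, gradeSign_of_mem _ _ (hl j a a.2), smul_smul,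
      ← zpow_add₀ (by simp), neg_one_zpow_congr]
    rw [show i * j - (p * i + i * (j + p)) = -(p * i + p * i) by ring]
    exact Even.neg ⟨_, rfl⟩

/-- A coderivation with corestriction supported on `S^n(U)` is a differential operator of order
`≤ n`. -/
theorem isDiffOp_coder {n : ℕ} {p : ℤ} {l : GrSym 𝒰 →ₗ[k] U}
    (hdeg : ∀ i, ∀ a ∈ deg 𝒰 i, l a ∈ 𝒰 (i + p))
    (hl : ∀ m ≠ n, ∀ a ∈ symPow 𝒰 m, l a = 0) : IsDiffOp (deg 𝒰) n p (coder 𝒰 l) := by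
  induction n generalizing p l with
  | zero =>
    -- A corestriction supported on `S⁰(U)` is the counit times the vector `l 1`, and its
    -- coderivation is multiplication by that vector: an operator of order zero.
    have h1 : coder 𝒰 l = LinearMap.mulLeft k (ι 𝒰 (l 1)) := by
      have h2 : l = (LinearMap.toSpanSingleton k U (l 1)) ∘ₗ Coalgebra.counit := by
        apply ext_symPow
        intro m a ha
        rw [LinearMap.comp_apply, counit_eq]
        by_cases hm : m = 0
        · subst hm
          conv_lhs => rw [symPow_zero_eq 𝒰 ha, Algebra.algebraMap_eq_smul_one, map_smul]
          rfl
        · rw [hl m hm a ha, counit_of_mem 𝒰 hm ha, map_zero]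
      ext a
      have h : ∀ t : GrSym 𝒰 ⊗[k] GrSym 𝒰, LinearMap.mul' k _
          (TensorProduct.map (ι 𝒰 ∘ₗ l) LinearMap.id t) =
          ι 𝒰 (l 1) * TensorProduct.lid k _ (Coalgebra.counit.rTensor (GrSym 𝒰) t) := by
        intro t
        induction t using TensorProduct.induction_on with
        | zero => simp
        | add s t hs ht => simp only [map_add, mul_add] at hs ht ⊢; rw [hs, ht]
        | tmul a b =>
          have := LinearMap.congr_fun h2 a
          simp only [TensorProduct.map_tmul, LinearMap.comp_apply, this]
          simp
      rw [coder_apply, h, Coalgebra.rTensor_counit_comul]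
      simp
    rw [h1]
    refine isDiffOp_mulLeft (fun i j a ha b hb => mul_comm_of_mem 𝒰 ha hb) (ι_mem_deg 𝒰 ?_)
    have := hdeg 0 1 SetLike.GradedOne.one_mem
    rwa [zero_add] at this
  | succ n ih =>
    apply isDiffOp_of_generators
    intro i x hx
    -- Taking the commutator with `x` feeds `x` into the corestriction, which is then supported one
    -- symmetric power lower. This drives the induction.
    have h1 : gradedCommLeft p (coder 𝒰 l) i (ι 𝒰 x) =
        coder 𝒰 (l ∘ₗ LinearMap.mulLeft k (ι 𝒰 x)) := by
      ext a
      rw [gradedCommLeft_apply, coder_ι_mul_of_sign (gradeSign_of_degree hdeg i) hx]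
      abel
    rw [h1]
    apply ih
    · intro j a ha
      have := hdeg _ _ (SetLike.GradedMul.mul_mem (ι_mem_deg 𝒰 hx) ha)
      rwa [show j + (p + i) = i + j + p by ring]
    · intro m hm a ha
      exact hl (1 + m) (by omega) _ (SetLike.GradedMul.mul_mem (ι_mem_symPow 𝒰 x) ha)

/-- A differential operator of order `≤ n` on `S(U)` is determined by its values on `S^m(U)` for
`m ≤ n`. -/
theorem IsDiffOp.eq_zero {n : ℕ} {p : ℤ} {E : GrSym 𝒰 →ₗ[k] GrSym 𝒰}
    (hE : IsDiffOp (deg 𝒰) n p E) (h : ∀ m ≤ n, ∀ a ∈ symPow 𝒰 m, E a = 0) : E = 0 := by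
  -- An operator that commutes up to sign with multiplication by `U` is determined by its value at
  -- `1`. The induction on the order shows that the commutators with elements of `U` vanish.
  have key : ∀ (p : ℤ) (E : GrSym 𝒰 →ₗ[k] GrSym 𝒰), E 1 = 0 →
      (∀ i, ∀ x ∈ 𝒰 i, gradedCommLeft p E i (ι 𝒰 x) = 0) → E = 0 := by
    intro p E h1 h2
    apply linearMap_ext 𝒰
    · exact h1
    · intro i x hx a ha
      have := LinearMap.congr_fun (h2 i x hx) a
      rw [gradedCommLeft_apply, ha, LinearMap.zero_apply, mul_zero, smul_zero,
        sub_zero] at this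
      exact this
  have h1 : E 1 = 0 := h 0 (Nat.zero_le _) 1 SetLike.GradedOne.one_mem
  induction n generalizing p E with
  | zero => exact key p E h1 fun i x hx => hE i _ (ι_mem_deg 𝒰 hx)
  | succ n ih =>
    refine key p E h1 fun i x hx => ?_
    have h2 : ∀ m ≤ n, ∀ a ∈ symPow 𝒰 m, gradedCommLeft p E i (ι 𝒰 x) a = 0 := by
      intro m hm a ha
      rw [gradedCommLeft_apply, h m (by omega) a ha, h (1 + m) (by omega) _
        (SetLike.GradedMul.mul_mem (ι_mem_symPow 𝒰 x) ha), mul_zero, smul_zero, sub_zero]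
    exact ih (hE i _ (ι_mem_deg 𝒰 hx)) h2 (h2 0 (Nat.zero_le _) 1 SetLike.GradedOne.one_mem)

theorem projPow_mem_deg {i : ℤ} {a : GrSym 𝒰} (ha : a ∈ deg 𝒰 i) (n : ℕ) :
    projPow 𝒰 n a ∈ deg 𝒰 i := by
  refine deg_le 𝒰 (N := (deg 𝒰 i).comap (projPow 𝒰 n)) ?_ ha
  rintro w rfl
  rw [Submodule.mem_comap, projPow_of_mem 𝒰 (word_mem_symPow 𝒰 w)]
  split_ifs
  · exact word_mem_deg 𝒰 w
  · exact zero_mem _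

/-- A differential operator of order `≤ n` that maps `S^n(U)` to `U` and the lower symmetric powers
to zero is a coderivation. -/
theorem eq_coder_of_isDiffOp {n : ℕ} {p : ℤ} {D : GrSym 𝒰 →ₗ[k] GrSym 𝒰}
    (hD : IsDiffOp (deg 𝒰) n p D) (hdeg : ∀ i, ∀ a ∈ deg 𝒰 i, D a ∈ deg 𝒰 (i + p))
    (hn : ∀ a ∈ symPow 𝒰 n, D a ∈ LinearMap.range (ι 𝒰))
    (h : ∀ m < n, ∀ a ∈ symPow 𝒰 m, D a = 0) : D = coder 𝒰 (proj 𝒰 ∘ₗ D ∘ₗ projPow 𝒰 n) := by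
  set l := proj 𝒰 ∘ₗ D ∘ₗ projPow 𝒰 n with hl
  have h1 : ∀ m ≠ n, ∀ a ∈ symPow 𝒰 m, l a = 0 := by
    intro m hm a ha
    simp [hl, projPow_of_mem 𝒰 ha, hm.symm]
  have h2 : IsDiffOp (deg 𝒰) n p (coder 𝒰 l) :=
    isDiffOp_coder (fun i a ha => proj_mem_of_mem_deg (hdeg _ _ (projPow_mem_deg ha n))) h1
  rw [← sub_eq_zero, sub_eq_add_neg, ← neg_one_smul k (coder 𝒰 l)]
  -- The difference has order `≤ n`, so it need only be tested on `S^m(U)` with `m ≤ n`. Below `n`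
  -- both operators vanish; on `S^n(U)` both take values in `U` and have the same linear component.
  refine IsDiffOp.eq_zero (hD.add (h2.smul (-1))) ?_
  intro m hm a ha
  rw [LinearMap.add_apply, LinearMap.smul_apply, neg_one_smul, ← sub_eq_add_neg, sub_eq_zero]
  rcases hm.lt_or_eq with hm | rfl
  · rw [h m hm a ha, coder_eq_zero_of_lt h1 hm ha]
  · have h3 : coder 𝒰 l a ∈ symPow 𝒰 1 := by
      have := coder_mem_symPow (m := 0) h1 (a := a) (by rwa [zero_add])
      exact this
    rw [← ι_proj_of_mem 𝒰 h3, proj_coder]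
    obtain ⟨x, hx⟩ := hn a ha
    simp [hl, projPow_of_mem 𝒰 ha, ← hx, proj_ι]

end GrSym

/-! ### Extension of linear maps to formal power series in `ħ`. -/

section HbarExt

variable {k : Type u} [Field k] {V : Type*} [Ring V] [Algebra k V] {B : Type*} [Ring B]
  [Algebra k B] {B' : Type*} [Ring B'] [Algebra k B']

/-- The coefficient of `ħⁿ`. -/
def hbarCoeff (k : Type u) [Field k] {B : Type*} [Ring B] [Algebra k B] (n : ℕ) :
    PowerSeries B →ₗ[k] B where
  toFun p := PowerSeries.coeff n p
  map_add' p q := by simp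
  map_smul' r p := by simp

theorem hbarCoeff_apply (n : ℕ) (p : PowerSeries B) : hbarCoeff k n p = PowerSeries.coeff n p := rfl

/-- The constant power series. -/
def hbarC (k : Type u) [Field k] {B : Type*} [Ring B] [Algebra k B] : B →ₗ[k] PowerSeries B where
  toFun b := PowerSeries.monomial 0 b
  map_add' p q := by simp
  map_smul' r p := by ext n; simp [PowerSeries.coeff_C]

theorem hbarC_apply (b : B) : hbarC k b = PowerSeries.monomial 0 b := rfl

theorem coeff_hbarExt (f : V →ₗ[k] PowerSeries B) (p : PowerSeries V) (n : ℕ) :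
    PowerSeries.coeff n (hbarExt f p) = ∑ x ∈ Finset.HasAntidiagonal.antidiagonal n,
      PowerSeries.coeff x.1 (f (PowerSeries.coeff x.2 p)) := by
  simp only [hbarExt, LinearMap.coe_mk, AddHom.coe_mk, PowerSeries.coeff_mk]

theorem hbarExt_X_pow_mul (f : V →ₗ[k] PowerSeries B) (n : ℕ) (p : PowerSeries V) :
    hbarExt f (PowerSeries.X ^ n * p) = PowerSeries.X ^ n * hbarExt f p := by
  ext N
  rw [coeff_hbarExt, PowerSeries.coeff_X_pow_mul']
  split_ifs with h
  · rw [coeff_hbarExt]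
    obtain ⟨M, rfl⟩ := Nat.exists_eq_add_of_le h
    rw [Nat.add_sub_cancel_left]
    refine Finset.sum_of_injOn (fun x : ℕ × ℕ => (x.1, x.2 + n)) ?_ ?_ ?_ ?_ |>.symm
    · intro x _ y _ hxy
      simp only [Prod.mk.injEq, add_left_inj] at hxy
      exact Prod.ext hxy.1 hxy.2
    · intro x hx
      have := Finset.HasAntidiagonal.mem_antidiagonal.1 (Finset.mem_coe.1 hx)
      simp only [Finset.mem_coe, Finset.HasAntidiagonal.mem_antidiagonal]
      omega
    · rintro ⟨a, b⟩ hx hx'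
      have h1 := Finset.HasAntidiagonal.mem_antidiagonal.1 hx
      rw [PowerSeries.coeff_X_pow_mul']
      split_ifs with hb
      · exfalso
        apply hx'
        refine ⟨(a, b - n), ?_, ?_⟩
        · simp only [Finset.mem_coe, Finset.HasAntidiagonal.mem_antidiagonal]
          simp only at h1
          omega
        · simp only [Prod.mk.injEq, true_and]; omega
      · simp
    · intro x _
      simp only [PowerSeries.coeff_X_pow_mul', Nat.le_add_left, if_true, Nat.add_sub_cancel]
  · refine Finset.sum_eq_zero fun x hx => ?_
    have := Finset.HasAntidiagonal.mem_antidiagonal.1 hx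
    rw [PowerSeries.coeff_X_pow_mul', if_neg (by omega)]
    simp

theorem hbarExt_C (f : V →ₗ[k] PowerSeries B) (v : V) :
    hbarExt f (PowerSeries.monomial 0 v) = f v := by
  ext N
  rw [coeff_hbarExt, Finset.sum_eq_single (N, 0)]
  · simp
  · rintro ⟨a, b⟩ hx hne
    have := Finset.HasAntidiagonal.mem_antidiagonal.1 hx
    have hb : b ≠ 0 := by
      rintro rfl
      apply hne
      simp only [add_zero] at this
      rw [this]
    rw [PowerSeries.coeff_monomial, if_neg hb]
    simp
  · intro h
    exact absurd (Finset.HasAntidiagonal.mem_antidiagonal.2 (by simp)) h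

theorem X_pow_mul_monomial (m n : ℕ) (v : V) :
    PowerSeries.X ^ m * PowerSeries.monomial n v = PowerSeries.monomial (m + n) v := by
  rw [PowerSeries.X_pow_eq, PowerSeries.monomial_mul_monomial, one_mul]

theorem hbarExt_monomial (f : V →ₗ[k] PowerSeries B) (n : ℕ) (v : V) :
    hbarExt f (PowerSeries.monomial n v) = PowerSeries.X ^ n * f v := by
  rw [← add_zero n, ← X_pow_mul_monomial, hbarExt_X_pow_mul, hbarExt_C, add_zero]

/-- Continuity for the `ħ`-adic topology, in the strong form satisfied by `k[[ħ]]`-linear maps. -/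
def HbarCont (G : PowerSeries V →ₗ[k] PowerSeries B) : Prop :=
  ∀ n p, (∀ i < n, PowerSeries.coeff i p = 0) → ∀ i < n, PowerSeries.coeff i (G p) = 0

theorem HbarCont.comp {G : PowerSeries B →ₗ[k] PowerSeries B'}
    {H : PowerSeries V →ₗ[k] PowerSeries B} (hG : HbarCont G) (hH : HbarCont H) :
    HbarCont (G ∘ₗ H) := fun n p hp => hG n _ (hH n p hp)

theorem hbarCont_hbarExt (f : V →ₗ[k] PowerSeries B) : HbarCont (hbarExt f) := by
  intro n p hp i hi
  rw [coeff_hbarExt]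
  refine Finset.sum_eq_zero fun x hx => ?_
  have := Finset.HasAntidiagonal.mem_antidiagonal.1 hx
  rw [hp _ (by omega)]
  simp

theorem hbarCont_mulLeft (p : PowerSeries B) : HbarCont (LinearMap.mulLeft k p) := by
  intro n q hq i hi
  rw [LinearMap.mulLeft_apply, PowerSeries.coeff_mul]
  refine Finset.sum_eq_zero fun x hx => ?_
  have := Finset.HasAntidiagonal.mem_antidiagonal.1 hx
  rw [hq _ (by omega), mul_zero]

theorem hbarCont_mulRight (p : PowerSeries B) : HbarCont (LinearMap.mulRight k p) := by
  intro n q hq i hi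
  rw [LinearMap.mulRight_apply, PowerSeries.coeff_mul]
  refine Finset.sum_eq_zero fun x hx => ?_
  have := Finset.HasAntidiagonal.mem_antidiagonal.1 hx
  rw [hq _ (by omega), zero_mul]

/-- Up to order `n`, a power series is a finite sum of monomials, and the remainder does not affect
the coefficient of `ħⁿ` in the value of a continuous map. -/
theorem HbarCont.ext {G H : PowerSeries V →ₗ[k] PowerSeries B} (hG : HbarCont G) (hH : HbarCont H)
    (h : ∀ n v, G (PowerSeries.monomial n v) = H (PowerSeries.monomial n v)) : G = H := by
  ext p n
  set t : PowerSeries V := ∑ i ∈ Finset.range (n + 1),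
    PowerSeries.monomial i (PowerSeries.coeff i p) with ht
  have h1 : ∀ i < n + 1, PowerSeries.coeff i (p - t) = 0 := by
    intro i hi
    rw [map_sub, ht, map_sum, Finset.sum_eq_single i]
    · simp
    · intro j _ hj
      rw [PowerSeries.coeff_monomial, if_neg hj.symm]
    · intro h; exact absurd (Finset.mem_range.2 hi) h
  have h2 := hG _ _ h1 n (Nat.lt_succ_self n)
  have h3 := hH _ _ h1 n (Nat.lt_succ_self n)
  have h4 : G t = H t := by
    rw [ht, map_sum, map_sum]
    exact Finset.sum_congr rfl fun i _ => h i _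
  rw [map_sub, map_sub, sub_eq_zero] at h2 h3
  rw [h2, h3, h4]

theorem hbarExt_hbarExt_comp (f : B →ₗ[k] PowerSeries B') (g : V →ₗ[k] PowerSeries B) :
    hbarExt (hbarExt f ∘ₗ g) = hbarExt f ∘ₗ hbarExt g := by
  apply (hbarCont_hbarExt _).ext ((hbarCont_hbarExt _).comp (hbarCont_hbarExt _))
  intro n v
  rw [LinearMap.comp_apply, hbarExt_monomial, hbarExt_monomial, hbarExt_X_pow_mul,
    LinearMap.comp_apply]

theorem hbarExt_comp_hbarC (f : V →ₗ[k] PowerSeries B) : hbarExt f ∘ₗ hbarC k = f := by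
  ext1 v
  exact hbarExt_C f v

theorem hbarExt_hbarC : hbarExt (hbarC k) = (LinearMap.id : PowerSeries V →ₗ[k] PowerSeries V) := by
  apply (hbarCont_hbarExt _).ext (fun n p h => h)
  intro n v
  rw [hbarExt_monomial, hbarC_apply, X_pow_mul_monomial, add_zero]; rfl

theorem hbarExt_mul (f : V →ₐ[k] PowerSeries B) (p q : PowerSeries V) :
    hbarExt f.toLinearMap (p * q) = hbarExt f.toLinearMap p * hbarExt f.toLinearMap q := by
  revert p
  apply LinearMap.congr_fun (f := hbarExt f.toLinearMap ∘ₗ LinearMap.mulRight k q)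
    (g := LinearMap.mulRight k (hbarExt f.toLinearMap q) ∘ₗ hbarExt f.toLinearMap)
  apply ((hbarCont_hbarExt _).comp (hbarCont_mulRight _)).ext
    ((hbarCont_mulRight _).comp (hbarCont_hbarExt _))
  intro m v
  change hbarExt f.toLinearMap (PowerSeries.monomial m v * q) =
    hbarExt f.toLinearMap (PowerSeries.monomial m v) * hbarExt f.toLinearMap q
  revert q
  apply LinearMap.congr_fun
    (f := hbarExt f.toLinearMap ∘ₗ LinearMap.mulLeft k (PowerSeries.monomial m v))
    (g := LinearMap.mulLeft k (hbarExt f.toLinearMap (PowerSeries.monomial m v)) ∘ₗ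
      hbarExt f.toLinearMap)
  apply ((hbarCont_hbarExt _).comp (hbarCont_mulLeft _)).ext
    ((hbarCont_mulLeft _).comp (hbarCont_hbarExt _))
  intro n w
  change hbarExt f.toLinearMap (PowerSeries.monomial m v * PowerSeries.monomial n w) =
    hbarExt f.toLinearMap (PowerSeries.monomial m v) *
      hbarExt f.toLinearMap (PowerSeries.monomial n w)
  rw [PowerSeries.monomial_mul_monomial, hbarExt_monomial, hbarExt_monomial, hbarExt_monomial,
    AlgHom.toLinearMap_apply, AlgHom.toLinearMap_apply, AlgHom.toLinearMap_apply, map_mul, pow_add,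
    mul_assoc, mul_assoc, ← mul_assoc (f v), ← PowerSeries.X_pow_mul (φ := f v), mul_assoc]

end HbarExt

/-! ### Weighted maps and their specialization at `ħ = 1`. -/

namespace GrSym

variable {k : Type u} [Field k] {U : Type v} [AddCommGroup U] [Module k U]
  {U' : Type v} [AddCommGroup U'] [Module k U'] {U'' : Type v} [AddCommGroup U''] [Module k U'']
variable (𝒰 : ℤ → Submodule k U) [Decomposition 𝒰] {𝒰' : ℤ → Submodule k U'} [Decomposition 𝒰']
  {𝒰'' : ℤ → Submodule k U''} [Decomposition 𝒰'']

/-- `x ↦ ħ x`. -/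
def weightι : U →ₗ[k] PowerSeries (GrSym 𝒰) where
  toFun x := PowerSeries.monomial 1 (ι 𝒰 x)
  map_add' x y := by simp
  map_smul' r x := by ext n; simp [PowerSeries.coeff_monomial]

theorem monomial_smul {B : Type*} [Ring B] [Algebra k B] (n : ℕ) (r : k) (b : B) :
    PowerSeries.monomial n (r • b) = r • PowerSeries.monomial n b := by
  ext m; simp [PowerSeries.coeff_monomial]

/-- The morphism of algebras `S(U) → S(U)[[ħ]]` that is multiplication by `ħ^m` on `S^m(U)`. -/
def weight : GrSym 𝒰 →ₐ[k] PowerSeries (GrSym 𝒰) :=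
  lift 𝒰 (weightι 𝒰) (fun i j x hx y hy => by
    simp only [weightι, LinearMap.coe_mk, AddHom.coe_mk]
    rw [PowerSeries.monomial_mul_monomial, PowerSeries.monomial_mul_monomial, ι_mul_ι 𝒰 hx hy,
      monomial_smul])

theorem weight_word (w : List (Σ i : ℤ, 𝒰 i)) :
    weight 𝒰 (word 𝒰 w) = PowerSeries.monomial w.length (word 𝒰 w) := by
  induction w with
  | nil => rw [word_nil, map_one, List.length_nil, ← PowerSeries.X_pow_eq, pow_zero]
  | cons x w ih =>
    rw [word_cons, map_mul, ih, weight, lift_ι]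
    change PowerSeries.monomial 1 _ * _ = _
    rw [PowerSeries.monomial_mul_monomial, List.length_cons, add_comm]

/-- The extension of `weight` to `S(U)[[ħ]]`. -/
abbrev hbarWeight : PowerSeries (GrSym 𝒰) →ₗ[k] PowerSeries (GrSym 𝒰) :=
  hbarExt (weight 𝒰).toLinearMap

variable {𝒰}

theorem weight_of_mem {m : ℕ} {a : GrSym 𝒰} (ha : a ∈ symPow 𝒰 m) :
    weight 𝒰 a = PowerSeries.monomial m a := by
  refine symPow_le 𝒰 (N := LinearMap.eqLocus (weight 𝒰).toLinearMap
    { toFun := fun a => PowerSeries.monomial m a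
      map_add' := fun a b => map_add _ a b
      map_smul' := fun r a => monomial_smul m r a }) ?_ ha
  rintro w rfl
  exact weight_word 𝒰 w

theorem coeff_weight (n : ℕ) (a : GrSym 𝒰) :
    PowerSeries.coeff n (weight 𝒰 a) = projPow 𝒰 n a := by
  revert a
  apply LinearMap.congr_fun (f := hbarCoeff k n ∘ₗ (weight 𝒰).toLinearMap)
  apply ext_symPow
  intro m a ha
  rw [projPow_of_mem 𝒰 ha, LinearMap.comp_apply, AlgHom.toLinearMap_apply, weight_of_mem ha,
    hbarCoeff_apply, PowerSeries.coeff_monomial]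

/-- The weight operator only relocates components: the part in `S^j(U)` of the coefficient of `ħⁿ`
moves to `ħ^(j + n)`. Nothing is lost, which is why it is injective. -/
theorem projPow_coeff_hbarWeight (p : PowerSeries (GrSym 𝒰)) (j n : ℕ) :
    projPow 𝒰 j (PowerSeries.coeff (j + n) (hbarWeight 𝒰 p)) =
      projPow 𝒰 j (PowerSeries.coeff n p) := by
  rw [coeff_hbarExt, map_sum, Finset.sum_eq_single (j, n)]
  · rw [AlgHom.toLinearMap_apply, coeff_weight, projPow_of_mem 𝒰 (projPow_mem 𝒰 _ _), if_pos rfl]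
  · rintro ⟨a, b⟩ hx hne
    have := Finset.HasAntidiagonal.mem_antidiagonal.1 hx
    rw [AlgHom.toLinearMap_apply, coeff_weight, projPow_of_mem 𝒰 (projPow_mem 𝒰 _ _), if_neg]
    rintro rfl
    apply hne
    simp only [add_right_inj] at this
    rw [this]
  · intro h
    exact absurd (by simp) h

theorem hbarWeight_injective : Function.Injective (hbarWeight 𝒰) := by
  rw [injective_iff_map_eq_zero]
  intro p hp
  ext n
  rw [map_zero]
  apply eq_zero_of_projPow 𝒰
  intro j
  rw [← projPow_coeff_hbarWeight, hp, map_zero, map_zero]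

/-- `Ψ : S(U) → S(U')[[ħ]]` is homogeneous for the weight in which `S^m(U)` has weight `m` and `ħ`
has weight `1`, and specializes to `F` for `ħ = 1`. -/
def IsWeighted (Ψ : GrSym 𝒰 →ₗ[k] PowerSeries (GrSym 𝒰')) (F : GrSym 𝒰 →ₗ[k] GrSym 𝒰') : Prop :=
  ∀ m, ∀ a ∈ symPow 𝒰 m, hbarWeight 𝒰' (Ψ a) = PowerSeries.monomial m (F a)

namespace IsWeighted

/-- This and `unique` are the two halves of the passage to `ħ = 1`: equal specializations give equal
weighted maps, and a weighted map has only one specialization. -/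
theorem injective {Ψ Ψ' : GrSym 𝒰 →ₗ[k] PowerSeries (GrSym 𝒰')} {F : GrSym 𝒰 →ₗ[k] GrSym 𝒰'}
    (h : IsWeighted Ψ F) (h' : IsWeighted Ψ' F) : Ψ = Ψ' := by
  apply ext_symPow
  intro m a ha
  apply hbarWeight_injective
  rw [h m a ha, h' m a ha]

theorem unique {Ψ : GrSym 𝒰 →ₗ[k] PowerSeries (GrSym 𝒰')} {F F' : GrSym 𝒰 →ₗ[k] GrSym 𝒰'}
    (h : IsWeighted Ψ F) (h' : IsWeighted Ψ F') : F = F' := by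
  apply ext_symPow
  intro m a ha
  have := (h m a ha).symm.trans (h' m a ha)
  have h2 := congrArg (PowerSeries.coeff m) this
  simpa using h2

theorem projPow_coeff {Ψ : GrSym 𝒰 →ₗ[k] PowerSeries (GrSym 𝒰')} {F : GrSym 𝒰 →ₗ[k] GrSym 𝒰'}
    (h : IsWeighted Ψ F) {m : ℕ} {a : GrSym 𝒰} (ha : a ∈ symPow 𝒰 m) (j n : ℕ) :
    projPow 𝒰' j (PowerSeries.coeff n (Ψ a)) = if j + n = m then projPow 𝒰' j (F a) else 0 := by
  rw [← projPow_coeff_hbarWeight, h m a ha, PowerSeries.coeff_monomial]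
  split_ifs
  · rfl
  · exact map_zero _

/-- The weight operators intertwine the extension of `Ψ` with that of the constant map `F`. This
makes specialization compatible with composition. -/
theorem hbarExt {Ψ : GrSym 𝒰 →ₗ[k] PowerSeries (GrSym 𝒰')} {F : GrSym 𝒰 →ₗ[k] GrSym 𝒰'}
    (h : IsWeighted Ψ F) : hbarWeight 𝒰' ∘ₗ hbarExt Ψ = _root_.hbarExt (hbarC k ∘ₗ F) ∘ₗ
      hbarWeight 𝒰 := by
  apply ((hbarCont_hbarExt _).comp (hbarCont_hbarExt _)).ext
    ((hbarCont_hbarExt _).comp (hbarCont_hbarExt _))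
  intro n v
  rw [LinearMap.comp_apply, LinearMap.comp_apply, hbarExt_monomial, hbarExt_monomial,
    hbarExt_X_pow_mul, hbarExt_X_pow_mul]
  congr 1
  revert v
  apply LinearMap.congr_fun (f := hbarWeight 𝒰' ∘ₗ Ψ)
    (g := _root_.hbarExt (hbarC k ∘ₗ F) ∘ₗ (weight 𝒰).toLinearMap)
  apply ext_symPow
  intro m a ha
  rw [LinearMap.comp_apply, LinearMap.comp_apply, h m a ha, AlgHom.toLinearMap_apply,
    weight_of_mem ha, hbarExt_monomial, LinearMap.comp_apply, hbarC_apply, X_pow_mul_monomial,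
    add_zero]

theorem comp {Ψ : GrSym 𝒰' →ₗ[k] PowerSeries (GrSym 𝒰'')} {F : GrSym 𝒰' →ₗ[k] GrSym 𝒰''}
    {Φ : GrSym 𝒰 →ₗ[k] PowerSeries (GrSym 𝒰')} {G : GrSym 𝒰 →ₗ[k] GrSym 𝒰'}
    (h : IsWeighted Ψ F) (h' : IsWeighted Φ G) :
    IsWeighted (_root_.hbarExt Ψ ∘ₗ Φ) (F ∘ₗ G) := by
  intro m a ha
  have h1 := LinearMap.congr_fun h.hbarExt (Φ a)
  rw [LinearMap.comp_apply, LinearMap.comp_apply, h' m a ha, hbarExt_monomial,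
    LinearMap.comp_apply, hbarC_apply, X_pow_mul_monomial, add_zero] at h1
  exact h1

/-- The comultiplication preserves total length, and the weight operator is multiplicative on
`S(U')[[ħ]]`, so weights add up. -/
theorem convMul {Ψ Ψ' : GrSym 𝒰 →ₗ[k] PowerSeries (GrSym 𝒰')} {F F' : GrSym 𝒰 →ₗ[k] GrSym 𝒰'}
    (h : IsWeighted Ψ F) (h' : IsWeighted Ψ' F') :
    IsWeighted (WithConv.toConv Ψ * WithConv.toConv Ψ').ofConv
      (WithConv.toConv F * WithConv.toConv F').ofConv := by
  intro m a ha
  refine symPow_le 𝒰 (N := LinearMap.eqLocus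
    (hbarWeight 𝒰' ∘ₗ (WithConv.toConv Ψ * WithConv.toConv Ψ').ofConv)
    { toFun := fun a => PowerSeries.monomial m ((WithConv.toConv F * WithConv.toConv F').ofConv a)
      map_add' := fun a b => by rw [map_add, map_add]
      map_smul' := fun r a => by rw [map_smul]; exact monomial_smul m r _ }) ?_ ha
  rintro w rfl
  change hbarWeight 𝒰' (LinearMap.mul' k _ _) = PowerSeries.monomial _ (LinearMap.mul' k _ _)
  have hw := comul_word 𝒰 w
  revert hw
  simp only [LinearMap.comp_apply]
  generalize (Coalgebra.comul (word 𝒰 w) : GrSym 𝒰 ⊗[k] GrSym 𝒰) = t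
  intro hw
  induction hw using Submodule.span_induction with
  | zero => simp only [map_zero]
  | add s t _ _ hs ht => simp only [map_add] at hs ht ⊢; rw [hs, ht]
  | smul r s _ hs => simp only [map_smul] at hs ⊢; rw [hs, monomial_smul]
  | mem t ht =>
    obtain ⟨l, l', h1, _, rfl⟩ := ht
    rw [TensorProduct.map_tmul, TensorProduct.map_tmul, LinearMap.mul'_apply, LinearMap.mul'_apply,
      hbarExt_mul]
    change hbarWeight 𝒰' (Ψ _) * hbarWeight 𝒰' (Ψ' _) = _
    rw [h _ _ (word_mem_symPow 𝒰 l), h' _ _ (word_mem_symPow 𝒰 l'),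
      PowerSeries.monomial_mul_monomial, h1]

theorem convOne : IsWeighted (1 : WithConv (GrSym 𝒰 →ₗ[k] PowerSeries (GrSym 𝒰'))).ofConv
    (1 : WithConv (GrSym 𝒰 →ₗ[k] GrSym 𝒰')).ofConv := by
  intro m a ha
  rw [LinearMap.convOne_apply, LinearMap.convOne_apply, counit_eq]
  by_cases hm : m = 0
  · subst hm
    have h1 : ∀ r : k, algebraMap k (PowerSeries (GrSym 𝒰')) r =
        PowerSeries.monomial 0 (algebraMap k (GrSym 𝒰') r) := by
      intro r
      rw [Algebra.algebraMap_eq_smul_one, Algebra.algebraMap_eq_smul_one, monomial_smul,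
        ← PowerSeries.X_pow_eq, pow_zero]
    rw [h1, hbarExt_C, AlgHom.toLinearMap_apply, weight_of_mem]
    rw [symPow, pow_zero]
    exact Submodule.algebraMap_mem _
  · rw [counit_of_mem 𝒰 hm ha]
    simp

theorem pow {Ψ : GrSym 𝒰 →ₗ[k] PowerSeries (GrSym 𝒰')} {F : GrSym 𝒰 →ₗ[k] GrSym 𝒰'}
    (h : IsWeighted Ψ F) (n : ℕ) :
    IsWeighted (WithConv.toConv Ψ ^ n).ofConv (WithConv.toConv F ^ n).ofConv := by
  induction n with
  | zero => rw [pow_zero, pow_zero]; exact convOne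
  | succ n ih => rw [pow_succ, pow_succ]; exact ih.convMul h

theorem exp {Ψ : GrSym 𝒰 →ₗ[k] PowerSeries (GrSym 𝒰')} {F : GrSym 𝒰 →ₗ[k] GrSym 𝒰'}
    (h : IsWeighted Ψ F) : IsWeighted (exp 𝒰 Ψ) (exp 𝒰 F) := by
  intro m a ha
  rw [exp_apply Ψ ha, exp_apply F ha, map_sum, map_sum]
  refine Finset.sum_congr rfl fun j _ => ?_
  rw [map_smul, monomial_smul, h.pow j m a ha]

end IsWeighted

end GrSym

/-! ### Degrees, pure maps and their composition. -/

namespace GrSym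

variable {k : Type u} [Field k] {U : Type v} [AddCommGroup U] [Module k U]
  {U' : Type v} [AddCommGroup U'] [Module k U'] {U'' : Type v} [AddCommGroup U''] [Module k U'']
variable {𝒰 : ℤ → Submodule k U} [Decomposition 𝒰] {𝒰' : ℤ → Submodule k U'} [Decomposition 𝒰']
  {𝒰'' : ℤ → Submodule k U''} [Decomposition 𝒰'']

section Degrees

variable {B : Type*} [Ring B] [Algebra k B] {Q : ℤ → Submodule k B} [SetLike.GradedMonoid Q]

theorem convMul_mem_of_mem {φ ψ : GrSym 𝒰 →ₗ[k] B} (hφ : ∀ i, ∀ a ∈ deg 𝒰 i, φ a ∈ Q i)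
    (hψ : ∀ i, ∀ a ∈ deg 𝒰 i, ψ a ∈ Q i) (i : ℤ) (a : GrSym 𝒰) (ha : a ∈ deg 𝒰 i) :
    (WithConv.toConv φ * WithConv.toConv ψ) a ∈ Q i := by
  refine deg_le 𝒰 (N := (Q i).comap (WithConv.toConv φ * WithConv.toConv ψ).ofConv) ?_ ha
  intro w hw
  rw [Submodule.mem_comap, LinearMap.convMul_apply]
  have h := comul_word 𝒰 w
  revert h
  generalize (Coalgebra.comul (word 𝒰 w) : GrSym 𝒰 ⊗[k] GrSym 𝒰) = t
  intro h
  induction h using Submodule.span_induction with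
  | zero => simp
  | add s t _ _ hs ht => rw [map_add, map_add]; exact add_mem hs ht
  | smul r s _ hs => rw [map_smul, map_smul]; exact Submodule.smul_mem _ _ hs
  | mem t ht =>
    obtain ⟨v, v', _, h1, rfl⟩ := ht
    rw [TensorProduct.map_tmul, LinearMap.mul'_apply, ← hw, ← h1]
    exact SetLike.GradedMul.mul_mem (hφ _ _ (word_mem_deg 𝒰 v)) (hψ _ _ (word_mem_deg 𝒰 v'))

theorem pow_mem_of_mem {φ : GrSym 𝒰 →ₗ[k] B} (hφ : ∀ i, ∀ a ∈ deg 𝒰 i, φ a ∈ Q i) (n : ℕ)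
    (i : ℤ) (a : GrSym 𝒰) (ha : a ∈ deg 𝒰 i) : (WithConv.toConv φ ^ n) a ∈ Q i := by
  induction n generalizing i a with
  | zero =>
    refine deg_le 𝒰 (N := (Q i).comap (WithConv.toConv φ ^ 0).ofConv) ?_ ha
    intro w hw
    rw [Submodule.mem_comap, pow_zero, LinearMap.convOne_apply, counit_eq]
    by_cases h : w = []
    · subst h
      subst hw
      rw [word_nil, map_one, map_one]
      exact SetLike.GradedOne.one_mem
    · rw [counit_word 𝒰 w h, map_zero]; exact zero_mem _
  | succ n ih =>
    rw [pow_succ]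
    exact convMul_mem_of_mem (φ := (WithConv.toConv φ ^ n).ofConv) ih hφ i a ha

theorem exp_mem_of_mem {φ : GrSym 𝒰 →ₗ[k] B} (hφ : ∀ i, ∀ a ∈ deg 𝒰 i, φ a ∈ Q i)
    (i : ℤ) (a : GrSym 𝒰) (ha : a ∈ deg 𝒰 i) : exp 𝒰 φ a ∈ Q i := by
  refine deg_le 𝒰 (N := (Q i).comap (exp 𝒰 φ)) ?_ ha
  rintro w rfl
  rw [Submodule.mem_comap, exp_apply φ (word_mem_symPow 𝒰 w)]
  exact Submodule.sum_mem _ fun j _ => Submodule.smul_mem _ _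
    (pow_mem_of_mem hφ j _ _ (word_mem_deg 𝒰 w))

/-- The power series of degree `i`, where `ħ` has degree `2`. -/
def hbarDeg (Q : ℤ → Submodule k B) (i : ℤ) : Submodule k (PowerSeries B) where
  carrier := {p | ∀ n : ℕ, PowerSeries.coeff n p ∈ Q (i - 2 * n)}
  add_mem' hp hq n := by rw [map_add]; exact add_mem (hp n) (hq n)
  zero_mem' n := by rw [map_zero]; exact zero_mem _
  smul_mem' r p hp n := by
    rw [← hbarCoeff_apply (k := k), map_smul]
    exact Submodule.smul_mem _ _ (hp n)

instance hbarDeg.gradedMonoid : SetLike.GradedMonoid (hbarDeg Q) where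
  one_mem := by
    intro n
    rw [PowerSeries.coeff_one]
    split_ifs with h
    · subst h
      simpa using SetLike.GradedOne.one_mem (A := Q)
    · exact zero_mem _
  mul_mem i j p q hp hq := by
    intro n
    rw [PowerSeries.coeff_mul]
    refine Submodule.sum_mem _ fun x hx => ?_
    have := Finset.HasAntidiagonal.mem_antidiagonal.1 hx
    rw [show i + j - 2 * (n : ℤ) = (i - 2 * (x.1 : ℤ)) + (j - 2 * (x.2 : ℤ)) by
      rw [← this]; push_cast; ring]
    exact SetLike.GradedMul.mul_mem (hp x.1) (hq x.2)

theorem hbarDegree_zero_iff {φ : GrSym 𝒰 →ₗ[k] PowerSeries B} :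
    HbarDegree (deg 𝒰) Q 0 φ ↔ ∀ i, ∀ a ∈ deg 𝒰 i, φ a ∈ hbarDeg Q i := by
  simp only [HbarDegree, add_zero]
  rfl

theorem hbarDegree_exp {φ : GrSym 𝒰 →ₗ[k] PowerSeries B} (h : HbarDegree (deg 𝒰) Q 0 φ) :
    HbarDegree (deg 𝒰) Q 0 (exp 𝒰 φ) := by
  rw [hbarDegree_zero_iff] at h ⊢
  exact exp_mem_of_mem h

theorem hbarDegree_comp {ψ : GrSym 𝒰' →ₗ[k] PowerSeries B}
    {φ : GrSym 𝒰 →ₗ[k] PowerSeries (GrSym 𝒰')} (hψ : HbarDegree (deg 𝒰') Q 0 ψ)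
    (hφ : HbarDegree (deg 𝒰) (deg 𝒰') 0 φ) : HbarDegree (deg 𝒰) Q 0 (hbarExt ψ ∘ₗ φ) := by
  intro i a ha n
  rw [LinearMap.comp_apply, coeff_hbarExt]
  refine Submodule.sum_mem _ fun x hx => ?_
  have := Finset.HasAntidiagonal.mem_antidiagonal.1 hx
  have h1 := hψ _ _ (hφ i a ha x.2) x.1
  rwa [show i + 0 - 2 * (x.2 : ℤ) + 0 - 2 * (x.1 : ℤ) = i + 0 - 2 * (n : ℤ) by
    rw [← this]; push_cast; ring] at h1

end Degrees

section PureMaps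

theorem coeff_hbarSum {V B : Type*} [Ring V] [Algebra k V] [Ring B] [Algebra k B]
    (a : ℕ → V →ₗ[k] B) (v : V) (n : ℕ) : PowerSeries.coeff n (hbarSum a v) = a (n + 1) v := by
  simp only [hbarSum, LinearMap.coe_mk, AddHom.coe_mk, PowerSeries.coeff_mk]

/-- The pure map `(1 / ħ) ∑ ħⁿ fₙ` with components `fₙ : S^n(U) → U'` given by `f : S(U) → U'`. -/
def pureLift (𝒰' : ℤ → Submodule k U') (f : GrSym 𝒰 →ₗ[k] U') :
    GrSym 𝒰 →ₗ[k] PowerSeries (GrSym 𝒰') :=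
  hbarSum fun n => ι 𝒰' ∘ₗ f ∘ₗ projPow 𝒰 n

theorem coeff_pureLift (f : GrSym 𝒰 →ₗ[k] U') (a : GrSym 𝒰) (n : ℕ) :
    PowerSeries.coeff n (pureLift 𝒰' f a) = ι 𝒰' (f (projPow 𝒰 (n + 1) a)) :=
  coeff_hbarSum _ _ _

theorem isPureMap_pureLift (f : GrSym 𝒰 →ₗ[k] U') : IsPureMap 𝒰 𝒰' (pureLift 𝒰' f) := by
  intro n hn
  obtain ⟨n, rfl⟩ := Nat.exists_eq_add_of_le' hn
  refine ⟨fun a _ => ?_, fun m hm a ha => ?_⟩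
  · rw [Nat.add_sub_cancel, coeff_pureLift]; exact LinearMap.mem_range_self _ _
  · rw [Nat.add_sub_cancel, coeff_pureLift, projPow_of_mem 𝒰 ha, if_neg hm.symm, map_zero, map_zero]

theorem pureLift_one (f : GrSym 𝒰 →ₗ[k] U') : pureLift 𝒰' f 1 = 0 := by
  ext n
  rw [coeff_pureLift, projPow_of_mem 𝒰 (m := 0) SetLike.GradedOne.one_mem, if_neg (by simp),
    map_zero, map_zero, map_zero]

/-- The map `S(U) → U'` with the components of a pure map. -/
def linPart (φ : GrSym 𝒰 →ₗ[k] PowerSeries (GrSym 𝒰')) : GrSym 𝒰 →ₗ[k] U' :=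
  proj 𝒰' ∘ₗ assemble 𝒰 fun m => hbarCoeff k (m - 1) ∘ₗ φ

theorem linPart_of_mem (φ : GrSym 𝒰 →ₗ[k] PowerSeries (GrSym 𝒰')) {m : ℕ} {a : GrSym 𝒰}
    (ha : a ∈ symPow 𝒰 m) : linPart φ a = proj 𝒰' (PowerSeries.coeff (m - 1) (φ a)) := by
  rw [linPart, LinearMap.comp_apply, assemble_of_mem 𝒰 _ ha]; rfl

theorem _root_.IsPureMap.map_one {φ : GrSym 𝒰 →ₗ[k] PowerSeries (GrSym 𝒰')}
    (h : IsPureMap 𝒰 𝒰' φ) : φ 1 = 0 := by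
  ext n
  exact (h (n + 1) (by simp)).2 0 (by simp) 1 SetLike.GradedOne.one_mem

/-- For `m = 0` the index `m - 1` in `linPart` is truncated to `0`. This is harmless because a pure
map vanishes at `1`. -/
theorem linPart_one {φ : GrSym 𝒰 →ₗ[k] PowerSeries (GrSym 𝒰')}
    (h : IsPureMap 𝒰 𝒰' φ) : linPart φ 1 = 0 := by
  rw [linPart_of_mem φ (m := 0) SetLike.GradedOne.one_mem, h.map_one, map_zero, map_zero]

theorem pureLift_linPart {φ : GrSym 𝒰 →ₗ[k] PowerSeries (GrSym 𝒰')} (h : IsPureMap 𝒰 𝒰' φ) :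
    pureLift 𝒰' (linPart φ) = φ := by
  apply ext_symPow
  intro m a ha
  ext n
  rw [coeff_pureLift, projPow_of_mem 𝒰 ha]
  split_ifs with hm
  · subst hm
    rw [linPart_of_mem φ ha, Nat.add_sub_cancel]
    obtain ⟨y, hy⟩ := (h (n + 1) (by simp)).1 a ha
    rw [Nat.add_sub_cancel] at hy
    rw [← hy, proj_ι]
  · rw [map_zero, map_zero]
    exact ((h (n + 1) (by simp)).2 m (Ne.symm hm) a ha).symm

/-- On `S^m(U)` with `m ≥ 1` a pure map takes values in `ħ^(m-1) U'`, and an element of `U'` has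
weight one, so the total is `m`. On `S⁰(U)` no power of `ħ` would fit, whence the condition `f 1 =
0`. -/
theorem isWeighted_pureLift {f : GrSym 𝒰 →ₗ[k] U'} (hf : f 1 = 0) :
    IsWeighted (pureLift 𝒰' f) (ι 𝒰' ∘ₗ f) := by
  intro m a ha
  rcases m with _ | m
  · rw [symPow_zero_eq 𝒰 ha, Algebra.algebraMap_eq_smul_one, map_smul, map_smul, pureLift_one,
      map_smul, LinearMap.comp_apply, hf]
    simp
  · have h1 : pureLift 𝒰' f a = PowerSeries.monomial m (ι 𝒰' (f a)) := by
      ext n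
      rw [coeff_pureLift, projPow_of_mem 𝒰 ha, PowerSeries.coeff_monomial]
      by_cases h : n = m
      · rw [if_pos h, if_pos (by rw [h])]
      · rw [if_neg h, if_neg (by omega), map_zero, map_zero]
    rw [h1, hbarExt_monomial, AlgHom.toLinearMap_apply, weight_of_mem (ι_mem_symPow 𝒰' _),
      X_pow_mul_monomial]
    rfl

theorem isWeighted_of_isPureMap {φ : GrSym 𝒰 →ₗ[k] PowerSeries (GrSym 𝒰')}
    (h : IsPureMap 𝒰 𝒰' φ) : IsWeighted φ (ι 𝒰' ∘ₗ linPart φ) := by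
  conv => arg 1; rw [← pureLift_linPart h]
  exact isWeighted_pureLift (linPart_one h)

/-- The components of a pure map of degree zero have different degrees, `2 - 2n` on `S^n(U)`, but
all of them are even. The coalgebra arguments use only this parity. -/
theorem linPart_even {φ : GrSym 𝒰 →ₗ[k] PowerSeries (GrSym 𝒰')}
    (h : HbarDegree (deg 𝒰) (deg 𝒰') 0 φ) (a : GrSym 𝒰) :
    gradeSign 𝒰' 1 (linPart φ a) = linPart φ (par 𝒰 a) := by
  revert a
  apply LinearMap.congr_fun (f := gradeSign 𝒰' 1 ∘ₗ linPart φ) (g := linPart φ ∘ₗ par 𝒰)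
  apply ext_word
  intro w
  rw [LinearMap.comp_apply, LinearMap.comp_apply, gradeSign_word, map_smul,
    linPart_of_mem φ (word_mem_symPow 𝒰 w),
    gradeSign_of_mem 𝒰' 1 (proj_mem_of_mem_deg (h _ _ (word_mem_deg 𝒰 w) _)), neg_one_zpow_congr]
  refine ⟨-((w.length - 1 : ℕ) : ℤ), by ring⟩

theorem isWeighted_hbarC : IsWeighted (hbarC k) (LinearMap.id : GrSym 𝒰 →ₗ[k] GrSym 𝒰) := by
  intro m a ha
  rw [hbarC_apply, hbarExt_C, AlgHom.toLinearMap_apply, weight_of_mem ha]; rfl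

theorem bvId_eq_pureLift : bvId 𝒰 = pureLift 𝒰 (proj 𝒰) := by
  ext a n
  rw [coeff_pureLift, bvId, coeff_hbarSum]
  rcases n with _ | n
  · rw [zero_add, Pi.single_eq_same, LinearMap.comp_apply, ι_proj, ι_proj, projPow_of_mem 𝒰 (projPow_mem 𝒰 1 a),
      if_pos rfl]
  · rw [Pi.single_eq_of_ne (by omega), proj_of_mem 𝒰 (by omega) (projPow_mem 𝒰 _ a), map_zero]
    rfl

variable [CharZero k]

theorem exp_ι_proj : exp 𝒰 (ι 𝒰 ∘ₗ proj 𝒰) = LinearMap.id := by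
  apply coalgHom_ext_proj (comul_exp (proj 𝒰) (proj_one 𝒰) fun a => (proj_gradeSign 𝒰 1 a).symm)
  · intro a; simp
  · exact exp_one _
  · rfl
  · intro a; rw [proj_exp _ (proj_one 𝒰)]; rfl

theorem exp_bvId : exp 𝒰 (bvId 𝒰) = hbarC k := by
  have h1 := (isWeighted_pureLift (𝒰' := 𝒰) (proj_one 𝒰)).exp
  rw [exp_ι_proj, ← bvId_eq_pureLift] at h1
  exact h1.injective isWeighted_hbarC

/-- By weight, the linear component of `F` appears in each coefficient of `E` as the part in
`S¹(U')`, and projection to a symmetric power preserves degrees. -/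
theorem hbarDegree_pureLift {E : GrSym 𝒰 →ₗ[k] PowerSeries (GrSym 𝒰')}
    {F : GrSym 𝒰 →ₗ[k] GrSym 𝒰'} (hE : IsWeighted E F) (h : HbarDegree (deg 𝒰) (deg 𝒰') 0 E) :
    HbarDegree (deg 𝒰) (deg 𝒰') 0 (pureLift 𝒰' (proj 𝒰' ∘ₗ F)) := by
  intro i a ha n
  have h1 : ∀ a, PowerSeries.coeff n (pureLift 𝒰' (proj 𝒰' ∘ₗ F) a) =
      projPow 𝒰' 1 (PowerSeries.coeff n (E a)) := by
    apply LinearMap.congr_fun (f := hbarCoeff k n ∘ₗ pureLift 𝒰' (proj 𝒰' ∘ₗ F))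
      (g := projPow 𝒰' 1 ∘ₗ hbarCoeff k n ∘ₗ E)
    apply ext_symPow
    intro m a ha
    simp only [LinearMap.comp_apply, hbarCoeff_apply]
    rw [coeff_pureLift, projPow_of_mem 𝒰 ha, hE.projPow_coeff ha, LinearMap.comp_apply, ι_proj,
      add_comm]
    split_ifs
    · rfl
    · rw [map_zero, map_zero]
  rw [h1]
  exact projPow_mem_deg (h i a ha n) 1

/-- The exponential is a coalgebra morphism with the same linear component as `F`, and that
component determines it. Hence every unital, parity-preserving coalgebra morphism comes from a map
to the cogenerators. -/
theorem coalgHom_eq_exp {F : GrSym 𝒰 →ₗ[k] GrSym 𝒰'}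
    (hF : ∀ a, Coalgebra.comul (F a) = TensorProduct.map F F (Coalgebra.comul a))
    (hF1 : F 1 = 1) (hpar : ∀ a, par 𝒰' (F a) = F (par 𝒰 a)) :
    exp 𝒰 (ι 𝒰' ∘ₗ proj 𝒰' ∘ₗ F) = F := by
  have h1 : (proj 𝒰' ∘ₗ F) 1 = 0 := by rw [LinearMap.comp_apply, hF1, proj_one]
  apply coalgHom_ext_proj (comul_exp _ h1 _) hF (exp_one _) hF1
  · intro a; rw [proj_exp _ h1]; rfl
  · intro a
    rw [LinearMap.comp_apply, LinearMap.comp_apply, ← hpar, proj_gradeSign]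

/-- The composition of pure maps of degree zero. -/
theorem diamond_spec {ψ : GrSym 𝒰' →ₗ[k] PowerSeries (GrSym 𝒰'')}
    {φ : GrSym 𝒰 →ₗ[k] PowerSeries (GrSym 𝒰')}
    (hψ : IsPureMap 𝒰' 𝒰'' ψ) (hψ' : HbarDegree (deg 𝒰') (deg 𝒰'') 0 ψ)
    (hφ : IsPureMap 𝒰 𝒰' φ) (hφ' : HbarDegree (deg 𝒰) (deg 𝒰') 0 φ) :
    IsPureMap 𝒰 𝒰'' (diamond 𝒰 𝒰' ψ φ) ∧ HbarDegree (deg 𝒰) (deg 𝒰'') 0 (diamond 𝒰 𝒰' ψ φ) ∧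
      exp 𝒰 (diamond 𝒰 𝒰' ψ φ) = hbarExt (exp 𝒰' ψ) ∘ₗ exp 𝒰 φ := by
  set f := linPart φ
  set g := linPart ψ
  have hf := comul_exp f (linPart_one hφ) (linPart_even hφ')
  have hg := comul_exp g (linPart_one hψ) (linPart_even hψ')
  set F := exp 𝒰 (ι 𝒰' ∘ₗ f) with hF
  set G := exp 𝒰' (ι 𝒰'' ∘ₗ g) with hG
  have hFp : ∀ a, par 𝒰' (F a) = F (par 𝒰 a) := exp_par fun a => by
    rw [LinearMap.comp_apply, gradeSign_ι, linPart_even hφ']; rfl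
  have hGp : ∀ a, par 𝒰'' (G a) = G (par 𝒰' a) := exp_par fun a => by
    rw [LinearMap.comp_apply, gradeSign_ι, linPart_even hψ']; rfl
  -- A composite of coalgebra morphisms is one, so it is the exponential of its linear component.
  -- This is why the logarithm of the composite is pure again.
  have hGF : exp 𝒰 (ι 𝒰'' ∘ₗ proj 𝒰'' ∘ₗ G ∘ₗ F) = G ∘ₗ F := by
    apply coalgHom_eq_exp
    · intro a
      rw [LinearMap.comp_apply, hg, hf, TensorProduct.map_comp]; rfl
    · rw [LinearMap.comp_apply, hF, hG, exp_one, exp_one]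
    · intro a
      rw [LinearMap.comp_apply, hGp, hFp]; rfl
  have hw : IsWeighted (hbarExt (exp 𝒰' ψ) ∘ₗ exp 𝒰 φ) (G ∘ₗ F) :=
    (isWeighted_of_isPureMap hψ).exp.comp (isWeighted_of_isPureMap hφ).exp
  have h1 : (proj 𝒰'' ∘ₗ G ∘ₗ F) 1 = 0 := by
    rw [LinearMap.comp_apply, LinearMap.comp_apply, hF, hG, exp_one, exp_one, proj_one]
  -- Both sides are weighted with specialization `G ∘ₗ F`, so they are equal. Taking logarithms then
  -- identifies the composition `⋄`.
  have hexp : exp 𝒰 (pureLift 𝒰'' (proj 𝒰'' ∘ₗ G ∘ₗ F)) = hbarExt (exp 𝒰' ψ) ∘ₗ exp 𝒰 φ := by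
    have h2 := (isWeighted_pureLift (𝒰' := 𝒰'') h1).exp
    rw [hGF] at h2
    exact h2.injective hw
  have hd : diamond 𝒰 𝒰' ψ φ = pureLift 𝒰'' (proj 𝒰'' ∘ₗ G ∘ₗ F) := by
    rw [diamond, ← hexp, log_exp (pureLift_one _)]
  rw [hd]
  exact ⟨isPureMap_pureLift _,
    hbarDegree_pureLift hw (hbarDegree_comp (hbarDegree_exp hψ') (hbarDegree_exp hφ')), hexp⟩

theorem eq_of_exp_eq {B : Type*} [Ring B] [Algebra k B] {φ ψ : GrSym 𝒰 →ₗ[k] B} (hφ : φ 1 = 0)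
    (hψ : ψ 1 = 0) (h : exp 𝒰 φ = exp 𝒰 ψ) : φ = ψ := by
  rw [← log_exp hφ, h, log_exp hψ]

theorem isBVInfMorphism_diamond {Δ : ℕ → GrSym 𝒰 →ₗ[k] GrSym 𝒰}
    {Δ' : ℕ → GrSym 𝒰' →ₗ[k] GrSym 𝒰'} {Δ'' : ℕ → GrSym 𝒰'' →ₗ[k] GrSym 𝒰''}
    {ψ : GrSym 𝒰' →ₗ[k] PowerSeries (GrSym 𝒰'')} {φ : GrSym 𝒰 →ₗ[k] PowerSeries (GrSym 𝒰')}
    (hψ : IsBVInfMorphism 𝒰' Δ' (deg 𝒰'') Δ'' ψ) (hψ' : IsPureMap 𝒰' 𝒰'' ψ)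
    (hφ : IsBVInfMorphism 𝒰 Δ (deg 𝒰') Δ' φ) (hφ' : IsPureMap 𝒰 𝒰' φ) :
    IsBVInfMorphism 𝒰 Δ (deg 𝒰'') Δ'' (diamond 𝒰 𝒰' ψ φ) := by
  obtain ⟨h1, h2, h3⟩ := diamond_spec hψ' hψ.degree hφ' hφ.degree
  refine ⟨h2, h1.map_one, ?_, fun n hn m hm a ha => (h1 n hn).2 m hm.ne' a ha⟩
  rw [h3, hbarExt_hbarExt_comp, LinearMap.comp_assoc, hφ.comm, ← LinearMap.comp_assoc,
    ← hbarExt_hbarExt_comp, hψ.comm, hbarExt_hbarExt_comp, LinearMap.comp_assoc]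

end PureMaps

end GrSym

/-! ### The category of pure dg BV algebras. -/

namespace PureDGBVAlgebra

open GrSym

variable {k : Type u} [Field k] [CharZero k]

/-- Pure dg BV algebras and pure `BV∞`-morphisms form a category. -/
theorem formsCategory (k : Type u) [Field k] [CharZero k] : FormsCategory.{u, v} k where
  id_mem V := by
    have h1 := isPureMap_pureLift (𝒰' := V.grading) (proj V.grading)
    rw [← bvId_eq_pureLift] at h1
    refine ⟨⟨?_, h1.map_one, ?_, fun n hn m hm a ha => (h1 n hn).2 m hm.ne' a ha⟩, h1⟩
    · have h2 : HbarDegree (deg V.grading) (deg V.grading) 0 (hbarC k) := by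
        intro i a ha n
        rw [hbarC_apply, PowerSeries.coeff_monomial]
        split_ifs with h
        · subst h; simpa using ha
        · exact zero_mem _
      have h3 := hbarDegree_pureLift (F := LinearMap.id) isWeighted_hbarC h2
      rw [LinearMap.comp_id] at h3
      rw [bvId_eq_pureLift]
      exact h3
    · rw [exp_bvId, hbarExt_hbarC, hbarExt_comp_hbarC, LinearMap.id_comp]
  comp_mem φ ψ := ⟨isBVInfMorphism_diamond ψ.isHom.1 ψ.isHom.2 φ.isHom.1 φ.isHom.2,
    (diamond_spec ψ.isHom.2 ψ.isHom.1.degree φ.isHom.2 φ.isHom.1.degree).1⟩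
  id_comp φ := by
    rw [diamond, exp_bvId, hbarExt_comp_hbarC, log_exp φ.isHom.1.map_one]
  comp_id φ := by
    rw [diamond, exp_bvId, hbarExt_hbarC, LinearMap.id_comp, log_exp φ.isHom.1.map_one]
  assoc φ ψ χ := by
    have h1 := diamond_spec ψ.isHom.2 ψ.isHom.1.degree φ.isHom.2 φ.isHom.1.degree
    have h2 := diamond_spec χ.isHom.2 χ.isHom.1.degree ψ.isHom.2 ψ.isHom.1.degree
    rw [diamond, h1.2.2, ← LinearMap.comp_assoc, ← hbarExt_hbarExt_comp, ← h2.2.2]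
    rfl

end PureDGBVAlgebra

/-! ### Even translations of the grading. -/

namespace GrSym

variable {k : Type u} [Field k] {U : Type v} [AddCommGroup U] [Module k U]

section Regrading

variable {𝒰 𝒲 : ℤ → Submodule k U} [Decomposition 𝒰] [Decomposition 𝒲]

/-- `s : S(U) → S(U)` is the identity on `U`, for two gradings of `U` that differ by the even
translation `c`. -/
structure IsRegrading (c : ℤ) (s : GrSym 𝒰 →ₐ[k] GrSym 𝒲) : Prop where
  even : Even c
  mem : ∀ i, ∀ x ∈ 𝒰 i, x ∈ 𝒲 (i + c)
  map_ι : ∀ x, s (ι 𝒰 x) = ι 𝒲 x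

namespace IsRegrading

variable {c : ℤ} {s : GrSym 𝒰 →ₐ[k] GrSym 𝒲} (hs : IsRegrading c s)
include hs

theorem gradeSign_eq (p : ℤ) : gradeSign 𝒲 p = gradeSign 𝒰 p := by
  ext x
  induction x using Decomposition.inductionOn 𝒰 with
  | zero => simp
  | add x y hx hy => rw [map_add, hx, hy, map_add]
  | @homogeneous i x =>
    rw [gradeSign_of_mem _ _ x.2, gradeSign_of_mem _ _ (hs.mem _ _ x.2), neg_one_zpow_congr]
    rw [mul_add, add_sub_cancel_left]
    exact hs.even.mul_left p

theorem gradedSymm {l : U →ₗ[k] U →ₗ[k] U} (hl : GradedSymm 𝒲 l) : GradedSymm 𝒰 l := by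
  intro i j x hx y hy
  rw [hl _ _ x (hs.mem i x hx) y (hs.mem j y hy), neg_one_zpow_congr]
  rw [show (i + c) * (j + c) - i * j = c * (i + j + c) by ring]
  exact hs.even.mul_right _

/-- Each letter is shifted by `c`, so the degree changes in proportion to the length, whereas all
Koszul signs stay the same. The dependence on the length is what the degree of `ħ` absorbs. -/
theorem map_word_mem (w : List (Σ i : ℤ, 𝒰 i)) :
    s (word 𝒰 w) ∈ deg 𝒲 (wdeg w + c * w.length) ∧ s (word 𝒰 w) ∈ symPow 𝒲 w.length := by
  induction w with
  | nil =>
    rw [word_nil, map_one, wdeg_nil, List.length_nil, Nat.cast_zero, mul_zero, add_zero]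
    exact ⟨SetLike.GradedOne.one_mem, SetLike.GradedOne.one_mem⟩
  | cons x w ih =>
    rw [word_cons, map_mul, hs.map_ι, wdeg_cons, List.length_cons]
    constructor
    · rw [show x.1 + wdeg w + c * ((w.length + 1 : ℕ) : ℤ) = x.1 + c + (wdeg w + c * w.length) by
        push_cast; ring]
      exact SetLike.GradedMul.mul_mem (ι_mem_deg 𝒲 (hs.mem _ _ x.2.2)) ih.1
    · rw [add_comm]
      exact SetLike.GradedMul.mul_mem (ι_mem_symPow 𝒲 _) ih.2

theorem map_gradeSign (p : ℤ) (a : GrSym 𝒰) :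
    s (gradeSign (deg 𝒰) p a) = gradeSign (deg 𝒲) p (s a) := by
  revert a
  apply LinearMap.congr_fun (f := s.toLinearMap ∘ₗ gradeSign (deg 𝒰) p)
    (g := gradeSign (deg 𝒲) p ∘ₗ s.toLinearMap)
  apply ext_word
  intro w
  simp only [LinearMap.comp_apply, AlgHom.toLinearMap_apply]
  rw [gradeSign_word, map_smul, gradeSign_of_mem _ _ (hs.map_word_mem w).1, neg_one_zpow_congr]
  rw [show p * wdeg w - p * (wdeg w + c * w.length) = c * -(p * w.length) by ring]
  exact hs.even.mul_right _

theorem map_comul (a : GrSym 𝒰) : Coalgebra.comul (s a) =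
    TensorProduct.map s.toLinearMap s.toLinearMap (Coalgebra.comul a) := by
  change comulLin 𝒲 (s a) = TensorProduct.map s.toLinearMap s.toLinearMap (comulLin 𝒰 a)
  revert a
  apply LinearMap.congr_fun (f := comulLin 𝒲 ∘ₗ s.toLinearMap)
    (g := TensorProduct.map s.toLinearMap s.toLinearMap ∘ₗ comulLin 𝒰)
  apply linearMap_ext
  · simp [comulLin_one]
  · intro i x hx a ha
    simp only [LinearMap.comp_apply, AlgHom.toLinearMap_apply] at ha ⊢
    rw [map_mul, hs.map_ι, comulLin_ι_mul 𝒲 (hs.mem i x hx), ha, comulLin_ι_mul 𝒰 hx]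
    generalize comulLin 𝒰 a = t
    induction t using TensorProduct.induction_on with
    | zero => simp
    | add t t' ht ht' => simp only [map_add, ht, ht']
    | tmul b d =>
      simp only [comulStep_tmul, map_add, TensorProduct.map_tmul, AlgHom.toLinearMap_apply,
        map_mul, hs.map_ι, hs.map_gradeSign]
      rw [gradeSign_congr (deg 𝒲) (show Even (i + c - i) by simpa using hs.even)]

theorem counit_map (a : GrSym 𝒰) : counitAlgHom 𝒲 (s a) = counitAlgHom 𝒰 a := by
  revert a
  apply AlgHom.congr_fun (φ₁ := (counitAlgHom 𝒲).comp s)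
  apply algHom_ext
  intro x
  rw [AlgHom.comp_apply, hs.map_ι, counitAlgHom_ι, counitAlgHom_ι]

theorem proj_map (a : GrSym 𝒰) : proj 𝒲 (s a) = proj 𝒰 a := by
  revert a
  apply LinearMap.congr_fun (f := proj 𝒲 ∘ₗ s.toLinearMap)
  apply linearMap_ext
  · simp [proj_one]
  · intro i x _ a _
    simp only [LinearMap.comp_apply, AlgHom.toLinearMap_apply]
    rw [map_mul, hs.map_ι, proj_ι_mul, proj_ι_mul, hs.counit_map]

theorem extendTwo_map {l : U →ₗ[k] U →ₗ[k] U} (hl : GradedSymm 𝒲 l) (hl' : GradedSymm 𝒰 l)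
    (a : GrSym 𝒰) : extendTwo 𝒲 l hl (s a) = extendTwo 𝒰 l hl' a := by
  revert a
  apply LinearMap.congr_fun (f := extendTwo 𝒲 l hl ∘ₗ s.toLinearMap)
  apply linearMap_ext
  · simp [extendTwo_one]
  · intro i x _ a _
    simp only [LinearMap.comp_apply, AlgHom.toLinearMap_apply]
    rw [map_mul, hs.map_ι, extendTwo_ι_mul, extendTwo_ι_mul, hs.proj_map]

theorem coder_map (l : GrSym 𝒲 →ₗ[k] U) (a : GrSym 𝒰) :
    coder 𝒲 l (s a) = s (coder 𝒰 (l ∘ₗ s.toLinearMap) a) := by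
  rw [coder_apply, coder_apply, hs.map_comul]
  generalize (Coalgebra.comul a : GrSym 𝒰 ⊗[k] GrSym 𝒰) = t
  induction t using TensorProduct.induction_on with
  | zero => simp
  | add t t' ht ht' => simp only [map_add, ht, ht']
  | tmul b d => simp [hs.map_ι]

end IsRegrading

end Regrading

/-! ### Pure dg BV structures as pairs of coderivations. -/

section DGBV

variable {𝒰 : ℤ → Submodule k U} [Decomposition 𝒰]

theorem hbarSum_dgBVSeq {V : Type*} [Ring V] [Algebra k V]
    (Δ₁ Δ₂ : V →ₗ[k] V) (v : V) : hbarSum (dgBVSeq Δ₁ Δ₂) v =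
      PowerSeries.monomial 0 (Δ₁ v) + PowerSeries.monomial 1 (Δ₂ v) := by
  ext n
  rw [coeff_hbarSum, map_add, PowerSeries.coeff_monomial, PowerSeries.coeff_monomial]
  rcases n with _ | _ | n
  · simp [dgBVSeq]
  · simp [dgBVSeq]
  · simp [dgBVSeq]

theorem hbarDegree_dgBVSeq {V : Type*} [Ring V] [Algebra k V] (𝒱 : ℤ → Submodule k V)
    (Δ₁ Δ₂ : V →ₗ[k] V) : HbarDegree 𝒱 𝒱 1 (hbarSum (dgBVSeq Δ₁ Δ₂)) ↔
      (∀ i, ∀ a ∈ 𝒱 i, Δ₁ a ∈ 𝒱 (i + 1)) ∧ ∀ i, ∀ a ∈ 𝒱 i, Δ₂ a ∈ 𝒱 (i + -1) := by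
  constructor
  · intro h
    constructor
    · intro i a ha
      have h1 := h i a ha 0
      rw [coeff_hbarSum, Nat.cast_zero, mul_zero, sub_zero] at h1
      exact h1
    · intro i a ha
      have h1 := h i a ha 1
      rw [coeff_hbarSum, show i + 1 - 2 * ((1 : ℕ) : ℤ) = i + -1 by push_cast; ring] at h1
      exact h1
  · rintro ⟨h1, h2⟩ i a ha n
    rw [coeff_hbarSum]
    rcases n with _ | _ | n
    · rw [Nat.cast_zero, mul_zero, sub_zero]
      exact h1 i a ha
    · rw [show i + 1 - 2 * ((0 + 1 : ℕ) : ℤ) = i + -1 by push_cast; ring]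
      exact h2 i a ha
    · exact zero_mem _

/-- The first coderivation preserves length. The second shortens words by one letter and is
accompanied by one factor `ħ`. -/
theorem isWeighted_dgBVSeq {l₁ l₂ : GrSym 𝒰 →ₗ[k] U}
    (h₁ : ∀ m ≠ 1, ∀ a ∈ symPow 𝒰 m, l₁ a = 0) (h₂ : ∀ m ≠ 2, ∀ a ∈ symPow 𝒰 m, l₂ a = 0) :
    IsWeighted (hbarSum (dgBVSeq (coder 𝒰 l₁) (coder 𝒰 l₂))) (coder 𝒰 l₁ + coder 𝒰 l₂) := by
  intro m a ha
  have e₁ : hbarWeight 𝒰 (PowerSeries.monomial 0 (coder 𝒰 l₁ a)) =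
      PowerSeries.monomial m (coder 𝒰 l₁ a) := by
    have : coder 𝒰 l₁ a ∈ symPow 𝒰 m := by
      rcases m with _ | m
      · rw [coder_eq_zero_of_lt h₁ (by omega) ha]; exact zero_mem _
      · exact coder_mem_symPow h₁ ha
    rw [hbarExt_monomial, AlgHom.toLinearMap_apply, weight_of_mem this, X_pow_mul_monomial, zero_add]
  have e₂ : hbarWeight 𝒰 (PowerSeries.monomial 1 (coder 𝒰 l₂ a)) =
      PowerSeries.monomial m (coder 𝒰 l₂ a) := by
    rcases lt_or_ge m 2 with hm | hm
    · rw [coder_eq_zero_of_lt h₂ hm ha, map_zero, map_zero, map_zero]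
    · obtain ⟨m, rfl⟩ := Nat.exists_eq_add_of_le' hm
      rw [hbarExt_monomial, AlgHom.toLinearMap_apply, weight_of_mem (coder_mem_symPow h₂ ha),
        X_pow_mul_monomial]
      congr 2
      omega
  rw [hbarSum_dgBVSeq, map_add, e₁, e₂, LinearMap.add_apply, map_add]

theorem isWeighted_zero {U' : Type v} [AddCommGroup U'] [Module k U'] {𝒰' : ℤ → Submodule k U'} :
    IsWeighted (0 : GrSym 𝒰 →ₗ[k] PowerSeries (GrSym 𝒰')) 0 := by
  intro m a _
  rw [LinearMap.zero_apply, map_zero, LinearMap.zero_apply, map_zero]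

variable (d : U →ₗ[k] U) (l : U →ₗ[k] U →ₗ[k] U) (hl : GradedSymm 𝒰 l)

theorem isWeighted_lieCoder :
    IsWeighted (hbarSum (dgBVSeq (coder 𝒰 (d ∘ₗ proj 𝒰)) (coder 𝒰 (extendTwo 𝒰 l hl))))
      (coder 𝒰 (lieCorestr d l hl)) := by
  rw [coder_lieCorestr]
  exact isWeighted_dgBVSeq
    (fun m hm a ha => by rw [LinearMap.comp_apply, proj_of_mem 𝒰 hm ha, map_zero])
    (fun m hm a ha => extendTwo_of_mem 𝒰 l hl hm ha)

theorem isDGBV_lieCoder (hd : ∀ i, ∀ x ∈ 𝒰 i, d x ∈ 𝒰 (i + 1))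
    (hl' : ∀ i j : ℤ, ∀ x ∈ 𝒰 i, ∀ y ∈ 𝒰 j, l x y ∈ 𝒰 (i + j + -1))
    (h0 : ∀ a, coder 𝒰 (lieCorestr d l hl) (coder 𝒰 (lieCorestr d l hl) a) = 0) :
    IsDGBV (deg 𝒰) (coder 𝒰 (d ∘ₗ proj 𝒰)) (coder 𝒰 (extendTwo 𝒰 l hl)) := by
  have h1 : ∀ i, ∀ a ∈ deg 𝒰 i, (d ∘ₗ proj 𝒰) a ∈ 𝒰 (i + 1) :=
    fun i a ha => hd _ _ (proj_mem_of_mem_deg ha)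
  have h2 : ∀ i, ∀ a ∈ deg 𝒰 i, extendTwo 𝒰 l hl a ∈ 𝒰 (i + -1) :=
    fun i a ha => extendTwo_mem_of_mem_deg hl hl' ha
  have hw := isWeighted_lieCoder d l hl
  refine ⟨(hbarDegree_dgBVSeq _ _ _).2 ⟨fun i a => coder_mem_deg h1, fun i a => coder_mem_deg h2⟩,
    ?_, ?_, ?_⟩
  · intro n hn
    rcases n with _ | _ | _ | n
    · omega
    · exact isDiffOp_coder h1 fun m hm a ha => by
        rw [LinearMap.comp_apply, proj_of_mem 𝒰 hm ha, map_zero]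
    · exact isDiffOp_coder h2 fun m hm a ha => extendTwo_of_mem 𝒰 l hl hm ha
    · exact IsDiffOp.zero _ _
  · apply (hw.comp hw).injective
    have h3 : coder 𝒰 (lieCorestr d l hl) ∘ₗ coder 𝒰 (lieCorestr d l hl) = 0 :=
      LinearMap.ext h0
    rw [h3]
    exact isWeighted_zero
  · rw [hbarSum_dgBVSeq, coder_one, coder_one, LinearMap.comp_apply, proj_one, extendTwo_one]
    simp

theorem isPureBV_lieCoder :
    IsPureBV 𝒰 (dgBVSeq (coder 𝒰 (d ∘ₗ proj 𝒰)) (coder 𝒰 (extendTwo 𝒰 l hl))) := by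
  have key : ∀ {n : ℕ} {f : GrSym 𝒰 →ₗ[k] U}, (∀ m ≠ n, ∀ a ∈ symPow 𝒰 m, f a = 0) →
      (∀ a ∈ symPow 𝒰 n, coder 𝒰 f a ∈ LinearMap.range (ι 𝒰)) ∧
        ∀ m < n, ∀ a ∈ symPow 𝒰 m, coder 𝒰 f a = 0 := by
    intro n f hf
    refine ⟨fun a ha => ?_, fun m hm a ha => coder_eq_zero_of_lt hf hm ha⟩
    have := coder_mem_symPow (m := 0) hf (a := a) (by rwa [zero_add])
    rwa [symPow, zero_add, pow_one] at this
  intro n hn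
  rcases n with _ | _ | _ | n
  · omega
  · exact key fun m hm a ha => by rw [LinearMap.comp_apply, proj_of_mem 𝒰 hm ha, map_zero]
  · exact key fun m hm a ha => extendTwo_of_mem 𝒰 l hl hm ha
  · exact ⟨fun _ _ => zero_mem _, fun _ _ _ _ => rfl⟩

/-- The operators of a pure dg BV algebra are the coderivations given by a differential and a
bracket. -/
theorem exists_lieCoder [CharZero k] {Δ₁ Δ₂ : GrSym 𝒰 →ₗ[k] GrSym 𝒰}
    (h : IsDGBV (deg 𝒰) Δ₁ Δ₂) (hp : IsPureBV 𝒰 (dgBVSeq Δ₁ Δ₂)) :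
    ∃ (d : U →ₗ[k] U) (l : U →ₗ[k] U →ₗ[k] U) (hl : GradedSymm 𝒰 l),
      (∀ i, ∀ x ∈ 𝒰 i, d x ∈ 𝒰 (i + 1)) ∧
      (∀ i j : ℤ, ∀ x ∈ 𝒰 i, ∀ y ∈ 𝒰 j, l x y ∈ 𝒰 (i + j + -1)) ∧
      Δ₁ = coder 𝒰 (d ∘ₗ proj 𝒰) ∧ Δ₂ = coder 𝒰 (extendTwo 𝒰 l hl) ∧
      ∀ a, coder 𝒰 (lieCorestr d l hl) (coder 𝒰 (lieCorestr d l hl) a) = 0 := by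
  obtain ⟨g1, g2⟩ := (hbarDegree_dgBVSeq _ _ _).1 h.degree
  let d : U →ₗ[k] U := proj 𝒰 ∘ₗ Δ₁ ∘ₗ ι 𝒰
  let l : U →ₗ[k] U →ₗ[k] U := LinearMap.mk₂ k (fun x y => proj 𝒰 (Δ₂ (ι 𝒰 x * ι 𝒰 y)))
    (fun x x' y => by simp only [map_add, add_mul]) (fun r x y => by simp)
    (fun x y y' => by simp only [map_add, mul_add]) (fun r x y => by simp)
  have hl : GradedSymm 𝒰 l := by
    intro i j x hx y hy
    change proj 𝒰 (Δ₂ (ι 𝒰 x * ι 𝒰 y)) = _ • proj 𝒰 (Δ₂ (ι 𝒰 y * ι 𝒰 x))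
    rw [ι_mul_ι 𝒰 hx hy, map_smul, map_smul]
  have o1 : IsDiffOp (deg 𝒰) 1 1 Δ₁ := by
    have := h.order 1 le_rfl
    rw [show (3 - 2 * ((1 : ℕ) : ℤ)) = 1 by norm_num] at this
    exact this
  have o2 : IsDiffOp (deg 𝒰) 2 (-1) Δ₂ := by
    have := h.order 2 one_le_two
    rw [show (3 - 2 * ((2 : ℕ) : ℤ)) = -1 by norm_num] at this
    exact this
  have e1 : Δ₁ = coder 𝒰 (d ∘ₗ proj 𝒰) := by
    refine (eq_coder_of_isDiffOp (n := 1) (p := 1) o1 g1 (hp 1 le_rfl).1 (hp 1 le_rfl).2).trans ?_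
    congr 1
    ext a
    simp only [d, LinearMap.comp_apply, ι_proj]
  have e2 : Δ₂ = coder 𝒰 (extendTwo 𝒰 l hl) := by
    refine (eq_coder_of_isDiffOp (n := 2) (p := -1) o2 g2 (hp 2 one_le_two).1
      (hp 2 one_le_two).2).trans ?_
    congr 1
    apply ext_word
    intro w
    by_cases hw : w.length = 2
    · obtain ⟨x, y, rfl⟩ := List.length_eq_two.1 hw
      rw [LinearMap.comp_apply, LinearMap.comp_apply, projPow_of_mem 𝒰 (word_mem_symPow 𝒰 _),
        if_pos hw.symm, word_cons, word_cons, word_nil, mul_one, extendTwo_ι_mul_ι]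
      rfl
    · rw [LinearMap.comp_apply, LinearMap.comp_apply, projPow_of_mem 𝒰 (word_mem_symPow 𝒰 _),
        if_neg (Ne.symm hw), extendTwo_of_mem 𝒰 l hl hw (word_mem_symPow 𝒰 w), map_zero, map_zero]
  refine ⟨d, l, hl, ?_, ?_, e1, e2, ?_⟩
  · intro i x hx
    exact proj_mem_of_mem_deg (g1 _ _ (ι_mem_deg 𝒰 hx))
  · intro i j x hx y hy
    exact proj_mem_of_mem_deg
      (g2 _ _ (SetLike.GradedMul.mul_mem (ι_mem_deg 𝒰 hx) (ι_mem_deg 𝒰 hy)))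
  -- The equation `Δ² = 0` over `k[[ħ]]` specializes at `ħ = 1` to the vanishing of the square of
  -- the total coderivation.
  · have hw := isWeighted_lieCoder d l hl
    rw [← e1, ← e2] at hw
    have h2 := hw.comp hw
    rw [h.sq_zero] at h2
    exact fun a => LinearMap.congr_fun (h2.unique isWeighted_zero) a

end DGBV

end GrSym

/-! ### Parity of operators of degree `1` and `-1`. -/

section LieAxioms

variable {k : Type u} [Field k] {U : Type v} [AddCommGroup U] [Module k U]
  {𝒰 : ℤ → Submodule k U} [Decomposition 𝒰]

theorem neg_one_zpow_sub_one (i : ℤ) : (-1 : k) ^ (i - 1) = -(-1 : k) ^ i := by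
  rw [zpow_sub₀ (by simp), zpow_one, div_neg, div_one]

theorem neg_one_zpow_add_one (i : ℤ) : (-1 : k) ^ (i + 1) = -(-1 : k) ^ i := by
  rw [zpow_add₀ (by simp), zpow_one, mul_neg, mul_one]

theorem gradeSign_one_of_degree {d : U →ₗ[k] U} (hd : ∀ i, ∀ x ∈ 𝒰 i, d x ∈ 𝒰 (i + 1)) (x : U) :
    gradeSign 𝒰 1 (d x) = -d (gradeSign 𝒰 1 x) := by
  induction x using Decomposition.inductionOn 𝒰 with
  | zero => simp
  | add x y hx hy => simp only [map_add, hx, hy, neg_add]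
  | @homogeneous i x =>
    rw [gradeSign_of_mem _ _ (hd i x x.2), gradeSign_of_mem _ _ x.2, map_smul, one_mul, one_mul,
      neg_one_zpow_add_one, neg_smul]

theorem gradeSign_one_of_degree₂ {l : U →ₗ[k] U →ₗ[k] U}
    (hl : ∀ i j : ℤ, ∀ x ∈ 𝒰 i, ∀ y ∈ 𝒰 j, l x y ∈ 𝒰 (i + j + -1)) (x y : U) :
    gradeSign 𝒰 1 (l x y) = -l (gradeSign 𝒰 1 x) (gradeSign 𝒰 1 y) := by
  induction x using Decomposition.inductionOn 𝒰 with
  | zero => simp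
  | add x x' hx hy => simp only [map_add, LinearMap.add_apply, hx, hy, neg_add]
  | @homogeneous i x =>
    induction y using Decomposition.inductionOn 𝒰 with
    | zero => simp
    | add y y' hx hy => simp only [map_add, hx, hy, neg_add]
    | @homogeneous j y =>
      rw [gradeSign_of_mem _ _ (hl i j x x.2 y y.2), gradeSign_of_mem _ _ x.2,
        gradeSign_of_mem _ _ y.2, map_smul, map_smul, LinearMap.smul_apply, one_mul, one_mul,
        one_mul, smul_smul, ← zpow_add₀ (by simp), ← sub_eq_add_neg, neg_one_zpow_sub_one, neg_smul,
        add_comm j i]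

end LieAxioms

/-! ### The pure dg BV algebra of a dg Lie algebra. -/

namespace DGLieAlgebra

open GrSym

variable {k : Type u} [Field k]

theorem isRegrading_doubleSusp (g : DGLieAlgebra.{u, v} k) :
    IsRegrading 2 (g.doubleSusp : GrSym g.shiftUp →ₐ[k] GrSym g.shiftDown) where
  even := by decide
  mem i x hx := by
    change x ∈ g.grading (-1 + (i + 2))
    rwa [show -1 + (i + 2) = 1 + i by ring]
  map_ι x := GrSym.lift_ι g.shiftUp (GrSym.ι g.shiftDown)
    (double_comm k g.grading 1 (-1) (by decide)) x

theorem isRegrading_doubleSusp_symm (g : DGLieAlgebra.{u, v} k) :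
    IsRegrading (-2) (g.doubleSusp.symm : GrSym g.shiftDown →ₐ[k] GrSym g.shiftUp) where
  even := by decide
  mem i x hx := by
    change x ∈ g.grading (1 + (i + -2))
    rwa [show 1 + (i + -2) = -1 + i by ring]
  map_ι x := GrSym.lift_ι g.shiftDown (GrSym.ι g.shiftUp)
    (double_comm k g.grading (-1) 1 (by decide)) x

theorem l₂_symm_down (g : DGLieAlgebra.{u, v} k) : GradedSymm g.shiftDown g.l₂ :=
  g.isRegrading_doubleSusp_symm.gradedSymm g.l₂_symm

theorem Δ₁_eq (g : DGLieAlgebra.{u, v} k) :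
    g.Δ₁ = coder g.shiftDown (g.d ∘ₗ proj g.shiftDown) := by
  ext a
  have h := g.isRegrading_doubleSusp.coder_map (g.d ∘ₗ proj g.shiftDown) (g.doubleSusp.symm a)
  have h2 : (g.d ∘ₗ proj g.shiftDown) ∘ₗ
      (g.doubleSusp : GrSym g.shiftUp →ₐ[k] GrSym g.shiftDown).toLinearMap =
      g.d ∘ₗ proj g.shiftUp := by
    ext b
    exact congrArg g.d (g.isRegrading_doubleSusp.proj_map b)
  rw [h2] at h
  refine Eq.trans ?_ (h.symm.trans ?_)
  · rfl
  · exact congrArg _ (g.doubleSusp.apply_symm_apply a)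

theorem Δ₂_eq (g : DGLieAlgebra.{u, v} k) :
    g.Δ₂ = coder g.shiftDown (extendTwo g.shiftDown g.l₂ g.l₂_symm_down) := by
  ext a
  have h := g.isRegrading_doubleSusp.coder_map (extendTwo g.shiftDown g.l₂ g.l₂_symm_down)
    (g.doubleSusp.symm a)
  have h2 : extendTwo g.shiftDown g.l₂ g.l₂_symm_down ∘ₗ
      (g.doubleSusp : GrSym g.shiftUp →ₐ[k] GrSym g.shiftDown).toLinearMap =
      extendTwo g.shiftUp g.l₂ g.l₂_symm := by
    ext b
    exact g.isRegrading_doubleSusp.extendTwo_map _ _ b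
  rw [h2] at h
  refine Eq.trans ?_ (h.symm.trans ?_)
  · rfl
  · exact congrArg _ (g.doubleSusp.apply_symm_apply a)

theorem d_mem_down (g : DGLieAlgebra.{u, v} k) (i : ℤ) (x : g.carrier) (hx : x ∈ g.shiftDown i) :
    g.d x ∈ g.shiftDown (i + 1) := by
  have := g.d_mem _ x hx
  change g.d x ∈ g.grading (-1 + (i + 1))
  rwa [← add_assoc]

theorem l₂_of_mem_down (g : DGLieAlgebra.{u, v} k) {i : ℤ} {x : g.carrier}
    (hx : x ∈ g.shiftDown i) (y : g.carrier) : g.l₂ x y = ((-1 : k) ^ i) • g.bracket x y := by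
  rw [l₂, LinearMap.comp_apply, ← g.isRegrading_doubleSusp.gradeSign_eq, gradeSign_of_mem _ _ hx,
    one_mul, map_smul, LinearMap.smul_apply]

theorem bracket_mem_down (g : DGLieAlgebra.{u, v} k) (i j : ℤ) (x : g.carrier)
    (hx : x ∈ g.shiftDown i) (y : g.carrier) (hy : y ∈ g.shiftDown j) :
    g.bracket x y ∈ g.shiftDown (i + j + -1) := by
  have := g.bracket_mem _ _ x hx y hy
  change g.bracket x y ∈ g.grading (-1 + (i + j + -1))
  rwa [show -1 + (i + j + -1) = -1 + i + (-1 + j) by ring]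

theorem l₂_mem_down (g : DGLieAlgebra.{u, v} k) (i j : ℤ) (x : g.carrier)
    (hx : x ∈ g.shiftDown i) (y : g.carrier) (hy : y ∈ g.shiftDown j) :
    g.l₂ x y ∈ g.shiftDown (i + j + -1) := by
  rw [g.l₂_of_mem_down hx]
  exact Submodule.smul_mem _ _ (g.bracket_mem_down i j x hx y hy)

theorem l₂_l₂_left (g : DGLieAlgebra.{u, v} k) {i j : ℤ} {x y : g.carrier}
    (hx : x ∈ g.shiftDown i) (hy : y ∈ g.shiftDown j) (z : g.carrier) :
    g.l₂ (g.l₂ x y) z = ((-1 : k) ^ (j + 1)) • g.bracket (g.bracket x y) z := by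
  rw [g.l₂_of_mem_down (g.l₂_mem_down i j x hx y hy), g.l₂_of_mem_down hx, map_smul,
    LinearMap.smul_apply, smul_smul, ← zpow_add₀ (by simp), neg_one_zpow_congr]
  exact ⟨i - 1, by ring⟩

/-- The differential and the bracket of `𝔤` define a coderivation of square zero. -/
theorem lieCoder_sq_zero [CharZero k] (g : DGLieAlgebra.{u, v} k) (a : GrSym g.shiftDown) :
    coder g.shiftDown (lieCorestr g.d g.l₂ g.l₂_symm_down)
      (coder g.shiftDown (lieCorestr g.d g.l₂ g.l₂_symm_down) a) = 0 := by
  revert a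
  rw [lieCoder_sq_zero_iff g.l₂_symm_down (gradeSign_one_of_degree g.d_mem_down)
    (gradeSign_one_of_degree₂ g.l₂_mem_down)]
  refine ⟨g.d_d, fun i x hx y => ?_, fun i j x hx y hy z => ?_⟩
  · rw [g.l₂_of_mem_down hx, g.l₂_of_mem_down hx, g.l₂_of_mem_down (g.d_mem_down i x hx), map_smul,
      g.leibniz _ x hx, neg_one_zpow_add_one, neg_add_eq_sub 1 i, neg_one_zpow_sub_one]
    module
  · induction z using Decomposition.inductionOn g.shiftDown with
    | zero => simp
    | add z z' hz hz' =>
      simp only [map_add, smul_add, LinearMap.add_apply] at hz hz' ⊢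
      rw [← add_zero (0 : g.carrier)]
      nth_rw 1 [← hz]
      rw [← hz']
      abel
    | @homogeneous m z =>
      obtain ⟨z, hz⟩ := z
      -- Antisymmetry brings the second term into the form `[y, [x, z]]` that occurs in the Jacobi
      -- identity; `e5` and `e6` then collect the shifted signs so that the three terms cancel.
      have e3 : g.bracket (g.bracket x z) y =
          -(((-1 : k) ^ ((i + m + -1 + -1) * (j - 1))) • g.bracket y (g.bracket x z)) := by
        have h1 : g.bracket x z ∈ g.grading (i + m + -1 + -1) := by
          have := g.bracket_mem_down i m x hx z hz
          rw [add_comm (i + m + -1) (-1)]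
          exact this
        have h2 : y ∈ g.grading (j - 1) := by rw [← neg_add_eq_sub]; exact hy
        exact g.antisymm _ _ _ h1 _ h2
      have e4 := g.jacobi _ _ x hx y hy z
      have e5 : (-1 : k) ^ (j * m) * (-1 : k) ^ (m + 1) *
          (-1 : k) ^ ((i + m + -1 + -1) * (j - 1)) = -((-1 : k) ^ (i * j + i)) := by
        rw [← zpow_add₀ (by simp), ← zpow_add₀ (by simp), ← neg_one_zpow_add_one,
          neg_one_zpow_congr]
        exact ⟨m * j - j - i + 1, by ring⟩
      have e6 : (-1 : k) ^ j * (-1 : k) ^ ((-1 + i) * (-1 + j)) = -((-1 : k) ^ (i * j + i)) := by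
        rw [← zpow_add₀ (by simp), ← neg_one_zpow_add_one, neg_one_zpow_congr]
        exact ⟨-i, by ring⟩
      rw [gradeSign_of_mem g.shiftDown j hz, map_smul, map_smul, LinearMap.smul_apply, g.l₂_l₂_left hx hy,
        g.l₂_l₂_left hx hz, e3, g.l₂_of_mem_down hx, g.l₂_of_mem_down hy, map_smul, e4,
        smul_neg, smul_neg, smul_smul, smul_smul, e5, smul_smul, smul_smul,
        neg_one_zpow_mul_self, one_mul, smul_add, smul_smul, e6, neg_one_zpow_add_one]
      module

theorem isPureDGBV [CharZero k] (g : DGLieAlgebra.{u, v} k) : g.IsPureDGBV := by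
  rw [IsPureDGBV, Δ₁_eq, Δ₂_eq]
  exact ⟨isDGBV_lieCoder g.d g.l₂ g.l₂_symm_down g.d_mem_down g.l₂_mem_down g.lieCoder_sq_zero,
    isPureBV_lieCoder _ _ _⟩

theorem isWeighted_Δ (g : DGLieAlgebra.{u, v} k) :
    IsWeighted (hbarSum (dgBVSeq g.Δ₁ g.Δ₂)) (g.Δ₁ + g.Δ₂) := by
  have h := isWeighted_lieCoder g.d g.l₂ g.l₂_symm_down
  rwa [coder_lieCorestr, ← Δ₁_eq, ← Δ₂_eq] at h

/-- The map `S(𝔤[-1]) → S(𝔥[-1])` that corresponds to an `L∞`-morphism. -/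
def LInfHom.down {g h : DGLieAlgebra.{u, v} k} (Φ : LInfHom g h) :
    GrSym g.shiftDown →ₗ[k] GrSym h.shiftDown :=
  h.doubleSusp.toLinearMap ∘ₗ Φ.toCoalgHom.toLinearMap ∘ₗ g.doubleSusp.symm.toLinearMap

/-! ### `L∞`-morphisms on the double suspension; functoriality and faithfulness. -/

section Down

variable {g h l : DGLieAlgebra.{u, v} k}

namespace LInfHom

theorem down_apply (Φ : LInfHom g h) (a : GrSym g.shiftDown) :
    Φ.down a = h.doubleSusp (Φ.toCoalgHom (g.doubleSusp.symm a)) := rfl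

theorem down_injective {Φ Ψ : LInfHom g h} (e : Φ.down = Ψ.down) : Φ = Ψ := by
  apply LInfHom.ext
  ext a
  have := LinearMap.congr_fun e (g.doubleSusp a)
  rw [down_apply, down_apply, AlgEquiv.symm_apply_apply] at this
  exact h.doubleSusp.injective this

theorem down_one (Φ : LInfHom g h) : Φ.down 1 = 1 := by
  rw [down_apply, _root_.map_one, Φ.map_one, _root_.map_one]

theorem comul_down (Φ : LInfHom g h) (a : GrSym g.shiftDown) :
    Coalgebra.comul (Φ.down a) = TensorProduct.map Φ.down Φ.down (Coalgebra.comul a) := by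
  have h1 := h.isRegrading_doubleSusp.map_comul (Φ.toCoalgHom (g.doubleSusp.symm a))
  have h2 := CoalgHomClass.map_comp_comul_apply Φ.toCoalgHom (g.doubleSusp.symm a)
  have h3 := g.isRegrading_doubleSusp_symm.map_comul a
  have h4 : Coalgebra.comul (g.doubleSusp.symm a) = TensorProduct.map
    g.doubleSusp.symm.toLinearMap g.doubleSusp.symm.toLinearMap (Coalgebra.comul a) := h3
  rw [← h2, h4] at h1
  refine h1.trans ?_
  rw [down, TensorProduct.map_comp, TensorProduct.map_comp]
  rfl

theorem par_down (Φ : LInfHom g h) (a : GrSym g.shiftDown) :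
    par h.shiftDown (Φ.down a) = Φ.down (par g.shiftDown a) := by
  have h1 := h.isRegrading_doubleSusp.map_gradeSign 1 (Φ.toCoalgHom (g.doubleSusp.symm a))
  have h2 : ∀ b, gradeSign (deg h.shiftUp) 1 (Φ.toCoalgHom b) =
      Φ.toCoalgHom (gradeSign (deg g.shiftUp) 1 b) := by
    intro b
    induction b using Decomposition.inductionOn (deg g.shiftUp) with
    | zero => simp
    | add b c hb hc => simp only [map_add, hb, hc]
    | @homogeneous i b =>
      rw [gradeSign_of_mem _ _ b.2, gradeSign_of_mem _ _ (Φ.map_deg i b b.2), map_smul]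
  have h3 := g.isRegrading_doubleSusp_symm.map_gradeSign 1 a
  rw [h2] at h1
  refine h1.symm.trans ?_
  exact congrArg (fun b => h.doubleSusp (Φ.toCoalgHom b)) h3.symm

theorem down_comm (Φ : LInfHom g h) : Φ.down ∘ₗ (g.Δ₁ + g.Δ₂) = (h.Δ₁ + h.Δ₂) ∘ₗ Φ.down := by
  ext a
  have := Φ.comm (g.doubleSusp.symm a)
  simp only [LinearMap.comp_apply, LinearMap.add_apply, down_apply, Δ₁, Δ₂, map_add,
    AlgEquiv.toLinearMap_apply, AlgEquiv.symm_apply_apply]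
  rw [← map_add, ← map_add, this, map_add]

theorem proj_down (Φ : LInfHom g h) (a : GrSym g.shiftDown) :
    proj h.shiftDown (Φ.down a) = proj h.shiftUp (Φ.toCoalgHom (g.doubleSusp.symm a)) :=
  h.isRegrading_doubleSusp.proj_map _

theorem proj_down_one (Φ : LInfHom g h) : (proj h.shiftDown ∘ₗ Φ.down) 1 = 0 := by
  rw [LinearMap.comp_apply, down_one, proj_one]

end LInfHom

theorem bvMap_eq (Φ : LInfHom g h) :
    bvMap Φ = pureLift h.shiftDown (proj h.shiftDown ∘ₗ Φ.down) := by
  ext a n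
  rw [bvMap, coeff_hbarSum, coeff_pureLift, LinearMap.comp_apply (proj h.shiftDown),
    LInfHom.proj_down]
  rfl

/-- The link between the two categories: setting `ħ = 1` in the exponential of `bvMap Φ` returns the
transported coalgebra morphism. -/
theorem isWeighted_exp_bvMap [CharZero k] (Φ : LInfHom g h) :
    IsWeighted (exp g.shiftDown (bvMap Φ)) Φ.down := by
  have h1 := (isWeighted_pureLift (𝒰' := h.shiftDown) Φ.proj_down_one).exp
  rwa [coalgHom_eq_exp Φ.comul_down Φ.down_one Φ.par_down, ← bvMap_eq] at h1

theorem bvMap_one (Φ : LInfHom g h) : bvMap Φ 1 = 0 := by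
  rw [bvMap_eq, pureLift_one]

theorem isPureMap_bvMap (Φ : LInfHom g h) : IsPureMap g.shiftDown h.shiftDown (bvMap Φ) := by
  rw [bvMap_eq]; exact isPureMap_pureLift _

/-- A word contributing to the coefficient of `ħⁿ` has `n + 1` letters. Passing to `S(𝔤[1])` changes
its degree by `-2(n + 1)`, `Φ` preserves degrees, and the single letter of the value returns with
`+2`. The sum `-2n` is cancelled by the degree of `ħⁿ`. -/
theorem hbarDegree_bvMap (Φ : LInfHom g h) :
    HbarDegree (deg g.shiftDown) (deg h.shiftDown) 0 (bvMap Φ) := by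
  intro i a ha n
  refine deg_le g.shiftDown
    (N := (deg h.shiftDown (i + 0 - 2 * n)).comap (hbarCoeff k n ∘ₗ bvMap Φ)) ?_ ha
  rintro w rfl
  rw [Submodule.mem_comap, LinearMap.comp_apply, hbarCoeff_apply, bvMap_eq, coeff_pureLift,
    projPow_of_mem _ (word_mem_symPow _ w)]
  split_ifs with hn
  · apply ι_mem_deg
    have h1 := (g.isRegrading_doubleSusp_symm.map_word_mem w).1
    have h2 := h.isRegrading_doubleSusp.mem _ _ (proj_mem_of_mem_deg (Φ.map_deg _ _ h1))
    rw [LinearMap.comp_apply, LInfHom.proj_down]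
    rw [← hn, show wdeg w + -2 * ((n + 1 : ℕ) : ℤ) + 2 = wdeg w + 0 - 2 * n by push_cast; ring]
      at h2
    exact h2
  · rw [map_zero, map_zero]; exact zero_mem _

variable [CharZero k]

/-- Both sides of the intertwining relation are weighted, and at `ħ = 1` the relation says that `Φ`
commutes with the codifferentials. -/
theorem isHom_bvMap (hg : g.IsPureDGBV) (hh : h.IsPureDGBV) (Φ : LInfHom g h) :
    PureDGBVAlgebra.IsHom (g.toBV hg) (h.toBV hh) (bvMap Φ) := by
  refine ⟨⟨hbarDegree_bvMap Φ, bvMap_one Φ, ?_,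
    fun n hn m hm a ha => (isPureMap_bvMap Φ n hn).2 m hm.ne' a ha⟩, isPureMap_bvMap Φ⟩
  have h1 := (isWeighted_exp_bvMap Φ).comp g.isWeighted_Δ
  rw [Φ.down_comm] at h1
  exact h1.injective (h.isWeighted_Δ.comp (isWeighted_exp_bvMap Φ))

theorem bvFunctorial (k : Type u) [Field k] [CharZero k] :
    BVFunctorial (k := k) fun g : DGLieAlgebra.{u, v} k => g.isPureDGBV where
  map_mem Φ := isHom_bvMap _ _ Φ
  map_id g := by
    have h1 : LInfHom.down (CategoryTheory.CategoryStruct.id g) = LinearMap.id := by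
      ext a
      exact g.doubleSusp.apply_symm_apply a
    rw [bvMap_eq, h1, LinearMap.comp_id, bvId_eq_pureLift]
  map_comp {g h l} Φ Ψ := by
    have h1 : LInfHom.down (CategoryTheory.CategoryStruct.comp Φ Ψ) =
        LInfHom.down Ψ ∘ₗ LInfHom.down Φ := by
      ext a
      rw [LinearMap.comp_apply, LInfHom.down_apply, LInfHom.down_apply, LInfHom.down_apply,
        AlgEquiv.symm_apply_apply]
      rfl
    obtain ⟨h2, -, h3⟩ := diamond_spec (isPureMap_bvMap Ψ) (hbarDegree_bvMap Ψ)
      (isPureMap_bvMap Φ) (hbarDegree_bvMap Φ)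
    -- As `log` inverts `exp`, it suffices to compare exponentials. Both are weighted with the
    -- composite coalgebra morphism as specialization.
    apply eq_of_exp_eq (bvMap_one _) h2.map_one
    rw [h3]
    have h4 := isWeighted_exp_bvMap (CategoryTheory.CategoryStruct.comp Φ Ψ)
    rw [h1] at h4
    exact h4.injective ((isWeighted_exp_bvMap Ψ).comp (isWeighted_exp_bvMap Φ))

/-- The exponential of `bvMap Φ` has a unique specialization at `ħ = 1`, and this recovers `Φ`. -/
theorem bvMap_injective {Φ Ψ : LInfHom g h} (e : bvMap Φ = bvMap Ψ) : Φ = Ψ := by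
  have h1 := isWeighted_exp_bvMap Φ
  rw [e] at h1
  exact LInfHom.down_injective (h1.unique (isWeighted_exp_bvMap Ψ))

end Down

end DGLieAlgebra

/-! ### Fullness and essential surjectivity. -/

namespace DGLieAlgebra

open GrSym

variable {k : Type u} [Field k] [CharZero k]

section Full

variable {g h : DGLieAlgebra.{u, v} k}

/-- The linear part of `φ` exponentiates to a coalgebra morphism, the specialization of `exp φ`. The
relation with `Δ` and `Δ'` specializes to compatibility with the codifferentials, and transport to
`S(𝔤[1])` yields the required `L∞`-morphism. -/
theorem exists_bvMap_eq (hg : g.IsPureDGBV) (hh : h.IsPureDGBV)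
    {φ : GrSym g.shiftDown →ₗ[k] PowerSeries (GrSym h.shiftDown)}
    (hφ : PureDGBVAlgebra.IsHom (g.toBV hg) (h.toBV hh) φ) : ∃ Φ : LInfHom g h, bvMap Φ = φ := by
  have hpure : IsPureMap g.shiftDown h.shiftDown φ := hφ.2
  have hdeg : HbarDegree (deg g.shiftDown) (deg h.shiftDown) 0 φ := hφ.1.degree
  have hcomm : hbarExt (exp g.shiftDown φ) ∘ₗ hbarSum (dgBVSeq g.Δ₁ g.Δ₂) =
    hbarExt (hbarSum (dgBVSeq h.Δ₁ h.Δ₂)) ∘ₗ exp g.shiftDown φ := hφ.1.comm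
  set f := linPart φ with hf
  have hf1 : f 1 = 0 := linPart_one hpure
  have hfe := linPart_even hdeg
  set F := exp g.shiftDown (ι h.shiftDown ∘ₗ f) with hF
  have hFc := comul_exp f hf1 hfe
  have hw : IsWeighted (exp g.shiftDown φ) F := (isWeighted_of_isPureMap hpure).exp
  have hFΔ : F ∘ₗ (g.Δ₁ + g.Δ₂) = (h.Δ₁ + h.Δ₂) ∘ₗ F := by
    have h1 := hw.comp g.isWeighted_Δ
    rw [hcomm] at h1
    exact h1.unique (h.isWeighted_Δ.comp hw)
  have hFp : ∀ a, par h.shiftDown (F a) = F (par g.shiftDown a) := exp_par fun a => by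
    rw [LinearMap.comp_apply, gradeSign_ι, hfe]; rfl
  let G : GrSym g.shiftUp →ₗ[k] GrSym h.shiftUp :=
    h.doubleSusp.symm.toLinearMap ∘ₗ F ∘ₗ g.doubleSusp.toLinearMap
  have hG : ∀ a, G a = h.doubleSusp.symm (F (g.doubleSusp a)) := fun a => rfl
  have hG1 : G 1 = 1 := by rw [hG, map_one, hF, exp_one, map_one]
  have hGc : ∀ a, Coalgebra.comul (G a) = TensorProduct.map G G (Coalgebra.comul a) := by
    intro a
    have h1 := h.isRegrading_doubleSusp_symm.map_comul (F (g.doubleSusp a))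
    have h2 : Coalgebra.comul (g.doubleSusp a) = TensorProduct.map g.doubleSusp.toLinearMap
      g.doubleSusp.toLinearMap (Coalgebra.comul a) := g.isRegrading_doubleSusp.map_comul a
    rw [hFc, h2] at h1
    refine h1.trans ?_
    simp only [G]
    rw [TensorProduct.map_comp, TensorProduct.map_comp]
    rfl
  have hGp : ∀ a, par h.shiftUp (G a) = G (par g.shiftUp a) := by
    intro a
    have h1 := h.isRegrading_doubleSusp_symm.map_gradeSign 1 (F (g.doubleSusp a))
    have h2 := g.isRegrading_doubleSusp.map_gradeSign 1 a
    refine h1.symm.trans ?_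
    exact congrArg h.doubleSusp.symm ((hFp _).trans (congrArg F h2.symm))
  have hproj : ∀ a, proj h.shiftUp (G a) = f (g.doubleSusp a) := by
    intro a
    have h1 := h.isRegrading_doubleSusp_symm.proj_map (F (g.doubleSusp a))
    rw [proj_exp f hf1] at h1
    exact h1
  have hGdeg : ∀ i, ∀ a ∈ deg g.shiftUp i, G a ∈ deg h.shiftUp i := by
    -- Since `G` is the exponential of its linear component, it preserves degrees if that component
    -- does. For the component, the count of `hbarDegree_bvMap` is run backwards: a word with one
    -- letter more than `w` involves the coefficient of `ħ^w.length`.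
    rw [← coalgHom_eq_exp hGc hG1 hGp]
    apply exp_mem_of_mem
    intro i a ha
    refine deg_le g.shiftUp
      (N := (deg h.shiftUp i).comap (ι h.shiftUp ∘ₗ proj h.shiftUp ∘ₗ G)) ?_ ha
    rintro w rfl
    rw [Submodule.mem_comap, LinearMap.comp_apply, LinearMap.comp_apply, hproj]
    apply ι_mem_deg
    obtain ⟨h1, h2⟩ := g.isRegrading_doubleSusp.map_word_mem w
    rcases w with _ | ⟨x, w⟩
    · rw [word_nil, map_one, hf1]; exact zero_mem _
    · have h3 := proj_mem_of_mem_deg (hdeg _ _ h1 w.length)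
      have h4 := h.isRegrading_doubleSusp_symm.mem _ _ h3
      rw [show wdeg (x :: w) + 2 * ((x :: w).length : ℤ) + 0 - 2 * w.length + -2 = wdeg (x :: w) by
        rw [List.length_cons]; push_cast; ring] at h4
      have h5 : f (g.doubleSusp (word g.shiftUp (x :: w))) = _ := linPart_of_mem φ h2
      rw [h5]
      exact h4
  let Φ : LInfHom g h :=
    { toCoalgHom :=
        { G with
          counit_comp := by
            ext a
            have h1 := h.isRegrading_doubleSusp_symm.counit_map (F (g.doubleSusp a))
            rw [counit_exp f] at h1
            exact h1.trans (g.isRegrading_doubleSusp.counit_map a)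
          map_comp_comul := by
            ext a
            exact (hGc a).symm }
      map_deg := hGdeg
      map_one := hG1
      comm := by
        intro a
        have h1 := LinearMap.congr_fun hFΔ (g.doubleSusp a)
        simp only [LinearMap.comp_apply, LinearMap.add_apply, Δ₁, Δ₂, AlgEquiv.toLinearMap_apply,
          AlgEquiv.symm_apply_apply] at h1
        rw [← map_add, ← map_add] at h1
        change G (g.D₁ a + g.D₂ a) = h.D₁ (G a) + h.D₂ (G a)
        rw [hG, h1, AlgEquiv.symm_apply_apply]
        rfl }
  refine ⟨Φ, ?_⟩
  have h1 : Φ.down = F := by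
    ext a
    change h.doubleSusp (h.doubleSusp.symm (F (g.doubleSusp (g.doubleSusp.symm a)))) = F a
    rw [AlgEquiv.apply_symm_apply, AlgEquiv.apply_symm_apply]
  have h2 : proj h.shiftDown ∘ₗ F = f := LinearMap.ext (proj_exp f hf1)
  rw [bvMap_eq, h1, h2, hf, pureLift_linPart hpure]

end Full

/-! ### The dg Lie algebra of a pure dg BV algebra. -/

section EssSurj

variable {U : Type v} [AddCommGroup U] [Module k U] (𝒰 : ℤ → Submodule k U) [Decomposition 𝒰]
  {d : U →ₗ[k] U} {l : U →ₗ[k] U →ₗ[k] U} (hl : GradedSymm 𝒰 l)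
  (hd : ∀ i, ∀ x ∈ 𝒰 i, d x ∈ 𝒰 (i + 1))
  (hl' : ∀ i j : ℤ, ∀ x ∈ 𝒰 i, ∀ y ∈ 𝒰 j, l x y ∈ 𝒰 (i + j + -1))
  (h0 : ∀ a, coder 𝒰 (lieCorestr d l hl) (coder 𝒰 (lieCorestr d l hl) a) = 0)

/-- The dg Lie algebra `U[1]` given by a coderivation `d + l` of `S(U)` of square zero. -/
def ofLieCoder : DGLieAlgebra.{u, v} k where
  carrier := U
  grading := gradedShift 1 𝒰
  d := d
  bracket := l ∘ₗ gradeSign 𝒰 1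
  d_mem i x hx := by
    have := hd _ x hx
    rwa [add_assoc] at this
  bracket_mem i j x hx y hy := by
    have := hl' _ _ x hx y hy
    rw [show 1 + i + (1 + j) + -1 = 1 + (i + j) by ring] at this
    rw [LinearMap.comp_apply, gradeSign_of_mem 𝒰 1 hx, map_smul]
    exact Submodule.smul_mem _ _ this
  d_d := ((lieCoder_sq_zero_iff hl (gradeSign_one_of_degree hd)
    (gradeSign_one_of_degree₂ hl')).1 h0).1
  antisymm i j x hx y hy := by
    rw [LinearMap.comp_apply, gradeSign_of_mem 𝒰 1 hx, LinearMap.comp_apply,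
      gradeSign_of_mem 𝒰 1 hy, map_smul, map_smul, LinearMap.smul_apply, LinearMap.smul_apply,
      hl _ _ x hx y hy, smul_smul, smul_smul, ← zpow_add₀ (by simp), ← zpow_add₀ (by simp),
      ← neg_smul, ← neg_one_zpow_add_one, neg_one_zpow_congr]
    exact ⟨i, by ring⟩
  leibniz i x hx y := by
    have h1 := ((lieCoder_sq_zero_iff hl (gradeSign_one_of_degree hd)
      (gradeSign_one_of_degree₂ hl')).1 h0).2.1 _ x hx y
    rw [add_assoc, ← eq_neg_iff_add_eq_zero] at h1
    simp only [LinearMap.comp_apply]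
    rw [gradeSign_of_mem 𝒰 1 hx, gradeSign_of_mem 𝒰 1 (hd _ x hx)]
    simp only [map_smul, LinearMap.smul_apply, one_mul]
    rw [h1, neg_one_zpow_add_one, add_comm 1 i, neg_one_zpow_add_one, smul_smul, mul_neg,
      neg_one_zpow_mul_self, neg_add, smul_add, smul_neg, smul_neg, smul_smul, neg_mul_neg,
      neg_one_zpow_mul_self]
    module
  jacobi i j x hx y hy z := by
    have h1 := ((lieCoder_sq_zero_iff hl (gradeSign_one_of_degree hd)
      (gradeSign_one_of_degree₂ hl')).1 h0).2.2 _ _ x hx y hy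
    simp only [LinearMap.comp_apply]
    induction z using Decomposition.inductionOn 𝒰 with
    | zero => simp
    | add z z' hz hz' =>
      simp only [map_add, hz, hz', smul_add]
      abel
    | @homogeneous m z =>
      have h2 := h1 z
      have e1 := hl _ _ _ (hl' _ _ x hx z z.2) y hy
      rw [gradeSign_of_mem _ _ z.2, map_smul, map_smul, LinearMap.smul_apply, e1] at h2
      rw [gradeSign_of_mem 𝒰 1 hx, gradeSign_of_mem 𝒰 1 hy]
      simp only [map_smul, LinearMap.smul_apply, one_mul]
      rw [gradeSign_of_mem 𝒰 1 (hl' _ _ x hx y hy), map_smul, LinearMap.smul_apply]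
      -- With `y` moved to the front by symmetry in `e1`, the square-zero condition on three letters
      -- can be solved for the nested term on the left of the Jacobi identity.
      have h3 : l x (l y z) = -(((-1 : k) ^ (1 + i)) • (l (l x y) z +
          ((-1 : k) ^ ((1 + j) * m) * (-1 : k) ^ ((1 + i + m + -1) * (1 + j))) •
            l y (l x z))) := by
        have h4 := congrArg (fun v => ((-1 : k) ^ (1 + i)) • v) h2
        simp only [smul_add, smul_zero, smul_smul, neg_one_zpow_mul_self, one_smul] at h4
        rw [smul_add, smul_smul, ← add_eq_zero_iff_eq_neg, add_comm]
        exact h4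
      rw [h3]
      simp only [smul_neg, smul_add, smul_smul, ← zpow_add₀ (show (-1 : k) ≠ 0 by simp)]
      rw [neg_add, ← neg_smul, ← neg_smul, ← neg_one_zpow_add_one, ← neg_one_zpow_add_one]
      congr 2
      · exact neg_one_zpow_congr ⟨1, by ring⟩
      · exact neg_one_zpow_congr ⟨1 + i + m + j * m, by ring⟩

/-- The sign put into the bracket and the sign in `l₂` are parity operators for gradings that differ
by an even translation, so they cancel. -/
theorem ofLieCoder_l₂ : (ofLieCoder 𝒰 hl hd hl' h0).l₂ = l := by
  ext x y
  change l (gradeSign 𝒰 1 (gradeSign (gradedShift 1 (gradedShift 1 𝒰)) 1 x)) y = l x y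
  have h1 : gradeSign (gradedShift 1 (gradedShift 1 𝒰)) 1 x = gradeSign 𝒰 1 x := by
    induction x using Decomposition.inductionOn 𝒰 with
    | zero => simp
    | add x x' hx hx' => simp only [map_add, hx, hx']
    | @homogeneous i x =>
      have h2 : (x : U) ∈ gradedShift 1 (gradedShift 1 𝒰) (i - 2) := by
        change (x : U) ∈ 𝒰 (1 + (1 + (i - 2)))
        rw [show 1 + (1 + (i - 2)) = i by ring]
        exact x.2
      rw [gradeSign_of_mem _ _ h2, gradeSign_of_mem _ _ x.2, neg_one_zpow_congr]
      exact ⟨-1, by ring⟩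
  refine (congrArg (fun v => l (gradeSign 𝒰 1 v) y) h1).trans ?_
  exact congrArg (fun v => l v y) (gradeSign_self 𝒰 1 x)

theorem shiftDown_ofLieCoder : (ofLieCoder 𝒰 hl hd hl' h0).shiftDown = 𝒰 := by
  funext p
  change 𝒰 (1 + (-1 + p)) = 𝒰 p
  rw [show 1 + (-1 + p) = p by ring]

end EssSurj

/-- The two gradings are equal but not definitionally so, hence the operators live on formally
different algebras. As all of them are given by the same formulas in `d` and `l`, they coincide once
the gradings are identified; the decomposition is unique. -/
theorem _root_.PureDGBVAlgebra.mk_eq_mk {k : Type u} [Field k] {U : Type v} [AddCommGroup U]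
    [Module k U] {𝒲 𝒰 : ℤ → Submodule k U} [D𝒲 : Decomposition 𝒲] [D𝒰 : Decomposition 𝒰]
    (h𝒲 : 𝒲 = 𝒰) {d : U →ₗ[k] U} {l : U →ₗ[k] U →ₗ[k] U} (hl𝒲 : GradedSymm 𝒲 l)
    (hl : GradedSymm 𝒰 l) {A₁ A₂ : GrSym 𝒲 →ₗ[k] GrSym 𝒲} {B₁ B₂ : GrSym 𝒰 →ₗ[k] GrSym 𝒰}
    (hA₁ : A₁ = coder 𝒲 (d ∘ₗ proj 𝒲)) (hA₂ : A₂ = coder 𝒲 (extendTwo 𝒲 l hl𝒲))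
    (hB₁ : B₁ = coder 𝒰 (d ∘ₗ proj 𝒰)) (hB₂ : B₂ = coder 𝒰 (extendTwo 𝒰 l hl))
    (p : IsDGBV (deg 𝒲) A₁ A₂) (q : IsPureBV 𝒲 (dgBVSeq A₁ A₂))
    (p' : IsDGBV (deg 𝒰) B₁ B₂) (q' : IsPureBV 𝒰 (dgBVSeq B₁ B₂)) :
    PureDGBVAlgebra.mk U 𝒲 A₁ A₂ p q = PureDGBVAlgebra.mk U 𝒰 B₁ B₂ p' q' := by
  subst h𝒲
  have hD : D𝒲 = D𝒰 := Subsingleton.elim _ _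
  subst hD hA₁ hA₂ hB₁ hB₂
  rfl

/-- The shift `U[1]` is undone exactly by `𝔤[-1]`, so the given object is recovered by an equality
and not only up to isomorphism. -/
theorem exists_toBV_eq (V : PureDGBVAlgebra.{u, v} k) :
    ∃ g : DGLieAlgebra.{u, v} k, ∀ hg : g.IsPureDGBV, g.toBV hg = V := by
  obtain ⟨U, 𝒰, Δ₁, Δ₂, h, hp⟩ := V
  obtain ⟨d, l, hl, hd, hl', e₁, e₂, h0⟩ := exists_lieCoder h hp
  refine ⟨ofLieCoder 𝒰 hl hd hl' h0, fun hg => ?_⟩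
  set g := ofLieCoder 𝒰 hl hd hl' h0 with hgdef
  have hl₂ : g.l₂ = l := ofLieCoder_l₂ 𝒰 hl hd hl' h0
  -- The symmetry proof inside `extendTwo` depends on the bracket, so the bracket is replaced by a
  -- variable before the equality `g.l₂ = l` is used.
  have h1 : ∀ (l' : U →ₗ[k] U →ₗ[k] U) (_ : g.l₂ = l'), ∃ hl'' : GradedSymm g.shiftDown l',
      g.Δ₂ = coder g.shiftDown (extendTwo g.shiftDown l' hl'') := by
    rintro _ rfl
    exact ⟨g.l₂_symm_down, g.Δ₂_eq⟩
  obtain ⟨hl₃, h2⟩ := h1 l hl₂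
  exact PureDGBVAlgebra.mk_eq_mk (D𝒲 := gradedShift.decomposition (-1) (gradedShift 1 𝒰))
    (shiftDown_ofLieCoder 𝒰 hl hd hl' h0) hl₃ hl g.Δ₁_eq h2 e₁ e₂ hg.1 hg.2 h hp

end DGLieAlgebra

end

/-! ### The equivalence of categories. -/

theorem mainTheorem5 (k : Type u) [Field k] [CharZero k] :
    ∃ (hcat : PureDGBVAlgebra.FormsCategory.{u, v} k)
      (hobj : ∀ g : DGLieAlgebra.{u, v} k, g.IsPureDGBV)
      (hfun : DGLieAlgebra.BVFunctorial hobj),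
      letI := PureDGBVAlgebra.category hcat
      (DGLieAlgebra.bvFunctor hcat hobj hfun).IsEquivalence := by
  refine ⟨PureDGBVAlgebra.formsCategory k, DGLieAlgebra.isPureDGBV, DGLieAlgebra.bvFunctorial k, ?_⟩
  let := PureDGBVAlgebra.category (PureDGBVAlgebra.formsCategory.{u, v} k)
  refine { faithful := ⟨?_⟩, full := ⟨?_⟩, essSurj := ⟨?_⟩ }
  · intro g h Φ Ψ e
    exact DGLieAlgebra.bvMap_injective (congrArg PureDGBVAlgebra.Hom.φ e)
  · intro g h φ
    obtain ⟨Φ, hΦ⟩ := DGLieAlgebra.exists_bvMap_eq g.isPureDGBV h.isPureDGBV φ.isHom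
    exact ⟨Φ, PureDGBVAlgebra.Hom.ext hΦ⟩
  · intro V
    obtain ⟨g, hg⟩ := DGLieAlgebra.exists_toBV_eq V
    exact ⟨g, ⟨CategoryTheory.eqToIso (hg g.isPureDGBV)⟩⟩
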